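/- Let $d\in\mathbb N$. Write points of $\mathbb R^{2d}$ as $z=(q,p)$ with $q,p\in\mathbb R^d$, and let $J=\begin{pmatrix}0&\mathrm{Id}\\-\mathrm{Id}&0\end{pmatrix}$. For $\varepsilon>0$ and a symbol $a$ on $\mathbb R^{2d}$ let $$(\mathrm{op^{We}}(a)\psi)(q)=(2\pi\varepsilon)^{-d}\int_{\mathbb R^d}\int_{\mathbb R^d}a\big(\tfrac{q+y}{2},p\big)\,e^{i(q-y)\cdot p/\varepsilon}\,\psi(y)\,dy\,dp$$ (the $y$-integral is taken first; $\psi\in L^2(\mathbb R^d)$ if $a$ is a Schwartz function, $\psi\in\mathcal S(\mathbb R^d)$ if $a$ has subquadratic growth), and for a Schwartz function $b$ let $$\mathrm{op^{AW}}(b)=\mathrm{op^{We}}(b*G_{\varepsilon/2}),\qquad G_{\varepsilon/2}(z)=(\pi\varepsilon)^{-d}e^{-|z|^2/\varepsilon}.$$ A smooth function $a:\mathbb R^{2d}\to\mathbb R$ is of subquadratic growth if $\|\partial^\gamma a\|_\infty<\infty$ for all multi-indices $|\gamma|\ge2$. For smooth $a,b$ put $$\Theta_m(a,b)(z)=\frac{(-i)^m}{m!}\,A(D)^m\big(a(z)b(z')-b(z)a(z')\big)\Big|_{z'=z},\qquad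 A(D)\big(a(z)b(z')\big)=\tfrac12\,J\nabla a(z)\cdot\nabla b(z').$$ **Lemma.** Let $a:\mathbb R^{2d}\to\mathbb R$ be a smooth function of subquadratic growth, $b:\mathbb R^{2d}\to\mathbb R$ a Schwartz function, and $n\in\mathbb N$. For every $\varepsilon>0$ the operators $\mathrm{op^{We}}(a)$ and $\mathrm{op^{AW}}(b)$ map $\mathcal S(\mathbb R^d)$ into itself, and $\frac i\varepsilon[\mathrm{op^{We}}(a),\mathrm{op^{AW}}(b)]$ with domain $\mathcal S(\mathbb R^d)$ is essentially self-adjoint in $L^2(\mathbb R^d)$. Moreover there is a family $(\varrho_n^\varepsilon(a,b))_{\varepsilon>0}$ of Schwartz functions $\mathbb R^{2d}\to\mathbb R$ with $$\sup_{\varepsilon>0}\|\mathrm{op^{We}}(\varrho_n^\varepsilon(a,b))\|_{\mathcal L(L^2)}<\infty$$ such that for all $\varepsilon>0$, on $\mathcal S(\mathbb R^d)$, $$\frac i\varepsilon\big[\mathrm{op^{We}}(a),\mathrm{op^{AW}}(b)\big]=\sum_{k=0}^{n-1}\varepsilon^k\,\mathrm{op^{We}}(\theta_k(a,b))+\varepsilon^n\,\mathrm{op^{We}}(\varrho_n^\varepsilon(a,b)),$$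 where $$\theta_k(a,b)=i\sum_{\ell+m=k+1}\frac{1}{4^\ell\,\ell!}\,\Theta_m(a,\Delta^\ell b).$$ -/

import Mathlib

open MeasureTheory
open scoped SchwartzMap ContDiff Convolution

noncomputable section

namespace WeylCalculus

/-- Configuration space `ℝ^d` with its Euclidean structure. -/
abbrev Config (d : ℕ) : Type := EuclideanSpace ℝ (Fin d)

/-- Phase space `ℝ^{2d}` with its Euclidean structure. The coordinates indexed by `Sum.inl j` are
the positions `q_j`, those indexed by `Sum.inr j` are the momenta `p_j`. -/
abbrev Phase (d : ℕ) : Type := EuclideanSpace ℝ (Fin d ⊕ Fin d)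

/-- The Hilbert space `L²(ℝ^d)` of complex-valued functions. -/
abbrev L2 (d : ℕ) : Type := Lp ℂ 2 (volume : Measure (Config d))

/-- The phase space point `(q, p)`. -/
def phasePt {d : ℕ} (q p : Config d) : Phase d := WithLp.toLp 2 (Sum.elim q p)

/-- A smooth function of subquadratic growth: all derivatives of order at least two are bounded. -/
def IsSubquadratic {d : ℕ} (a : Phase d → ℝ) : Prop :=
  ContDiff ℝ ∞ a ∧ ∀ k : ℕ, 2 ≤ k → ∃ C : ℝ, ∀ z, ‖iteratedFDeriv ℝ k a z‖ ≤ C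

/-- The Weyl quantization of a symbol `a`,
`(op(a)ψ)(q) = (2πε)^{-d} ∫ (∫ a((q+y)/2, p) e^{i(q-y)·p/ε} ψ(y) dy) dp`.
For a Schwartz symbol `a` and `ψ` in `L²` the double integral converges absolutely. With the
`y`-integration carried out first, both integrals also converge absolutely for a symbol of
subquadratic growth and a Schwartz function `ψ`, because the inner integral then decays rapidly
in `p`. -/
def weyl {d : ℕ} (ε : ℝ) (a : Phase d → ℂ) (ψ : Config d → ℂ) (q : Config d) : ℂ :=
  (((2 * Real.pi * ε) ^ d : ℝ) : ℂ)⁻¹ *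
    ∫ p : Config d, ∫ y : Config d,
      a (phasePt ((2 : ℝ)⁻¹ • (q + y)) p) *
        Complex.exp (Complex.I * ((inner ℝ (q - y) p / ε : ℝ) : ℂ)) * ψ y

/-- The phase space Gaussian `G_{ε/2}(z) = (πε)^{-d} e^{-|z|²/ε}`, with covariance `(ε/2) Id`. -/
def gauss {d : ℕ} (ε : ℝ) (z : Phase d) : ℝ :=
  ((Real.pi * ε) ^ d)⁻¹ * Real.exp (-‖z‖ ^ 2 / ε)

/-- The Anti-Wick quantization, that is, the Weyl quantization of `b * G_{ε/2}`. -/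
def antiWick {d : ℕ} (ε : ℝ) (b : Phase d → ℝ) (ψ : Config d → ℂ) : Config d → ℂ :=
  weyl ε (fun z => (((b ⋆[ContinuousLinearMap.mul ℝ ℝ, volume] gauss ε) z : ℝ) : ℂ)) ψ

/-- A linear map `T` of the Schwartz space, regarded as an unbounded operator in `L²(ℝ^d)` whose
domain is the (image in `L²(ℝ^d)` of the) Schwartz space. -/
def onSchwartz {d : ℕ} (T : 𝓢(Config d, ℂ) →ₗ[ℂ] 𝓢(Config d, ℂ)) : L2 d →ₗ.[ℂ] L2 d where
  domain := LinearMap.range (SchwartzMap.toLpCLM ℂ ℂ 2 (volume : Measure (Config d))).toLinearMap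
  toFun := (SchwartzMap.toLpCLM ℂ ℂ 2 (volume : Measure (Config d))).toLinearMap ∘ₗ T ∘ₗ
    (LinearEquiv.ofInjective
      (SchwartzMap.toLpCLM ℂ ℂ 2 (volume : Measure (Config d))).toLinearMap
      (SchwartzMap.injective_toLp 2 volume)).symm.toLinearMap

/-- An unbounded operator is essentially self-adjoint on its domain if it is densely defined and
closable, and its closure is self-adjoint. -/
def IsEssentiallySelfAdjoint {d : ℕ} (T : L2 d →ₗ.[ℂ] L2 d) : Prop :=
  Dense (T.domain : Set (L2 d)) ∧ T.IsClosable ∧ IsSelfAdjoint T.closure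

/-- The matrix `J = (0 Id; -Id 0)`. -/
def matJ (d : ℕ) : Matrix (Fin d ⊕ Fin d) (Fin d ⊕ Fin d) ℝ := Matrix.fromBlocks 0 1 (-1) 0

/-- The partial derivative in the phase space coordinate with index `j`. -/
def partialDeriv {d : ℕ} (j : Fin d ⊕ Fin d) (f : Phase d → ℝ) (z : Phase d) : ℝ :=
  fderiv ℝ f z (EuclideanSpace.single j 1)

/-- The bidifferential operator `A(D) = (1/2) J∇_z · ∇_{z'}`, acting on functions `F(z, z')`. -/
def bidiff {d : ℕ} (F : Phase d → Phase d → ℝ) (z z' : Phase d) : ℝ :=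
  (1 / 2) * ∑ i, ∑ j, matJ d i j *
    partialDeriv i (fun w' => partialDeriv j (fun w => F w w') z) z'

/-- The coefficients of the Moyal bracket,
`Θ_k(a,b)(z) = ((-i)^k / k!) A(D)^k (a(z) b(z') - b(z) a(z')) |_{z' = z}`. -/
def moyalTheta {d : ℕ} (k : ℕ) (a b : Phase d → ℝ) (z : Phase d) : ℂ :=
  (-Complex.I) ^ k / (k.factorial : ℂ) *
    ((bidiff^[k] (fun w w' => a w * b w' - b w * a w') z z : ℝ) : ℂ)

/-- The coefficients
`θ_k(a,b) = i ∑_{ℓ+m=k+1} (4^ℓ ℓ!)^{-1} Θ_m(a, Δ^ℓ b)`. -/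
def commTheta {d : ℕ} (k : ℕ) (a b : Phase d → ℝ) (z : Phase d) : ℂ :=
  Complex.I * ∑ x ∈ Finset.HasAntidiagonal.antidiagonal (k + 1),
    ((4 : ℂ) ^ x.1 * (x.1.factorial : ℂ))⁻¹ *
      moyalTheta x.2 a ((Laplacian.laplacian : (Phase d → ℝ) → Phase d → ℝ)^[x.1] b) z

end WeylCalculus

end

/-! The symbols of both products are computed exactly and then studied as functions of ε. The Weyl
operator with symbol e^{2πi ξ·z} is a translation in q times a modulation, and op(c) is the
superposition of these operators with density ĉ, the Fourier transform of c (`weyl_eq_translate`).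
Composing each of them with op(a) only shifts the argument of a (`weyl_comp_translate`,
`translate_weyl`). Hence op(a)op(c) and op(c)op(a) have the symbols ∫ e^{2πi ξ·z} a(z ∓ πε Jξ) ĉ(ξ)
dξ (`weyl_weyl_right`, `weyl_weyl_left`). For an Anti-Wick operator ĉ(ξ) = e^{-επ²|ξ|²} b̂(ξ), so
these symbols are `compSymbol` with σ = ±1 at s = ε. They are Schwartz functions although a grows:
integration by parts in ξ produces arbitrary decay in z.

A derivative in s falls either on the Gaussian, where -π²|ξ|² b̂ is the transform of Δb/4, or on the
shift, where the factor Jξ becomes a derivative of b paired with one of a. The result is a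
combination of symbols of the same form for (a, Δb) and (∂_j a, ∂_i b). So all s-derivatives form
bounded families of Schwartz functions down to s = 0, and the binomial theorem evaluates them there.
The terms ab of order zero cancel in the commutator, the prefactor i/ε lowers the order by one, and
θ_k comes from the derivative of order k + 1 (`commTheta_eq`).

The remainder is bounded uniformly in ε by two different operator estimates. The translations are
isometries, so ‖op(c)‖ is at most the L¹ norm of ĉ, for every ε (`norm_opL2_le_fourier`). Together
with Taylor's formula for the Fourier transforms of the symbols this settles ε ≤ 1. Op(c) is also
(πε)^{-d} times a superposition of phase space reflections with density c, so ‖op(c)‖ is at most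
(πε)^{-d} times the L¹ norm of c (`norm_opL2_le`). For ε ≥ 1 the rescaling z = √ε y, ξ = u/√ε and
the linear growth of ∇a show that the commutator symbol has L¹ norm O(ε^{1+d}). Its operator norm is
then O(ε), and each subtracted Taylor term is at most a constant times ε^n, so division by ε^{n+1}
leaves a bounded family.

Complex conjugation exchanges the symbols for σ = 1 and σ = -1. Therefore i/ε times their difference
is a real Schwartz function, and the commutator extends from the Schwartz space to a bounded
self-adjoint operator. This gives essential self-adjointness. -/

noncomputable section

namespace WeylCalculus

/-! ### Oscillatory integrals with rapidly decaying amplitudes -/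

section Oscillatory

open Real FourierTransform

variable {ι X V W : Type} [NormedAddCommGroup X] [NormedSpace ℝ X]
  [NormedAddCommGroup V] [InnerProductSpace ℝ V]

/-- Families of smooth functions on `X × V` whose derivatives decay rapidly in the second variable,
uniformly up to the factor `(1 + ‖x‖) ^ M`, which is the same for derivatives of all orders. -/
structure IsAmplitude [NormedAddCommGroup W] [NormedSpace ℝ W] (M : ℕ) (F : ι → X × V → W) :
    Prop where
  smooth : ∀ i, ContDiff ℝ ∞ (F i)
  bound : ∀ k N : ℕ, ∃ C : ℝ, 0 ≤ C ∧ ∀ i x v,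
    (1 + ‖v‖) ^ N * ‖iteratedFDeriv ℝ k (F i) (x, v)‖ ≤ C * (1 + ‖x‖) ^ M

/-- Families of smooth functions on `X × V` whose derivatives grow polynomially in the second
variable, uniformly up to the factor `(1 + ‖x‖) ^ M`. -/
structure IsMultiplier [NormedAddCommGroup W] [NormedSpace ℝ W] (M : ℕ) (F : ι → X × V → W) :
    Prop where
  smooth : ∀ i, ContDiff ℝ ∞ (F i)
  bound : ∀ k : ℕ, ∃ (C : ℝ) (m : ℕ), 0 ≤ C ∧ ∀ i x v,
    ‖iteratedFDeriv ℝ k (F i) (x, v)‖ ≤ C * (1 + ‖v‖) ^ m * (1 + ‖x‖) ^ M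

/-- In the Leibniz formula the growth (1 + ‖v‖)^m of each derivative of the multiplier is paid for
by m additional powers of decay of the amplitude. -/
theorem IsMultiplier.bilin {W₁ W₂ W₃ : Type} [NormedAddCommGroup W₁] [NormedSpace ℝ W₁]
    [NormedAddCommGroup W₂] [NormedSpace ℝ W₂] [NormedAddCommGroup W₃] [NormedSpace ℝ W₃]
    {M₁ M₂ : ℕ} {f : ι → X × V → W₁} {F : ι → X × V → W₂} (B : W₁ →L[ℝ] W₂ →L[ℝ] W₃)
    (hf : IsMultiplier M₁ f) (hF : IsAmplitude M₂ F) :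
    IsAmplitude (M₁ + M₂) (fun i z => B (f i z) (F i z)) := by
  refine ⟨fun i => B.isBoundedBilinearMap.contDiff.comp ((hf.smooth i).prodMk (hF.smooth i)),
    fun k N => ?_⟩
  choose C m hC hfb using hf.bound
  choose D hD hFb using hF.bound
  refine ⟨‖B‖ * ∑ j ∈ Finset.range (k + 1), (k.choose j : ℝ) * (C j * D (k - j) (N + m j)), ?_,
    fun i x v => ?_⟩
  · exact mul_nonneg (norm_nonneg B) (Finset.sum_nonneg fun j _ =>
      mul_nonneg (Nat.cast_nonneg _) (mul_nonneg (hC _) (hD _ _)))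
  have h := B.norm_iteratedFDeriv_le_of_bilinear (hf.smooth i) (hF.smooth i) (x, v) (n := k)
    (by exact_mod_cast le_top)
  calc (1 + ‖v‖) ^ N * ‖iteratedFDeriv ℝ k (fun z => B (f i z) (F i z)) (x, v)‖
      ≤ (1 + ‖v‖) ^ N * (‖B‖ * ∑ j ∈ Finset.range (k + 1), (k.choose j : ℝ) *
          ‖iteratedFDeriv ℝ j (f i) (x, v)‖ * ‖iteratedFDeriv ℝ (k - j) (F i) (x, v)‖) := by
        gcongr
    _ = ‖B‖ * ∑ j ∈ Finset.range (k + 1), (k.choose j : ℝ) * ((1 + ‖v‖) ^ N *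
          ‖iteratedFDeriv ℝ j (f i) (x, v)‖ * ‖iteratedFDeriv ℝ (k - j) (F i) (x, v)‖) := by
        rw [mul_left_comm, Finset.mul_sum]
        congr 1
        exact Finset.sum_congr rfl fun j _ => by ring
    _ ≤ ‖B‖ * ∑ j ∈ Finset.range (k + 1), (k.choose j : ℝ) *
          ((C j * D (k - j) (N + m j)) * (1 + ‖x‖) ^ (M₁ + M₂)) := by
        refine mul_le_mul_of_nonneg_left (Finset.sum_le_sum fun j _ =>
          mul_le_mul_of_nonneg_left ?_ (Nat.cast_nonneg _)) (norm_nonneg B)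
        calc (1 + ‖v‖) ^ N * ‖iteratedFDeriv ℝ j (f i) (x, v)‖ *
              ‖iteratedFDeriv ℝ (k - j) (F i) (x, v)‖
            ≤ (1 + ‖v‖) ^ N * (C j * (1 + ‖v‖) ^ m j * (1 + ‖x‖) ^ M₁) *
              ‖iteratedFDeriv ℝ (k - j) (F i) (x, v)‖ := by gcongr; exact hfb j i x v
          _ = C j * (1 + ‖x‖) ^ M₁ * ((1 + ‖v‖) ^ (N + m j) *
              ‖iteratedFDeriv ℝ (k - j) (F i) (x, v)‖) := by ring
          _ ≤ C j * (1 + ‖x‖) ^ M₁ * (D (k - j) (N + m j) * (1 + ‖x‖) ^ M₂) := by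
              have := hFb (k - j) (N + m j) i x v
              have := hC j
              gcongr
          _ = _ := by ring
    _ = _ := by rw [mul_assoc, Finset.sum_mul]; congr 1
                exact Finset.sum_congr rfl fun j _ => by ring

theorem IsAmplitude.clm_comp {W₁ W₂ : Type} [NormedAddCommGroup W₁] [NormedSpace ℝ W₁]
    [NormedAddCommGroup W₂] [NormedSpace ℝ W₂] {M : ℕ} {F : ι → X × V → W₁}
    (hF : IsAmplitude M F) (B : W₁ →L[ℝ] W₂) : IsAmplitude M (fun i z => B (F i z)) := by
  refine ⟨fun i => B.contDiff.comp (hF.smooth i), fun k N => ?_⟩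
  obtain ⟨C, hC, h⟩ := hF.bound k N
  refine ⟨‖B‖ * C, by positivity, fun i x v => ?_⟩
  have h1 := B.norm_iteratedFDeriv_comp_left (f := F i) (x := (x, v)) (n := k)
    ((hF.smooth i).contDiffAt) (by exact_mod_cast le_top)
  calc (1 + ‖v‖) ^ N * ‖iteratedFDeriv ℝ k (fun z => B (F i z)) (x, v)‖
      ≤ (1 + ‖v‖) ^ N * (‖B‖ * ‖iteratedFDeriv ℝ k (F i) (x, v)‖) := by gcongr; exact h1
    _ = ‖B‖ * ((1 + ‖v‖) ^ N * ‖iteratedFDeriv ℝ k (F i) (x, v)‖) := by ring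
    _ ≤ ‖B‖ * (C * (1 + ‖x‖) ^ M) := mul_le_mul_of_nonneg_left (h i x v) (norm_nonneg B)
    _ = _ := by ring

theorem IsAmplitude.fderiv [NormedAddCommGroup W] [NormedSpace ℝ W] {M : ℕ} {F : ι → X × V → W}
    (hF : IsAmplitude M F) : IsAmplitude M (fun i z => fderiv ℝ (F i) z) := by
  refine ⟨fun i => (hF.smooth i).fderiv_right (by norm_cast), fun k N => ?_⟩
  obtain ⟨C, hC, h⟩ := hF.bound (k + 1) N
  refine ⟨C, hC, fun i x v => ?_⟩
  have := h i x v
  rwa [← norm_iteratedFDeriv_fderiv] at this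

theorem IsAmplitude.add [NormedAddCommGroup W] [NormedSpace ℝ W] {M : ℕ} {F G : ι → X × V → W}
    (hF : IsAmplitude M F) (hG : IsAmplitude M G) : IsAmplitude M (fun i z => F i z + G i z) := by
  refine ⟨fun i => (hF.smooth i).add (hG.smooth i), fun k N => ?_⟩
  obtain ⟨C, hC, h⟩ := hF.bound k N
  obtain ⟨D, hD, h'⟩ := hG.bound k N
  refine ⟨C + D, by positivity, fun i x v => ?_⟩
  rw [fun_iteratedFDeriv_add_apply (((hF.smooth i).of_le (by exact_mod_cast le_top)).contDiffAt)
    (((hG.smooth i).of_le (by exact_mod_cast le_top)).contDiffAt)]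
  calc _ ≤ (1 + ‖v‖) ^ N * (‖iteratedFDeriv ℝ k (F i) (x, v)‖ +
        ‖iteratedFDeriv ℝ k (G i) (x, v)‖) := by gcongr; exact norm_add_le _ _
    _ ≤ _ := by rw [mul_add, add_mul]; exact add_le_add (h i x v) (h' i x v)

theorem IsMultiplier.linear [NormedAddCommGroup W] [NormedSpace ℝ W] (B : V →L[ℝ] W) :
    IsMultiplier 0 (fun (_ : ι) (z : X × V) => B z.2) := by
  have e : (fun z : X × V => B z.2) = B.comp (ContinuousLinearMap.snd ℝ X V) := rfl
  refine ⟨fun _ => by rw [e]; exact ContinuousLinearMap.contDiff _, fun k => ?_⟩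
  set B' := B.comp (ContinuousLinearMap.snd ℝ X V)
  refine ⟨‖B‖ + ‖B'‖, 1, by positivity, fun _ x v => ?_⟩
  rw [e, pow_zero, mul_one, pow_one]
  match k with
  | 0 =>
    rw [norm_iteratedFDeriv_zero]
    calc ‖B' (x, v)‖ ≤ ‖B‖ * ‖v‖ := B.le_opNorm v
      _ ≤ _ := by nlinarith [norm_nonneg B, norm_nonneg B', norm_nonneg v,
                    mul_nonneg (norm_nonneg B') (norm_nonneg v)]
  | 1 =>
    rw [norm_iteratedFDeriv_one, ContinuousLinearMap.fderiv]
    nlinarith [norm_nonneg B, norm_nonneg B', norm_nonneg v,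
      mul_nonneg (norm_nonneg B') (norm_nonneg v), mul_nonneg (norm_nonneg B) (norm_nonneg v)]
  | k + 2 =>
    have : iteratedFDeriv ℝ (k + 2) B' (x, v) = 0 := by
      have h0 : _root_.fderiv ℝ B' = fun _ => B' := by ext1 y; exact B'.fderiv
      rw [← norm_eq_zero, ← norm_iteratedFDeriv_fderiv, h0,
        iteratedFDeriv_const_of_ne (by omega)]
      simp
    rw [this, norm_zero]
    positivity

variable [FiniteDimensional ℝ V] [MeasurableSpace V] [BorelSpace V]

/-- The Fourier transform in the second variable of a function on `X × V`, evaluated at `L x`. -/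
def osc [NormedAddCommGroup W] [NormedSpace ℂ W] (L : X →L[ℝ] V) (F : X × V → W) (x : X) : W :=
  ∫ v, 𝐞 (-(inner ℝ v (L x))) • F (x, v)

/-- An exponent large enough for integrability. -/
def decayExp (V : Type) [NormedAddCommGroup V] [InnerProductSpace ℝ V] : ℕ :=
  Module.finrank ℝ V + 1

theorem integrable_decay :
    Integrable (fun v : V => ((1 + ‖v‖) ^ (decayExp V))⁻¹) := by
  have := integrable_one_add_norm (E := V) (μ := volume) (r := (decayExp V : ℝ))
    (by simp [decayExp])
  refine this.congr (Filter.Eventually.of_forall fun v => ?_)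
  simp only
  rw [Real.rpow_neg (by positivity), Real.rpow_natCast]

theorem one_add_pow_le {t : ℝ} (ht : 0 ≤ t) (N : ℕ) : (1 + t) ^ N ≤ 2 ^ N * (1 + t ^ N) := by
  calc (1 + t) ^ N ≤ 2 ^ (N - 1) * (1 ^ N + t ^ N) := add_pow_le (by norm_num) ht N
    _ ≤ 2 ^ N * (1 + t ^ N) := by
      rw [one_pow]; gcongr
      · norm_num
      · omega

variable [NormedAddCommGroup W] [NormedSpace ℂ W]

/-- Fourier integrals decay as fast as the derivatives of the integrand permit. -/
theorem fourier_decay {f : V → W} (hf : ContDiff ℝ ∞ f) (N : ℕ) (I : ℕ → ℝ)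
    (h : ∀ n, Integrable (iteratedFDeriv ℝ n f) ∧ ∫ v, ‖iteratedFDeriv ℝ n f v‖ ≤ I n) (w : V) :
    ‖w‖ ^ N * ‖𝓕 f w‖ ≤ 2 ^ N * ∑ n ∈ Finset.range (N + 1), I n := by
  have := pow_mul_norm_iteratedFDeriv_fourier_le (K := 0) (N := ⊤) (f := f) hf
    (fun k n hk _ => by
      have : k = 0 := by exact_mod_cast nonpos_iff_eq_zero.mp hk
      subst this
      simpa using (h n).1.norm) (k := 0) (n := N) le_rfl le_top w
  simp only [norm_iteratedFDeriv_zero, pow_zero, one_mul, CharP.cast_eq_zero, mul_zero, zero_add,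
    Finset.range_one, Finset.singleton_product, Finset.sum_map,
    Function.Embedding.coeFn_mk] at this
  refine this.trans ?_
  gcongr with n hn
  exact (h n).2

omit [FiniteDimensional ℝ V] [MeasurableSpace V] [BorelSpace V] in
theorem IsAmplitude.norm_iteratedFDeriv_slice_le {M : ℕ} {F : ι → X × V → W}
    (hF : IsAmplitude M F) (i : ι) (x : X) (v : V) (n : ℕ) :
    ‖iteratedFDeriv ℝ n (fun v => F i (x, v)) v‖ ≤ ‖iteratedFDeriv ℝ n (F i) (x, v)‖ := by
  have e : (fun v => F i (x, v)) =
      (fun z => F i ((x, 0) + z)) ∘ (ContinuousLinearMap.inr ℝ X V) := by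
    ext v; simp
  have hs : ContDiff ℝ ∞ (fun z : X × V => F i ((x, 0) + z)) :=
    (hF.smooth i).comp (contDiff_const.add contDiff_id)
  rw [e, ContinuousLinearMap.iteratedFDeriv_comp_right _ hs _ (by exact_mod_cast le_top)]
  refine (ContinuousMultilinearMap.norm_compContinuousLinearMap_le _ _).trans ?_
  rw [iteratedFDeriv_comp_add_left]
  have h1 : ∏ _j : Fin n, ‖ContinuousLinearMap.inr ℝ X V‖ ≤ 1 :=
    Finset.prod_le_one (fun _ _ => norm_nonneg (ContinuousLinearMap.inr ℝ X V))
      (fun _ _ => ContinuousLinearMap.norm_inr_le_one ℝ X V)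
  calc _ ≤ ‖iteratedFDeriv ℝ n (F i) ((x, 0) + (ContinuousLinearMap.inr ℝ X V) v)‖ * 1 := by gcongr
    _ = _ := by simp

theorem IsAmplitude.integrable_slice {M : ℕ} {F : ι → X × V → W} (hF : IsAmplitude M F) (n : ℕ) :
    ∃ C : ℝ, 0 ≤ C ∧ ∀ i x, Integrable (iteratedFDeriv ℝ n (fun v => F i (x, v))) ∧
      ∫ v, ‖iteratedFDeriv ℝ n (fun v => F i (x, v)) v‖ ≤ C * (1 + ‖x‖) ^ M := by
  obtain ⟨C, hC, h⟩ := hF.bound n (decayExp V)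
  have hb : ∀ i x v, ‖iteratedFDeriv ℝ n (fun v => F i (x, v)) v‖ ≤
      (C * (1 + ‖x‖) ^ M) * ((1 + ‖v‖) ^ (decayExp V))⁻¹ := fun i x v => by
    refine (hF.norm_iteratedFDeriv_slice_le i x v n).trans ?_
    rw [← div_eq_mul_inv, le_div_iff₀ (by positivity), mul_comm]
    exact h i x v
  have hint : ∀ i x, Integrable (iteratedFDeriv ℝ n (fun v => F i (x, v))) := fun i x => by
    refine (integrable_decay.const_mul (C * (1 + ‖x‖) ^ M)).mono' ?_
      (Filter.Eventually.of_forall (hb i x))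
    have : ContDiff ℝ ∞ (fun v => F i (x, v)) := (hF.smooth i).comp (by fun_prop)
    exact (this.continuous_iteratedFDeriv (m := n) (by exact_mod_cast le_top)).aestronglyMeasurable
  refine ⟨C * ∫ v : V, ((1 + ‖v‖) ^ (decayExp V))⁻¹,
    mul_nonneg hC (integral_nonneg fun v => by positivity), fun i x => ⟨hint i x, ?_⟩⟩
  calc _ ≤ ∫ v : V, (C * (1 + ‖x‖) ^ M) * ((1 + ‖v‖) ^ (decayExp V))⁻¹ :=
        integral_mono (hint i x).norm (integrable_decay.const_mul _) (hb i x)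
    _ = _ := by rw [integral_const_mul]; ring

/-- Each integration by parts in v gains one power of `L x`. It costs one derivative of the
amplitude, which does not change the weight in x, since M is the same for derivatives of all orders.
-/
theorem IsAmplitude.osc_decay {M : ℕ} {F : ι → X × V → W} (hF : IsAmplitude M F)
    (L : X →L[ℝ] V) (N : ℕ) :
    ∃ C : ℝ, 0 ≤ C ∧ ∀ i x, (1 + ‖L x‖) ^ N * ‖osc L (F i) x‖ ≤ C * (1 + ‖x‖) ^ M := by
  choose C hC h using hF.integrable_slice
  have hcd : ∀ i x, ContDiff ℝ ∞ (fun v => F i (x, v)) := fun i x =>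
    (hF.smooth i).comp (by fun_prop)
  have key : ∀ N i x, ‖L x‖ ^ N * ‖osc L (F i) x‖ ≤
      2 ^ N * (∑ n ∈ Finset.range (N + 1), C n) * (1 + ‖x‖) ^ M := fun N i x => by
    have := fourier_decay (hcd i x) N (fun n => C n * (1 + ‖x‖) ^ M) (fun n => h n i x) (L x)
    rw [mul_assoc, Finset.sum_mul]
    exact this
  have hs : ∀ N, 0 ≤ ∑ n ∈ Finset.range (N + 1), C n := fun N => Finset.sum_nonneg fun n _ => hC n
  refine ⟨2 ^ N * (∑ n ∈ Finset.range (0 + 1), C n + 2 ^ N * ∑ n ∈ Finset.range (N + 1), C n),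
    ?_, fun i x => ?_⟩
  · have := hs N; have := hs 0; positivity
  calc (1 + ‖L x‖) ^ N * ‖osc L (F i) x‖
      ≤ (2 ^ N * (1 + ‖L x‖ ^ N)) * ‖osc L (F i) x‖ := by
        gcongr; exact one_add_pow_le (norm_nonneg _) N
    _ = 2 ^ N * (‖L x‖ ^ 0 * ‖osc L (F i) x‖ + ‖L x‖ ^ N * ‖osc L (F i) x‖) := by ring
    _ ≤ 2 ^ N * (2 ^ 0 * (∑ n ∈ Finset.range (0 + 1), C n) * (1 + ‖x‖) ^ M +
        2 ^ N * (∑ n ∈ Finset.range (N + 1), C n) * (1 + ‖x‖) ^ M) := by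
        exact mul_le_mul_of_nonneg_left (add_le_add (key 0 i x) (key N i x)) (by positivity)
    _ = _ := by ring

/-- The phase of `osc` as a bilinear form. -/
def oscPhase (L : X →L[ℝ] V) : V →L[ℝ] X →L[ℝ] ℝ :=
  ((ContinuousLinearMap.compL ℝ X V ℝ).flip L).comp (innerSL ℝ)

/-- The amplitude of the derivative of an oscillatory integral. -/
def oscDeriv (L : X →L[ℝ] V) (F : X × V → W) (z : X × V) : X →L[ℝ] W :=
  (fderiv ℝ F z).comp (ContinuousLinearMap.inl ℝ X V) +
    VectorFourier.fourierSMulRight (oscPhase L) (fun v => F (z.1, v)) z.2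

-- Differentiating the character brings down a factor linear in v, which is a multiplier of order 0
-- in x. So M does not increase, and derivatives of oscillatory integrals can be treated by
-- iteration.
omit [FiniteDimensional ℝ V] [MeasurableSpace V] [BorelSpace V] in
theorem IsAmplitude.oscDeriv {M : ℕ} {F : ι → X × V → W} (hF : IsAmplitude M F)
    (L : X →L[ℝ] V) : IsAmplitude M (fun i => oscDeriv L (F i)) := by
  refine IsAmplitude.add (hF.fderiv.clm_comp
    ((ContinuousLinearMap.compL ℝ X (X × V) W).flip (ContinuousLinearMap.inl ℝ X V))) ?_
  have h1 : IsMultiplier (ι := ι) 0 (fun (_ : ι) (z : X × V) => oscPhase L z.2) :=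
    IsMultiplier.linear (oscPhase L)
  have h2 := h1.bilin (ContinuousLinearMap.smulRightL ℝ X W) hF
  rw [zero_add] at h2
  have h3 := h2.clm_comp ((-(2 * π * Complex.I)) • ContinuousLinearMap.id ℝ (X →L[ℝ] W))
  exact h3

theorem IsAmplitude.hasFDerivAt_osc {M : ℕ} {F : ι → X × V → W} (hF : IsAmplitude M F)
    (L : X →L[ℝ] V) (i : ι) (x : X) :
    HasFDerivAt (osc L (F i)) (osc L (WeylCalculus.oscDeriv L (F i)) x) x := by
  obtain ⟨C, hC, hb⟩ := (hF.oscDeriv L).bound 0 (decayExp V)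
  have hcont : ∀ x, Continuous fun v => 𝐞 (-(inner ℝ v (L x))) • F i (x, v) := fun x => by
    have := (hF.smooth i).continuous
    exact (continuous_fourierChar.comp (by fun_prop)).smul (by fun_prop)
  have hcont' : Continuous fun v => 𝐞 (-(inner ℝ v (L x))) • WeylCalculus.oscDeriv L (F i) (x, v) := by
    have := ((hF.oscDeriv L).smooth i).continuous
    exact (continuous_fourierChar.comp (by fun_prop)).smul (by fun_prop)
  obtain ⟨C0, hC0, hb0⟩ := hF.integrable_slice 0
  refine hasFDerivAt_integral_of_dominated_of_fderiv_le
    (F' := fun x v => 𝐞 (-(inner ℝ v (L x))) • WeylCalculus.oscDeriv L (F i) (x, v))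
    -- The domination is needed on the unit ball around x, where 1 + ‖y‖ ≤ 2 + ‖x‖.
    (bound := fun v => (C * (2 + ‖x‖) ^ M) * ((1 + ‖v‖) ^ (decayExp V))⁻¹)
    (Metric.ball_mem_nhds x one_pos)
    (Filter.Eventually.of_forall fun x => (hcont x).aestronglyMeasurable) ?_
    hcont'.aestronglyMeasurable ?_ (integrable_decay.const_mul _) ?_
  · have := (hb0 i x).1.norm
    refine this.mono' (hcont x).aestronglyMeasurable (Filter.Eventually.of_forall fun v => ?_)
    rw [Circle.norm_smul, norm_iteratedFDeriv_zero]
  · refine Filter.Eventually.of_forall fun v y hy => ?_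
    have h1 := hb i y v
    rw [norm_iteratedFDeriv_zero] at h1
    rw [Circle.norm_smul _ (WeylCalculus.oscDeriv L (F i) (y, v)), ← div_eq_mul_inv,
      le_div_iff₀ (by positivity), mul_comm]
    refine h1.trans ?_
    have : ‖y‖ ≤ 1 + ‖x‖ := by
      have := norm_le_norm_add_norm_sub' y x
      have h2 : ‖y - x‖ < 1 := by simpa [dist_eq_norm] using hy
      linarith
    exact mul_le_mul_of_nonneg_left (pow_le_pow_left₀ (by positivity) (by linarith) M) hC
  · refine Filter.Eventually.of_forall fun v y _ => ?_
    have h1 : HasFDerivAt (fun y => F i (y, v))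
        ((_root_.fderiv ℝ (F i) (y, v)).comp (ContinuousLinearMap.inl ℝ X V)) y :=
      (((hF.smooth i).differentiable (by simp)).differentiableAt.hasFDerivAt).comp y
        (hasFDerivAt_prodMk_left y v)
    have h2 := VectorFourier.hasFDerivAt_fourierChar_smul (oscPhase L) (fun _ => (1 : ℂ)) v y
    have h3 := h2.smul h1
    have e : (fun y => 𝐞 (-(inner ℝ v (L y))) • F i (y, v)) =
        fun y => (𝐞 (-(oscPhase L v y)) • (1 : ℂ)) • F i (y, v) := by
      ext y
      rw [Circle.smul_def, Circle.smul_def, smul_eq_mul, mul_one]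
      rfl
    rw [e]
    refine h3.congr_fderiv ?_
    ext w
    have e2 : (inner ℝ v (L y) : ℝ) = oscPhase L v y := rfl
    simp only [WeylCalculus.oscDeriv, e2, Circle.smul_def, smul_eq_mul, mul_one,
      add_apply, smul_apply,
      ContinuousLinearMap.smulRight_apply, VectorFourier.fourierSMulRight_apply, smul_add,
      ContinuousLinearMap.comp_apply]
    congr 1
    rw [← Complex.coe_smul (oscPhase L v w) (F i (y, v)), Complex.real_smul, smul_smul, smul_smul]
    congr 1
    simp
    ring

/-- The derivative of an oscillatory integral is the oscillatory integral of `oscDeriv`, with values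
in `X →L[ℝ] W`. The value space changes at each step, so the induction quantifies over it. -/
theorem IsAmplitude.osc_bound {M : ℕ} (L : X →L[ℝ] V) (k : ℕ) :
    ∀ {W : Type} [NormedAddCommGroup W] [NormedSpace ℂ W] {F : ι → X × V → W},
      IsAmplitude M F → (∀ i, ContDiff ℝ k (osc L (F i))) ∧ ∀ N : ℕ, ∃ C : ℝ, 0 ≤ C ∧ ∀ i x,
        (1 + ‖L x‖) ^ N * ‖iteratedFDeriv ℝ k (osc L (F i)) x‖ ≤ C * (1 + ‖x‖) ^ M := by
  induction k with
  | zero =>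
    intro W _ _ F hF
    refine ⟨fun i => ?_, fun N => ?_⟩
    · exact contDiff_zero.2 (continuous_iff_continuousAt.2 fun x =>
        (hF.hasFDerivAt_osc L i x).continuousAt)
    · simpa only [norm_iteratedFDeriv_zero] using hF.osc_decay L N
  | succ k ih =>
    intro W _ _ F hF
    obtain ⟨h1, h2⟩ := ih (hF.oscDeriv L)
    have hd : ∀ i, _root_.fderiv ℝ (osc L (F i)) = osc L (WeylCalculus.oscDeriv L (F i)) :=
      fun i => by ext1 x; exact (hF.hasFDerivAt_osc L i x).fderiv
    refine ⟨fun i => ?_, fun N => ?_⟩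
    · rw [Nat.cast_succ, contDiff_succ_iff_fderiv]
      refine ⟨fun x => (hF.hasFDerivAt_osc L i x).differentiableAt, by simp, ?_⟩
      rw [hd]
      exact h1 i
    · obtain ⟨C, hC, h⟩ := h2 N
      refine ⟨C, hC, fun i x => ?_⟩
      rw [← norm_iteratedFDeriv_fderiv, hd]
      exact h i x

theorem IsAmplitude.contDiff_osc {M : ℕ} {F : ι → X × V → W} (hF : IsAmplitude M F)
    (L : X →L[ℝ] V) (i : ι) : ContDiff ℝ ∞ (osc L (F i)) :=
  contDiff_infty.2 fun k => (hF.osc_bound L k).1 i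

end Oscillatory

/-! ### Symbols of polynomial growth and bounded families of Schwartz functions -/

section Symbols

open Real FourierTransform

variable {ι X V W E : Type} [NormedAddCommGroup X] [NormedSpace ℝ X]
  [NormedAddCommGroup V] [InnerProductSpace ℝ V]
  [NormedAddCommGroup W] [NormedSpace ℝ W] [NormedAddCommGroup E] [NormedSpace ℝ E]

/-- Smooth functions all of whose derivatives are bounded by multiples of `(1 + ‖z‖) ^ M`. -/
def HasSymbolGrowth (M : ℕ) (a : E → W) : Prop :=
  ContDiff ℝ ∞ a ∧ ∀ k : ℕ, ∃ C : ℝ, 0 ≤ C ∧ ∀ z, ‖iteratedFDeriv ℝ k a z‖ ≤ C * (1 + ‖z‖) ^ M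

/-- Bounded families of Schwartz functions. -/
structure IsUniformSchwartz (ψ : ι → E → W) : Prop where
  smooth : ∀ i, ContDiff ℝ ∞ (ψ i)
  bound : ∀ k N : ℕ, ∃ C : ℝ, 0 ≤ C ∧ ∀ i v, (1 + ‖v‖) ^ N * ‖iteratedFDeriv ℝ k (ψ i) v‖ ≤ C

theorem norm_iteratedFDeriv_comp_clm_le {F G : Type} [NormedAddCommGroup F] [NormedSpace ℝ F]
    [NormedAddCommGroup G] [NormedSpace ℝ G] {f : F → W} (hf : ContDiff ℝ ∞ f)
    (L : G →L[ℝ] F) (k : ℕ) (x : G) :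
    ‖iteratedFDeriv ℝ k (fun x => f (L x)) x‖ ≤ ‖iteratedFDeriv ℝ k f (L x)‖ * ‖L‖ ^ k := by
  have h := ContinuousLinearMap.iteratedFDeriv_comp_right L hf x (i := k)
    (by exact_mod_cast le_top)
  rw [show (fun x => f (L x)) = f ∘ L from rfl, h]
  refine (ContinuousMultilinearMap.norm_compContinuousLinearMap_le _ _).trans ?_
  simp

theorem IsUniformSchwartz.isAmplitude {ψ : ι → V → W} (hψ : IsUniformSchwartz ψ) :
    IsAmplitude 0 (fun i (z : X × V) => ψ i z.2) := by
  refine ⟨fun i => (hψ.smooth i).comp contDiff_snd, fun k N => ?_⟩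
  obtain ⟨C, hC, h⟩ := hψ.bound k N
  refine ⟨C, hC, fun i x v => ?_⟩
  have h1 := norm_iteratedFDeriv_comp_clm_le (hψ.smooth i) (ContinuousLinearMap.snd ℝ X V) k (x, v)
  have h2 : ‖ContinuousLinearMap.snd ℝ X V‖ ^ k ≤ 1 :=
    pow_le_one₀ (norm_nonneg (ContinuousLinearMap.snd ℝ X V))
      (ContinuousLinearMap.norm_snd_le ℝ X V)
  rw [pow_zero, mul_one]
  refine le_trans ?_ (h i v)
  refine mul_le_mul_of_nonneg_left ?_ (by positivity)
  refine h1.trans ?_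
  exact mul_le_of_le_one_right (norm_nonneg _) h2

theorem HasSymbolGrowth.isMultiplier {M : ℕ} {a : E → W} (ha : HasSymbolGrowth M a)
    (L : ι → X × V →L[ℝ] E) {K : ℝ} (hL : ∀ i, ‖L i‖ ≤ K) :
    IsMultiplier M (fun i z => a (L i z)) := by
  refine ⟨fun i => ha.1.comp (L i).contDiff, fun k => ?_⟩
  obtain ⟨C, hC, h⟩ := ha.2 k
  refine ⟨C * (1 + |K|) ^ M * |K| ^ k, M, by positivity, fun i x v => ?_⟩
  have hLi : ‖L i‖ ≤ |K| := (hL i).trans (le_abs_self K)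
  have h0 : 1 + ‖L i (x, v)‖ ≤ (1 + |K|) * ((1 + ‖v‖) * (1 + ‖x‖)) := by
    have h1 : ‖L i (x, v)‖ ≤ |K| * (‖x‖ + ‖v‖) := by
      refine ((L i).le_opNorm _).trans ?_
      refine mul_le_mul hLi ?_ (norm_nonneg _) (abs_nonneg _)
      rw [Prod.norm_mk]
      exact max_le_add_of_nonneg (norm_nonneg _) (norm_nonneg _)
    have := mul_nonneg (abs_nonneg K) (mul_nonneg (norm_nonneg x) (norm_nonneg v))
    have := mul_nonneg (norm_nonneg x) (norm_nonneg v)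
    have := abs_nonneg K
    have := norm_nonneg x
    have := norm_nonneg v
    nlinarith
  calc _ ≤ ‖iteratedFDeriv ℝ k a (L i (x, v))‖ * ‖L i‖ ^ k :=
        norm_iteratedFDeriv_comp_clm_le ha.1 (L i) k (x, v)
    _ ≤ (C * (1 + ‖L i (x, v)‖) ^ M) * |K| ^ k :=
        mul_le_mul (h _) (pow_le_pow_left₀ (norm_nonneg (L i)) hLi k)
          (pow_nonneg (norm_nonneg (L i)) k) (by positivity)
    _ ≤ (C * ((1 + |K|) * ((1 + ‖v‖) * (1 + ‖x‖))) ^ M) * |K| ^ k := by gcongr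
    _ = _ := by rw [mul_pow, mul_pow]; ring

/-- The standard amplitude: a symbol composed with linear maps times a bounded family of Schwartz
functions. -/
theorem HasSymbolGrowth.isAmplitude {M : ℕ} {a : E → ℝ}
    (ha : HasSymbolGrowth M a) (L : ι → X × V →L[ℝ] E) {K : ℝ} (hL : ∀ i, ‖L i‖ ≤ K)
    {ψ : ι → V → ℂ} (hψ : IsUniformSchwartz ψ) :
    IsAmplitude M (fun i z => (a (L i z) : ℂ) * ψ i z.2) := by
  have h := (ha.isMultiplier L hL).bilin (ContinuousLinearMap.lsmul ℝ ℝ) (hψ.isAmplitude (X := X))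
  simpa only [ContinuousLinearMap.lsmul_apply, Complex.real_smul, add_zero] using h

theorem one_add_norm_pow_mul_le_seminorm (f : 𝓢(E, W)) (k N : ℕ) (x : E) :
    (1 + ‖x‖) ^ N * ‖iteratedFDeriv ℝ k f x‖ ≤
      2 ^ N * ((Finset.Iic (N, k)).sup fun m => SchwartzMap.seminorm ℝ m.1 m.2) f :=
  SchwartzMap.one_add_le_sup_seminorm_apply (𝕜 := ℝ) (m := (N, k)) le_rfl le_rfl f x

theorem _root_.SchwartzMap.isUniformSchwartz (f : 𝓢(E, W)) :
    IsUniformSchwartz (fun _ : ι => (f : E → W)) := by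
  refine ⟨fun _ => f.smooth _, fun k N => ⟨_, ?_, fun _ v =>
    one_add_norm_pow_mul_le_seminorm f k N v⟩⟩
  positivity

theorem _root_.SchwartzMap.hasSymbolGrowth (f : 𝓢(E, W)) (M : ℕ) : HasSymbolGrowth M f := by
  refine ⟨f.smooth _, fun k => ?_⟩
  obtain ⟨C, hC, h⟩ := (f.isUniformSchwartz (ι := Unit)).bound k 0
  refine ⟨C, hC, fun z => ?_⟩
  have h1 := h () z
  rw [pow_zero, one_mul] at h1
  exact h1.trans (le_mul_of_one_le_right hC (one_le_pow₀ (by linarith [norm_nonneg z])))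

/-- The Schwartz function given by a member of a bounded family. -/
def IsUniformSchwartz.toSchwartz {ψ : ι → E → W} (hψ : IsUniformSchwartz ψ) (i : ι) :
    𝓢(E, W) where
  toFun := ψ i
  smooth' := hψ.smooth i
  decay' k n := by
    obtain ⟨C, hC, h⟩ := hψ.bound n k
    refine ⟨C, fun x => le_trans ?_ (h i x)⟩
    gcongr
    linarith [norm_nonneg x]

@[simp] theorem IsUniformSchwartz.coe_toSchwartz {ψ : ι → E → W} (hψ : IsUniformSchwartz ψ)
    (i : ι) : ⇑(hψ.toSchwartz i) = ψ i := rfl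

theorem IsUniformSchwartz.add {ψ φ : ι → E → W} (hψ : IsUniformSchwartz ψ)
    (hφ : IsUniformSchwartz φ) : IsUniformSchwartz (fun i z => ψ i z + φ i z) := by
  refine ⟨fun i => (hψ.smooth i).add (hφ.smooth i), fun k N => ?_⟩
  obtain ⟨C, hC, h⟩ := hψ.bound k N
  obtain ⟨D, hD, h'⟩ := hφ.bound k N
  refine ⟨C + D, by positivity, fun i v => ?_⟩
  rw [fun_iteratedFDeriv_add_apply (((hψ.smooth i).of_le (by exact_mod_cast le_top)).contDiffAt)
    (((hφ.smooth i).of_le (by exact_mod_cast le_top)).contDiffAt)]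
  calc _ ≤ (1 + ‖v‖) ^ N * (‖iteratedFDeriv ℝ k (ψ i) v‖ + ‖iteratedFDeriv ℝ k (φ i) v‖) := by
        gcongr; exact norm_add_le _ _
    _ ≤ _ := by rw [mul_add]; exact add_le_add (h i v) (h' i v)

theorem IsUniformSchwartz.clm_comp {W' : Type} [NormedAddCommGroup W'] [NormedSpace ℝ W']
    {ψ : ι → E → W} (hψ : IsUniformSchwartz ψ) (B : W →L[ℝ] W') :
    IsUniformSchwartz (fun i z => B (ψ i z)) := by
  refine ⟨fun i => B.contDiff.comp (hψ.smooth i), fun k N => ?_⟩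
  obtain ⟨C, hC, h⟩ := hψ.bound k N
  refine ⟨‖B‖ * C, by positivity, fun i v => ?_⟩
  have h1 := B.norm_iteratedFDeriv_comp_left (f := ψ i) (x := v) (n := k)
    ((hψ.smooth i).contDiffAt) (by exact_mod_cast le_top)
  calc _ ≤ (1 + ‖v‖) ^ N * (‖B‖ * ‖iteratedFDeriv ℝ k (ψ i) v‖) := by gcongr; exact h1
    _ = ‖B‖ * ((1 + ‖v‖) ^ N * ‖iteratedFDeriv ℝ k (ψ i) v‖) := by ring
    _ ≤ _ := mul_le_mul_of_nonneg_left (h i v) (norm_nonneg B)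

theorem IsUniformSchwartz.const_smul {ψ : ι → E → ℂ} (hψ : IsUniformSchwartz ψ) (c : ℂ) :
    IsUniformSchwartz (fun i z => c * ψ i z) :=
  hψ.clm_comp (ContinuousLinearMap.mul ℝ ℂ c)

theorem IsUniformSchwartz.sum {κ : Type} {ψ : κ → ι → E → W} (s : Finset κ)
    (hψ : ∀ j ∈ s, IsUniformSchwartz (ψ j)) : IsUniformSchwartz (fun i z => ∑ j ∈ s, ψ j i z) := by
  classical
  induction s using Finset.induction_on with
  | empty => exact (0 : 𝓢(E, W)).isUniformSchwartz (ι := ι)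
  | insert j s hj ih =>
    simp only [Finset.sum_insert hj]
    exact (hψ j (by simp)).add (ih fun i hi => hψ i (by simp [hi]))

section Fourier

variable [FiniteDimensional ℝ V] [MeasurableSpace V] [BorelSpace V]

/-- If L is bounded below, decay in `L x` is decay in x; M of the N + M available powers cancel the
weight (1 + ‖x‖)^M. -/
theorem IsAmplitude.isUniformSchwartz_osc {W : Type} [NormedAddCommGroup W] [NormedSpace ℂ W]
    {M : ℕ} {F : ι → X × V → W} (hF : IsAmplitude M F) (L : X →L[ℝ] V) {K : ℝ}
    (hL : ∀ x, ‖x‖ ≤ K * ‖L x‖) : IsUniformSchwartz (fun i => osc L (F i)) := by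
  refine ⟨fun i => hF.contDiff_osc L i, fun k N => ?_⟩
  obtain ⟨C, hC, h⟩ := (hF.osc_bound L k).2 (N + M)
  refine ⟨(1 + |K|) ^ (N + M) * C, by positivity, fun i x => ?_⟩
  have h1 : 1 + ‖x‖ ≤ (1 + |K|) * (1 + ‖L x‖) := by
    have := hL x
    have := mul_le_mul_of_nonneg_right (le_abs_self K) (norm_nonneg (L x))
    have := norm_nonneg (L x)
    have := abs_nonneg K
    nlinarith
  have h2 : (0 : ℝ) < (1 + ‖x‖) ^ M := by positivity
  refine le_of_mul_le_mul_right ?_ h2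
  calc _ = (1 + ‖x‖) ^ (N + M) * ‖iteratedFDeriv ℝ k (osc L (F i)) x‖ := by ring
    _ ≤ ((1 + |K|) * (1 + ‖L x‖)) ^ (N + M) * ‖iteratedFDeriv ℝ k (osc L (F i)) x‖ := by gcongr
    _ = (1 + |K|) ^ (N + M) * ((1 + ‖L x‖) ^ (N + M) *
          ‖iteratedFDeriv ℝ k (osc L (F i)) x‖) := by rw [mul_pow]; ring
    _ ≤ (1 + |K|) ^ (N + M) * (C * (1 + ‖x‖) ^ M) :=
        mul_le_mul_of_nonneg_left (h i x) (by positivity)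
    _ = _ := by ring

/-- Here L is bounded below only in the second parameter, which takes over the role of the decaying
variable. This permits iterated oscillatory integrals: in the Weyl quantization the y-integral
decays in p and is then integrated in p. -/
theorem IsAmplitude.isAmplitude_osc {W V' : Type} [NormedAddCommGroup W] [NormedSpace ℂ W]
    [NormedAddCommGroup V'] [InnerProductSpace ℝ V'] {M : ℕ} {F : ι → (X × V') × V → W}
    (hF : IsAmplitude M F) (L : X × V' →L[ℝ] V) {K : ℝ}
    (hL : ∀ x v, ‖v‖ ≤ K * ‖L (x, v)‖) : IsAmplitude M (fun i => osc L (F i)) := by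
  refine ⟨fun i => hF.contDiff_osc L i, fun k N => ?_⟩
  obtain ⟨C, hC, h⟩ := (hF.osc_bound L k).2 (N + M)
  refine ⟨(1 + |K|) ^ (N + M) * C, by positivity, fun i x v => ?_⟩
  have h1 : 1 + ‖v‖ ≤ (1 + |K|) * (1 + ‖L (x, v)‖) := by
    have := hL x v
    have := mul_le_mul_of_nonneg_right (le_abs_self K) (norm_nonneg (L (x, v)))
    have := norm_nonneg (L (x, v))
    have := abs_nonneg K
    nlinarith
  have h3 : 1 + ‖(x, v)‖ ≤ (1 + ‖v‖) * (1 + ‖x‖) := by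
    have : ‖(x, v)‖ ≤ ‖x‖ + ‖v‖ := by
      rw [Prod.norm_mk]
      exact max_le_add_of_nonneg (norm_nonneg _) (norm_nonneg _)
    nlinarith [norm_nonneg x, norm_nonneg v, mul_nonneg (norm_nonneg x) (norm_nonneg v)]
  have h2 : (0 : ℝ) < (1 + ‖v‖) ^ M := by positivity
  refine le_of_mul_le_mul_right ?_ h2
  calc _ = (1 + ‖v‖) ^ (N + M) * ‖iteratedFDeriv ℝ k (osc L (F i)) (x, v)‖ := by ring
    _ ≤ ((1 + |K|) * (1 + ‖L (x, v)‖)) ^ (N + M) *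
          ‖iteratedFDeriv ℝ k (osc L (F i)) (x, v)‖ := by gcongr
    _ = (1 + |K|) ^ (N + M) * ((1 + ‖L (x, v)‖) ^ (N + M) *
          ‖iteratedFDeriv ℝ k (osc L (F i)) (x, v)‖) := by rw [mul_pow]; ring
    _ ≤ (1 + |K|) ^ (N + M) * (C * (1 + ‖(x, v)‖) ^ M) :=
        mul_le_mul_of_nonneg_left (h i (x, v)) (by positivity)
    _ ≤ (1 + |K|) ^ (N + M) * (C * ((1 + ‖v‖) * (1 + ‖x‖)) ^ M) := by gcongr
    _ = _ := by rw [mul_pow]; ring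

end Fourier

end Symbols

/-! ### Position and momentum coordinates and the symplectic map -/

section PhaseSpace

variable {d : ℕ}

/-- Phase space as a product of two copies of configuration space. -/
def phaseEquiv (d : ℕ) : Phase d ≃ₗᵢ[ℝ] WithLp 2 (Config d × Config d) :=
  PiLp.sumPiLpEquivProdLpPiLp 2 (fun _ => ℝ)

/-- The position component of a phase space point. -/
def posPart : Phase d →L[ℝ] Config d :=
  (WithLp.fstL 2 ℝ (Config d) (Config d)).comp (phaseEquiv d).toContinuousLinearEquiv.toContinuousLinearMap

/-- The momentum component of a phase space point. -/
def momPart : Phase d →L[ℝ] Config d :=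
  (WithLp.sndL 2 ℝ (Config d) (Config d)).comp (phaseEquiv d).toContinuousLinearEquiv.toContinuousLinearMap

/-- `phasePt` as a continuous linear map. -/
def phaseMk : Config d × Config d →L[ℝ] Phase d :=
  (phaseEquiv d).symm.toContinuousLinearEquiv.toContinuousLinearMap.comp
    (WithLp.prodContinuousLinearEquiv 2 ℝ (Config d) (Config d)).symm.toContinuousLinearMap

theorem phaseMk_apply (q p : Config d) : phaseMk (q, p) = phasePt q p := by
  ext i
  cases i <;> rfl

@[simp] theorem posPart_apply (z : Phase d) (j : Fin d) : posPart z j = z (Sum.inl j) := rfl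

@[simp] theorem momPart_apply (z : Phase d) (j : Fin d) : momPart z j = z (Sum.inr j) := rfl

@[simp] theorem posPart_phasePt (q p : Config d) : posPart (phasePt q p) = q := by
  ext j; rfl

@[simp] theorem momPart_phasePt (q p : Config d) : momPart (phasePt q p) = p := by
  ext j; rfl

theorem phasePt_add (q q' p p' : Config d) :
    phasePt (q + q') (p + p') = phasePt q p + phasePt q' p' := by
  ext j; cases j <;> rfl

theorem inner_phase (z w : Phase d) :
    inner ℝ z w = inner ℝ (posPart z) (posPart w) + inner ℝ (momPart z) (momPart w) := by
  simp [PiLp.inner_apply]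

theorem norm_sq_phase (z : Phase d) : ‖z‖ ^ 2 = ‖posPart z‖ ^ 2 + ‖momPart z‖ ^ 2 := by
  rw [← real_inner_self_eq_norm_sq, inner_phase, real_inner_self_eq_norm_sq,
    real_inner_self_eq_norm_sq]

theorem norm_posPart_le (z : Phase d) : ‖posPart z‖ ≤ ‖z‖ := by
  refine le_of_sq_le_sq ?_ (norm_nonneg _)
  nlinarith [norm_sq_phase z, sq_nonneg ‖momPart z‖]

theorem norm_momPart_le (z : Phase d) : ‖momPart z‖ ≤ ‖z‖ := by
  refine le_of_sq_le_sq ?_ (norm_nonneg _)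
  nlinarith [norm_sq_phase z, sq_nonneg ‖posPart z‖]

theorem measurePreserving_phaseMk :
    MeasurePreserving (fun x : Config d × Config d => phasePt x.1 x.2) := by
  have h := ((phaseEquiv d).symm.measurePreserving).comp
    (WithLp.volume_preserving_toLp (Config d) (Config d))
  convert h using 1
  ext1 x
  exact (phaseMk_apply x.1 x.2).symm

theorem measurableEmbedding_phaseMk :
    MeasurableEmbedding (fun x : Config d × Config d => phasePt x.1 x.2) := by
  have h : (fun x : Config d × Config d => phasePt x.1 x.2) =
      ((WithLp.prodContinuousLinearEquiv 2 ℝ (Config d) (Config d)).symm.trans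
        (phaseEquiv d).symm.toContinuousLinearEquiv).toHomeomorph := by
    ext1 x
    exact (phaseMk_apply x.1 x.2).symm
  rw [h]
  exact Homeomorph.measurableEmbedding _

theorem integral_phase {G : Type} [NormedAddCommGroup G] [NormedSpace ℝ G] (f : Phase d → G) :
    ∫ z, f z = ∫ x : Config d × Config d, f (phasePt x.1 x.2) :=
  (measurePreserving_phaseMk.integral_comp measurableEmbedding_phaseMk f).symm

theorem integrable_phase_iff {G : Type} [NormedAddCommGroup G] {f : Phase d → G} :
    Integrable f ↔ Integrable (fun x : Config d × Config d => f (phasePt x.1 x.2)) :=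
  (measurePreserving_phaseMk.integrable_comp_emb measurableEmbedding_phaseMk).symm

/-- The linear map `z ↦ J z`. -/
def symp : Phase d →L[ℝ] Phase d :=
  phaseMk.comp (momPart.prod (-posPart))

theorem symp_apply (z : Phase d) : symp z = phasePt (momPart z) (-posPart z) := by
  rw [← phaseMk_apply]; rfl

theorem symp_apply_eq_matJ (z : Phase d) (i : Fin d ⊕ Fin d) :
    symp z i = ∑ j, matJ d i j * z j := by
  rw [symp_apply]
  cases i <;> simp [matJ, phasePt, Matrix.one_apply]

theorem norm_symp (z : Phase d) : ‖symp z‖ = ‖z‖ := by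
  rw [← sq_eq_sq₀ (norm_nonneg _) (norm_nonneg _), norm_sq_phase, norm_sq_phase z, symp_apply]
  simp [add_comm]

end PhaseSpace

/-! ### Symbol growth of functions of subquadratic growth -/

section Subquadratic

variable {E : Type} [NormedAddCommGroup E] [NormedSpace ℝ E]

theorem HasSymbolGrowth.mono {W : Type} [NormedAddCommGroup W] [NormedSpace ℝ W] {M N : ℕ}
    {a : E → W} (ha : HasSymbolGrowth M a) (h : M ≤ N) : HasSymbolGrowth N a := by
  refine ⟨ha.1, fun k => ?_⟩
  obtain ⟨C, hC, h1⟩ := ha.2 k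
  refine ⟨C, hC, fun z => (h1 z).trans ?_⟩
  gcongr
  linarith [norm_nonneg z]

theorem norm_le_of_fderiv_le {W : Type} [NormedAddCommGroup W] [NormedSpace ℝ W] {f : E → W}
    (hf : ContDiff ℝ ∞ f) {M : ℕ} {C : ℝ} (hC : 0 ≤ C)
    (h : ∀ z, ‖fderiv ℝ f z‖ ≤ C * (1 + ‖z‖) ^ M) (z : E) :
    ‖f z‖ ≤ (‖f 0‖ + C) * (1 + ‖z‖) ^ (M + 1) := by
  have h1 : ‖f z - f 0‖ ≤ (C * (1 + ‖z‖) ^ M) * ‖z - 0‖ := by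
    refine Convex.norm_image_sub_le_of_norm_fderiv_le (s := Metric.closedBall 0 ‖z‖) (𝕜 := ℝ)
      (fun x _ => (hf.differentiable (by simp)).differentiableAt) (fun x hx => ?_)
      (convex_closedBall 0 ‖z‖) (by simp) (by simp)
    refine (h x).trans ?_
    have : ‖x‖ ≤ ‖z‖ := by simpa using hx
    gcongr
  have h2 : ‖f z‖ ≤ ‖f 0‖ + ‖f z - f 0‖ := norm_le_norm_add_norm_sub' (f z) (f 0)
  have h3 : (1 : ℝ) ≤ (1 + ‖z‖) ^ (M + 1) := one_le_pow₀ (by linarith [norm_nonneg z])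
  have h4 : C * (1 + ‖z‖) ^ M * ‖z‖ ≤ C * (1 + ‖z‖) ^ (M + 1) := by
    rw [pow_succ, ← mul_assoc]
    gcongr
    linarith
  rw [sub_zero] at h1
  nlinarith [norm_nonneg (f 0)]

/-- By the mean value inequality one integration raises the growth exponent by one. Two such steps
lead from bounded second derivatives to ∇a of order 1 and a of order 2. -/
theorem hasSymbolGrowth_of_fderiv {W : Type} [NormedAddCommGroup W] [NormedSpace ℝ W]
    {f : E → W} (hf : ContDiff ℝ ∞ f) {M : ℕ} (h : HasSymbolGrowth M (fderiv ℝ f)) :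
    HasSymbolGrowth (M + 1) f := by
  refine ⟨hf, fun k => ?_⟩
  cases k with
  | zero =>
    obtain ⟨C, hC, h1⟩ := h.2 0
    refine ⟨‖f 0‖ + C, by positivity, fun z => ?_⟩
    rw [norm_iteratedFDeriv_zero]
    refine norm_le_of_fderiv_le hf hC (fun z => ?_) z
    simpa using h1 z
  | succ k =>
    obtain ⟨C, hC, h1⟩ := (h.mono (Nat.le_succ M)).2 k
    refine ⟨C, hC, fun z => ?_⟩
    rw [← norm_iteratedFDeriv_fderiv]
    exact h1 z

theorem IsSubquadratic.hasSymbolGrowth_fderiv {d : ℕ} {a : Phase d → ℝ} (ha : IsSubquadratic a) :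
    HasSymbolGrowth 1 (fderiv ℝ a) := by
  have h1 : ContDiff ℝ ∞ (fderiv ℝ a) := ha.1.fderiv_right (by norm_cast)
  refine hasSymbolGrowth_of_fderiv h1 ⟨h1.fderiv_right (by norm_cast), fun k => ?_⟩
  obtain ⟨C, hC⟩ := ha.2 (k + 2) (by omega)
  refine ⟨|C|, abs_nonneg C, fun z => ?_⟩
  rw [norm_iteratedFDeriv_fderiv, norm_iteratedFDeriv_fderiv, pow_zero, mul_one]
  exact (hC z).trans (le_abs_self C)

theorem IsSubquadratic.hasSymbolGrowth {d : ℕ} {a : Phase d → ℝ} (ha : IsSubquadratic a) :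
    HasSymbolGrowth 2 a :=
  hasSymbolGrowth_of_fderiv ha.1 ha.hasSymbolGrowth_fderiv

theorem HasSymbolGrowth.partialDeriv {d M : ℕ} {a : Phase d → ℝ} (ha : HasSymbolGrowth M a)
    (j : Fin d ⊕ Fin d) : HasSymbolGrowth M (partialDeriv j a) := by
  have h1 : ContDiff ℝ ∞ (fderiv ℝ a) := ha.1.fderiv_right (by norm_cast)
  let ev := ContinuousLinearMap.apply ℝ ℝ (EuclideanSpace.single j (1 : ℝ) : Phase d)
  refine ⟨ev.contDiff.comp h1, fun k => ?_⟩
  obtain ⟨C, hC, h⟩ := ha.2 (k + 1)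
  refine ⟨‖ev‖ * C, by positivity, fun z => ?_⟩
  have h2 := ev.norm_iteratedFDeriv_comp_left (f := fderiv ℝ a) (x := z) (n := k)
    h1.contDiffAt (by exact_mod_cast le_top)
  rw [norm_iteratedFDeriv_fderiv] at h2
  refine h2.trans ?_
  rw [mul_assoc]
  exact mul_le_mul_of_nonneg_left (h z) (norm_nonneg ev)

end Subquadratic

/-! ### Linearity of oscillatory integrals in the amplitude -/

section OscLinear

open Real FourierTransform

variable {ι X V W : Type} [NormedAddCommGroup X] [NormedSpace ℝ X]
  [NormedAddCommGroup V] [InnerProductSpace ℝ V] [FiniteDimensional ℝ V] [MeasurableSpace V]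
  [BorelSpace V] [NormedAddCommGroup W] [NormedSpace ℂ W]

theorem IsAmplitude.integrable {M : ℕ} {F : ι → X × V → W} (hF : IsAmplitude M F) (i : ι) (x : X) :
    Integrable (fun v => F i (x, v)) := by
  obtain ⟨C, hC, h⟩ := hF.integrable_slice 0
  have := (h i x).1.norm
  simp only [norm_iteratedFDeriv_zero] at this
  refine this.mono' ?_ (Filter.Eventually.of_forall fun v => le_rfl)
  exact ((hF.smooth i).continuous.comp (by fun_prop)).aestronglyMeasurable

theorem IsAmplitude.integrable_osc {M : ℕ} {F : ι → X × V → W} (hF : IsAmplitude M F)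
    (L : X →L[ℝ] V) (i : ι) (x : X) :
    Integrable (fun v => 𝐞 (-(inner ℝ v (L x))) • F i (x, v)) := by
  refine (hF.integrable i x).norm.mono' ?_ (Filter.Eventually.of_forall fun v => ?_)
  · have := (hF.smooth i).continuous
    exact Continuous.aestronglyMeasurable
      ((continuous_fourierChar.comp (by fun_prop)).smul (by fun_prop))
  · rw [Circle.norm_smul]

theorem IsAmplitude.osc_add {M M' : ℕ} {F : ι → X × V → W} {G : ι → X × V → W}
    (hF : IsAmplitude M F) (hG : IsAmplitude M' G) (L : X →L[ℝ] V) (i : ι) :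
    osc L (fun z => F i z + G i z) = fun x => osc L (F i) x + osc L (G i) x := by
  ext1 x
  simp only [osc, smul_add]
  exact integral_add (hF.integrable_osc L i x) (hG.integrable_osc L i x)

theorem osc_const_smul (c : ℂ) (F : X × V → W) (L : X →L[ℝ] V) :
    osc L (fun z => c • F z) = fun x => c • osc L F x := by
  ext1 x
  simp only [osc]
  rw [← integral_smul]
  congr 1
  ext1 v
  rw [Circle.smul_def, Circle.smul_def, smul_comm]

end OscLinear

/-! ### Weyl quantization as a map of the Schwartz space -/

section WeylMap

open Real FourierTransform

variable {d : ℕ}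

/-- The linear map `((q, p), y) ↦ ((q + y) / 2, p)`. -/
def midPt (d : ℕ) : (Config d × Config d) × Config d →L[ℝ] Phase d :=
  phaseMk.comp (((2 : ℝ)⁻¹ • ((ContinuousLinearMap.fst ℝ (Config d) (Config d)).comp
    (ContinuousLinearMap.fst ℝ _ _) + ContinuousLinearMap.snd ℝ _ _)).prod
    ((ContinuousLinearMap.snd ℝ (Config d) (Config d)).comp (ContinuousLinearMap.fst ℝ _ _)))

theorem midPt_apply (q p y : Config d) :
    midPt d ((q, p), y) = phasePt ((2 : ℝ)⁻¹ • (q + y)) p := phaseMk_apply _ _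

/-- The integrand of the Weyl quantization without its oscillating factor. -/
def weylAmp (a : Phase d → ℝ) (ψ : Config d → ℂ) (z : (Config d × Config d) × Config d) : ℂ :=
  (a (midPt d z) : ℂ) * ψ z.2

/-- The frequency of the `y`-integration. -/
def innerFreq (d : ℕ) (ε : ℝ) : Config d × Config d →L[ℝ] Config d :=
  (2 * π * ε)⁻¹ • ContinuousLinearMap.snd ℝ _ _

/-- The frequency of the `p`-integration. -/
def outerFreq (d : ℕ) (ε : ℝ) : Config d →L[ℝ] Config d :=
  -(2 * π * ε)⁻¹ • ContinuousLinearMap.id ℝ _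

theorem fourierChar_eq_exp (t : ℝ) : (𝐞 t : ℂ) = Complex.exp (2 * π * t * Complex.I) := by
  rw [Real.fourierChar_apply]; push_cast; ring_nf

theorem exp_phase {ε : ℝ} (hε : ε ≠ 0) (s t : ℝ) :
    Complex.exp (Complex.I * (((s - t) / ε : ℝ) : ℂ)) =
      (𝐞 (s * (2 * π * ε)⁻¹) : ℂ) * (𝐞 (-(t * (2 * π * ε)⁻¹)) : ℂ) := by
  rw [fourierChar_eq_exp, fourierChar_eq_exp, ← Complex.exp_add]
  congr 1
  have h1 : (π : ℂ) ≠ 0 := by exact_mod_cast pi_ne_zero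
  have h2 : (ε : ℂ) ≠ 0 := by exact_mod_cast hε
  push_cast
  field_simp
  ring

/-- The kernel splits into two characters, one pairing y with p/(2πε) and one pairing p with
-q/(2πε). Thus the y-integral and the p-integral are both of the form `osc`. -/
theorem weyl_eq_osc {ε : ℝ} (hε : ε ≠ 0) (a : Phase d → ℝ) (ψ : Config d → ℂ) (q : Config d) :
    weyl ε (fun z => (a z : ℂ)) ψ q = (((2 * π * ε) ^ d : ℝ) : ℂ)⁻¹ *
      osc (outerFreq d ε) (osc (innerFreq d ε) (weylAmp a ψ)) q := by
  rw [weyl, osc]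
  congr 2
  ext1 p
  rw [osc, Circle.smul_def, smul_eq_mul, ← integral_const_mul]
  congr 1
  ext1 y
  rw [weylAmp, midPt_apply, inner_sub_left, exp_phase hε, Circle.smul_def, smul_eq_mul]
  simp only [outerFreq, innerFreq, smul_apply, ContinuousLinearMap.coe_snd',
    ContinuousLinearMap.id_apply, inner_smul_right]
  rw [real_inner_comm p q]
  ring_nf

theorem HasSymbolGrowth.isAmplitude_weylAmp {ι : Type} {M : ℕ} {a : Phase d → ℝ}
    (ha : HasSymbolGrowth M a) {ψ : ι → Config d → ℂ} (hψ : IsUniformSchwartz ψ) :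
    IsAmplitude M (fun i => weylAmp a (ψ i)) :=
  ha.isAmplitude (fun _ => midPt d) (fun _ => le_rfl) hψ

theorem HasSymbolGrowth.isAmplitude_inner {ι : Type} {M : ℕ} {a : Phase d → ℝ}
    (ha : HasSymbolGrowth M a) {ψ : ι → Config d → ℂ} (hψ : IsUniformSchwartz ψ) {ε : ℝ}
    (hε : ε ≠ 0) : IsAmplitude M (fun i => osc (innerFreq d ε) (weylAmp a (ψ i))) := by
  refine (ha.isAmplitude_weylAmp hψ).isAmplitude_osc (innerFreq d ε) (K := |2 * π * ε|)
    fun q p => le_of_eq ?_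
  simp only [innerFreq, smul_apply, ContinuousLinearMap.coe_snd', norm_smul, norm_inv,
    Real.norm_eq_abs]
  have : |2 * π * ε| ≠ 0 := abs_ne_zero.2 (by positivity)
  field_simp

theorem HasSymbolGrowth.isUniformSchwartz_weyl {ι : Type} {M : ℕ} {a : Phase d → ℝ}
    (ha : HasSymbolGrowth M a) {ψ : ι → Config d → ℂ} (hψ : IsUniformSchwartz ψ) {ε : ℝ}
    (hε : ε ≠ 0) : IsUniformSchwartz (fun i => weyl ε (fun z => (a z : ℂ)) (ψ i)) := by
  have h := ((ha.isAmplitude_inner hψ hε).isUniformSchwartz_osc (outerFreq d ε)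
    (K := |2 * π * ε|) fun q => le_of_eq ?_).const_smul (((2 * π * ε) ^ d : ℝ) : ℂ)⁻¹
  · convert h using 2
    ext1 q
    exact weyl_eq_osc hε a _ q
  · simp only [outerFreq, smul_apply, ContinuousLinearMap.id_apply, norm_smul, norm_neg, norm_inv,
      Real.norm_eq_abs]
    have : |2 * π * ε| ≠ 0 := abs_ne_zero.2 (by positivity)
    field_simp

/-- The Weyl quantization of a symbol of polynomial growth, acting on Schwartz functions. -/
def weylMap {M : ℕ} {a : Phase d → ℝ} (ha : HasSymbolGrowth M a) {ε : ℝ} (hε : ε ≠ 0) :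
    𝓢(Config d, ℂ) →ₗ[ℂ] 𝓢(Config d, ℂ) where
  toFun ψ := (ha.isUniformSchwartz_weyl (ψ.isUniformSchwartz (ι := Unit)) hε).toSchwartz ()
  map_add' ψ φ := by
    ext q
    have hψ := ψ.isUniformSchwartz (ι := Unit)
    have hφ := φ.isUniformSchwartz (ι := Unit)
    have e : weylAmp a (⇑(ψ + φ)) = fun z => weylAmp a ψ z + weylAmp a φ z := by
      ext1 z; simp [weylAmp, mul_add]
    simp only [IsUniformSchwartz.coe_toSchwartz, add_apply, weyl_eq_osc hε]
    rw [e, (ha.isAmplitude_weylAmp hψ).osc_add (ha.isAmplitude_weylAmp hφ) _ (),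
      (ha.isAmplitude_inner hψ hε).osc_add (ha.isAmplitude_inner hφ hε) _ (), mul_add]
  map_smul' c ψ := by
    ext q
    have e : weylAmp a (⇑(c • ψ)) = fun z => c • weylAmp a ψ z := by
      ext1 z; simp [weylAmp, mul_left_comm]
    simp only [IsUniformSchwartz.coe_toSchwartz, smul_apply, weyl_eq_osc hε, RingHom.id_apply]
    rw [e, osc_const_smul, osc_const_smul]
    simp only [smul_eq_mul]
    ring

theorem coe_weylMap {M : ℕ} {a : Phase d → ℝ} (ha : HasSymbolGrowth M a) {ε : ℝ} (hε : ε ≠ 0)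
    (ψ : 𝓢(Config d, ℂ)) : ⇑(weylMap ha hε ψ) = weyl ε (fun z => (a z : ℂ)) ψ := rfl

end WeylMap

/-! ### L² bounds for superpositions -/

section Superposition

open scoped ENNReal

/-- Cauchy-Schwarz with a weight. -/
theorem lintegral_mul_sq_le {Z : Type} [MeasurableSpace Z] {μ : Measure Z} {k f : Z → ℝ≥0∞}
    (hk : AEMeasurable k μ) (hf : AEMeasurable f μ) :
    (∫⁻ z, k z * f z ∂μ) ^ (2 : ℝ) ≤ (∫⁻ z, k z ∂μ) * ∫⁻ z, k z * f z ^ (2 : ℝ) ∂μ := by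
  have h := ENNReal.lintegral_mul_le_Lp_mul_Lq μ Real.HolderConjugate.two_two
    (f := fun z => k z ^ (1 / 2 : ℝ)) (g := fun z => k z ^ (1 / 2 : ℝ) * f z)
    (hk.pow_const _) ((hk.pow_const _).mul hf)
  have e1 : ∀ z, k z ^ (1 / 2 : ℝ) * (k z ^ (1 / 2 : ℝ) * f z) = k z * f z := fun z => by
    rw [← mul_assoc, ← ENNReal.rpow_add_of_nonneg _ _ (by norm_num) (by norm_num)]
    norm_num
  have e2 : ∀ z, (k z ^ (1 / 2 : ℝ)) ^ (2 : ℝ) = k z := fun z => by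
    rw [← ENNReal.rpow_mul]; norm_num
  have e3 : ∀ z, (k z ^ (1 / 2 : ℝ) * f z) ^ (2 : ℝ) = k z * f z ^ (2 : ℝ) := fun z => by
    rw [ENNReal.mul_rpow_of_nonneg _ _ (by norm_num), e2]
  simp only [Pi.mul_apply, e1, e2, e3] at h
  calc _ ≤ ((∫⁻ z, k z ∂μ) ^ (1 / 2 : ℝ) * (∫⁻ z, k z * f z ^ (2 : ℝ) ∂μ) ^ (1 / 2 : ℝ)) ^ (2 : ℝ) :=
        ENNReal.rpow_le_rpow h (by norm_num)
    _ = _ := by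
        rw [ENNReal.mul_rpow_of_nonneg _ _ (by norm_num), ← ENNReal.rpow_mul, ← ENNReal.rpow_mul]
        norm_num

/-- A superposition of functions that are bounded in `L²` is bounded in `L²`. -/
theorem eLpNorm_superposition_le {Z Q : Type} [MeasurableSpace Z] [MeasurableSpace Q]
    {μ : Measure Z} {ν : Measure Q} [SFinite μ] [SFinite ν] {K : Z → ℂ} {Φ : Z → Q → ℂ}
    (hK : AEStronglyMeasurable K μ)
    (hΦ : StronglyMeasurable (Function.uncurry Φ)) {B : ℝ≥0∞}
    (hB : ∀ z, eLpNorm (Φ z) 2 ν ≤ B) :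
    eLpNorm (fun q => ∫ z, K z * Φ z q ∂μ) 2 ν ≤ (∫⁻ z, ‖K z‖ₑ ∂μ) * B := by
  have hpow : ∀ g : Q → ℂ, eLpNorm g 2 ν = (∫⁻ q, ‖g q‖ₑ ^ (2 : ℝ) ∂ν) ^ (1 / 2 : ℝ) := fun g => by
    rw [eLpNorm_eq_lintegral_rpow_enorm_toReal (by norm_num) (by norm_num)]
    norm_num
  have hB2 : ∀ z, ∫⁻ q, ‖Φ z q‖ₑ ^ (2 : ℝ) ∂ν ≤ B ^ (2 : ℝ) := fun z => by
    have := ENNReal.rpow_le_rpow (hB z) (z := 2) (by norm_num)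
    rwa [hpow, ← ENNReal.rpow_mul, show (1 / 2 : ℝ) * 2 = 1 by norm_num, ENNReal.rpow_one] at this
  set A := ∫⁻ z, ‖K z‖ₑ ∂μ
  have hm : Measurable fun x : Z × Q => ‖Φ x.1 x.2‖ₑ := hΦ.enorm
  -- Cauchy-Schwarz with weight |K| and Tonelli replace Minkowski's integral inequality. Both hold
  -- in [0, ∞], so integrability of z ↦ K z * Φ z q need not be known beforehand.
  have key : ∫⁻ q, ‖∫ z, K z * Φ z q ∂μ‖ₑ ^ (2 : ℝ) ∂ν ≤ (A * B) ^ (2 : ℝ) := by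
    calc _ ≤ ∫⁻ q, A * ∫⁻ z, ‖K z‖ₑ * ‖Φ z q‖ₑ ^ (2 : ℝ) ∂μ ∂ν := by
          refine lintegral_mono fun q => ?_
          refine le_trans ?_ (lintegral_mul_sq_le hK.enorm
            (hm.comp measurable_prodMk_right).aemeasurable)
          refine ENNReal.rpow_le_rpow ((enorm_integral_le_lintegral_enorm _).trans ?_) (by norm_num)
          exact le_of_eq (lintegral_congr fun z => enorm_mul _ _)
      _ = A * ∫⁻ z, ∫⁻ q, ‖K z‖ₑ * ‖Φ z q‖ₑ ^ (2 : ℝ) ∂ν ∂μ := by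
          have hae : AEMeasurable (fun x : Q × Z => ‖K x.2‖ₑ * ‖Φ x.2 x.1‖ₑ ^ (2 : ℝ)) (ν.prod μ) :=
            (hK.enorm.comp_snd).mul ((hm.comp measurable_swap).pow_const _).aemeasurable
          rw [lintegral_const_mul'' _ hae.lintegral_prod_right', lintegral_lintegral_swap hae]
      _ = A * ∫⁻ z, ‖K z‖ₑ * ∫⁻ q, ‖Φ z q‖ₑ ^ (2 : ℝ) ∂ν ∂μ := by
          congr 1
          refine lintegral_congr fun z => ?_
          have hz : Measurable fun q => ‖Φ z q‖ₑ := hm.comp measurable_prodMk_left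
          rw [lintegral_const_mul _ (hz.pow_const _)]
      _ ≤ A * ∫⁻ z, ‖K z‖ₑ * B ^ (2 : ℝ) ∂μ := by
          gcongr with z
          exact hB2 z
      _ = (A * B) ^ (2 : ℝ) := by
          rw [lintegral_mul_const'' _ hK.enorm, ENNReal.mul_rpow_of_nonneg _ _ (by norm_num)]
          rw [← mul_assoc]
          congr 1
          rw [show (2 : ℝ) = ((2 : ℕ) : ℝ) by norm_num, ENNReal.rpow_natCast, sq]
  rw [hpow]
  calc _ ≤ ((A * B) ^ (2 : ℝ)) ^ (1 / 2 : ℝ) := ENNReal.rpow_le_rpow key (by norm_num)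
    _ = _ := by rw [← ENNReal.rpow_mul]; norm_num

end Superposition

/-! ### Weyl operators with Schwartz symbols as superpositions of reflections -/

section SchwartzSymbol

open Real FourierTransform

variable {d : ℕ}

theorem exists_decay_bound (c : 𝓢(Phase d, ℂ)) (r s : ℕ) : ∃ C : ℝ, 0 ≤ C ∧ ∀ q p : Config d,
    ‖c (phasePt q p)‖ ≤ C * (((1 + ‖q‖) ^ r)⁻¹ * ((1 + ‖p‖) ^ s)⁻¹) := by
  obtain ⟨C, hC, h⟩ := (c.isUniformSchwartz (ι := Unit)).bound 0 (r + s)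
  refine ⟨C, hC, fun q p => ?_⟩
  have h1 := h () (phasePt q p)
  rw [norm_iteratedFDeriv_zero] at h1
  have h2 := norm_posPart_le (phasePt q p)
  have h3 := norm_momPart_le (phasePt q p)
  rw [posPart_phasePt] at h2
  rw [momPart_phasePt] at h3
  rw [← mul_inv, ← div_eq_mul_inv, le_div_iff₀ (by positivity), mul_comm]
  refine le_trans ?_ h1
  rw [pow_add]
  gcongr

/-- The decaying factor is square integrable along affine maps. -/
theorem memLp_decay_comp (s : ℝ) (hs : s ≠ 0) (q : Config d) :
    MemLp (fun y : Config d => ((1 + ‖s • (q + y)‖) ^ (decayExp (Config d)))⁻¹) 2 := by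
  have hc : Continuous fun y : Config d => ((1 + ‖s • (q + y)‖) ^ (decayExp (Config d)))⁻¹ :=
    Continuous.inv₀ (by fun_prop) (fun y => by positivity)
  rw [memLp_two_iff_integrable_sq hc.aestronglyMeasurable]
  have h := ((integrable_decay (V := Config d)).comp_smul hs).comp_add_left q
  refine h.mono' (hc.pow 2).aestronglyMeasurable (Filter.Eventually.of_forall fun y => ?_)
  rw [Real.norm_eq_abs, abs_of_nonneg (by positivity), sq]
  refine mul_le_of_le_one_left (by positivity) (inv_le_one_of_one_le₀ (one_le_pow₀ ?_))
  linarith [norm_nonneg (s • (q + y))]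

/-- Absolute convergence of the Weyl quantization of a Schwartz symbol. -/
theorem integrable_weyl_symbol (c : 𝓢(Phase d, ℂ)) {ψ : Config d → ℂ} (hψ : MemLp ψ 2)
    (ε : ℝ) (q : Config d) :
    Integrable (fun x : Config d × Config d => c (phasePt ((2 : ℝ)⁻¹ • (q + x.2)) x.1) *
      Complex.exp (Complex.I * ((inner ℝ (q - x.2) x.1 / ε : ℝ) : ℂ)) * ψ x.2)
      (volume.prod volume) := by
  obtain ⟨C, hC, h⟩ := exists_decay_bound c (decayExp (Config d)) (decayExp (Config d))
  have h1 : Integrable fun y => ((1 + ‖(2 : ℝ)⁻¹ • (q + y)‖) ^ (decayExp (Config d)))⁻¹ * ‖ψ y‖ :=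
    (memLp_decay_comp (2 : ℝ)⁻¹ (by norm_num) q).integrable_mul hψ.norm
  have h2 := ((integrable_decay (V := Config d)).mul_prod h1).const_mul C
  refine h2.mono' ?_ (Filter.Eventually.of_forall fun x => ?_)
  · refine AEStronglyMeasurable.mul ?_ hψ.1.comp_snd
    have hc : Continuous fun x : Config d × Config d => phasePt ((2 : ℝ)⁻¹ • (q + x.2)) x.1 := by
      simp only [← phaseMk_apply]; fun_prop
    exact Continuous.aestronglyMeasurable ((c.continuous.comp hc).mul (by fun_prop))
  · rw [norm_mul, norm_mul, mul_comm Complex.I, Complex.norm_exp_ofReal_mul_I, mul_one]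
    calc _ ≤ C * (((1 + ‖(2 : ℝ)⁻¹ • (q + x.2)‖) ^ (decayExp (Config d)))⁻¹ *
          ((1 + ‖x.1‖) ^ (decayExp (Config d)))⁻¹) * ‖ψ x.2‖ := by gcongr; exact h _ _
      _ = _ := by ring

theorem weyl_congr_ae (ε : ℝ) (a : Phase d → ℂ) {ψ φ : Config d → ℂ} (h : ψ =ᵐ[volume] φ) :
    weyl ε a ψ = weyl ε a φ := by
  ext1 q
  simp only [weyl]
  congr 2
  ext1 p
  refine integral_congr_ae ?_
  filter_upwards [h] with y hy
  rw [hy]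

theorem weyl_add_fun (c : 𝓢(Phase d, ℂ)) {ψ φ : Config d → ℂ} (hψ : MemLp ψ 2) (hφ : MemLp φ 2)
    (ε : ℝ) (q : Config d) : weyl ε c (ψ + φ) q = weyl ε c ψ q + weyl ε c φ q := by
  have h1 := integrable_weyl_symbol c hψ ε q
  have h2 := integrable_weyl_symbol c hφ ε q
  simp only [weyl, ← mul_add]
  congr 1
  rw [← integral_add h1.integral_prod_left h2.integral_prod_left]
  refine integral_congr_ae ?_
  filter_upwards [h1.prod_right_ae, h2.prod_right_ae] with p hp1 hp2
  rw [← integral_add hp1 hp2]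
  simp only [Pi.add_apply, mul_add]

theorem weyl_smul_fun (a : Phase d → ℂ) (ψ : Config d → ℂ) (k : ℂ) (ε : ℝ) (q : Config d) :
    weyl ε a (k • ψ) q = k * weyl ε a ψ q := by
  simp only [weyl]
  rw [mul_left_comm]
  congr 1
  rw [← integral_const_mul]
  congr 1
  ext1 p
  rw [← integral_const_mul]
  congr 1
  ext1 y
  simp only [Pi.smul_apply, smul_eq_mul]
  ring

theorem weyl_add_symbol (c c' : 𝓢(Phase d, ℂ)) {ψ : Config d → ℂ} (hψ : MemLp ψ 2)
    (ε : ℝ) (q : Config d) : weyl ε (⇑(c + c')) ψ q = weyl ε c ψ q + weyl ε c' ψ q := by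
  have h1 := integrable_weyl_symbol c hψ ε q
  have h2 := integrable_weyl_symbol c' hψ ε q
  simp only [weyl, ← mul_add]
  congr 1
  rw [← integral_add h1.integral_prod_left h2.integral_prod_left]
  refine integral_congr_ae ?_
  filter_upwards [h1.prod_right_ae, h2.prod_right_ae] with p hp1 hp2
  rw [← integral_add hp1 hp2]
  simp only [add_apply, add_mul]

theorem weyl_smul_symbol (c : 𝓢(Phase d, ℂ)) (ψ : Config d → ℂ) (k : ℂ) (ε : ℝ) (q : Config d) :
    weyl ε (⇑(k • c)) ψ q = k * weyl ε c ψ q := by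
  simp only [weyl]
  rw [mul_left_comm]
  congr 1
  rw [← integral_const_mul]
  congr 1
  ext1 p
  rw [← integral_const_mul]
  congr 1
  ext1 y
  simp only [smul_apply, smul_eq_mul]
  ring

/-- The phase space reflection at `z`, acting on functions. -/
def reflect (ε : ℝ) (ψ : Config d → ℂ) (z : Phase d) (q : Config d) : ℂ :=
  Complex.exp (Complex.I * ((2 * inner ℝ (q - posPart z) (momPart z) / ε : ℝ) : ℂ)) *
    ψ ((2 : ℝ) • posPart z - q)

theorem integral_comp_two_smul_sub (f : Config d → ℂ) (q : Config d) :
    ∫ y, f y = 2 ^ d * ∫ x, f ((2 : ℝ) • x - q) := by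
  have h := Measure.integral_comp_smul (μ := (volume : Measure (Config d))) (fun y => f (y - q)) 2
  rw [integral_sub_right_eq_self] at h
  rw [h, finrank_euclideanSpace_fin, abs_of_nonneg (by positivity), Complex.real_smul, ← mul_assoc]
  push_cast
  rw [mul_inv_cancel₀ (pow_ne_zero d (by norm_num)), one_mul]

theorem reflect_memLp (ε : ℝ) {ψ : Config d → ℂ} (hm : StronglyMeasurable ψ) (z : Phase d) :
    eLpNorm (reflect ε ψ z) 2 volume = eLpNorm ψ 2 volume := by
  have h := eLpNorm_comp_measurePreserving (p := 2) (μ := volume)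
    (hm.aestronglyMeasurable (μ := volume))
    (Measure.measurePreserving_sub_left volume ((2 : ℝ) • posPart z))
  rw [← h]
  refine eLpNorm_congr_norm_ae (Filter.Eventually.of_forall fun q => ?_)
  rw [reflect, norm_mul, mul_comm Complex.I, Complex.norm_exp_ofReal_mul_I, one_mul]
  rfl

theorem stronglyMeasurable_reflect (ε : ℝ) {ψ : Config d → ℂ} (hm : StronglyMeasurable ψ) :
    StronglyMeasurable (Function.uncurry (reflect (d := d) ε ψ)) := by
  refine StronglyMeasurable.mul (Continuous.stronglyMeasurable ?_)
    (hm.comp_measurable (Continuous.measurable ?_))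
  · fun_prop
  · fun_prop

/-- The substitution y = 2x - q turns the midpoint (q + y)/2 into the integration variable x. Its
Jacobian 2^d changes the prefactor (2πε)^{-d} into (πε)^{-d}. -/
theorem weyl_eq_reflect (c : 𝓢(Phase d, ℂ)) {ψ : Config d → ℂ} (hm : StronglyMeasurable ψ)
    (hψ : MemLp ψ 2) (ε : ℝ) (q : Config d) :
    weyl ε c ψ q = (((π * ε) ^ d : ℝ) : ℂ)⁻¹ * ∫ z, c z * reflect ε ψ z q := by
  have hint := integrable_weyl_symbol c hψ ε q
  have h1 : ∀ p : Config d, ∫ y, c (phasePt ((2 : ℝ)⁻¹ • (q + y)) p) *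
      Complex.exp (Complex.I * ((inner ℝ (q - y) p / ε : ℝ) : ℂ)) * ψ y =
      2 ^ d * ∫ x, c (phasePt x p) * reflect ε ψ (phasePt x p) q := fun p => by
    rw [integral_comp_two_smul_sub _ q]
    congr 2
    ext1 x
    have e1 : (2 : ℝ)⁻¹ • (q + ((2 : ℝ) • x - q)) = x := by
      rw [add_sub_cancel, smul_smul]; norm_num
    have e2 : q - ((2 : ℝ) • x - q) = (2 : ℝ) • (q - x) := by
      rw [smul_sub, two_smul ℝ q]; abel
    rw [e1, e2, inner_smul_left, reflect, posPart_phasePt, momPart_phasePt, mul_assoc]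
    rfl
  have h2 : Integrable (fun x : Config d × Config d =>
      c (phasePt x.2 x.1) * reflect ε ψ (phasePt x.2 x.1) q) (volume.prod volume) := by
    obtain ⟨C, hC, h⟩ := exists_decay_bound c (decayExp (Config d)) (decayExp (Config d))
    have hsq : Integrable fun x : Config d => ‖ψ ((2 : ℝ) • x - q)‖ ^ 2 := by
      have h3 := (memLp_two_iff_integrable_sq_norm hψ.1).1 hψ
      exact (h3.comp_sub_right q).comp_smul (R := 2) (by norm_num)
    have hmem : MemLp (fun x : Config d => ψ ((2 : ℝ) • x - q)) 2 :=
      (memLp_two_iff_integrable_sq_norm (hm.comp_measurable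
        (Continuous.measurable (by fun_prop))).aestronglyMeasurable).2 hsq
    have h4 : Integrable fun x => ((1 + ‖(1 : ℝ) • (0 + x)‖) ^ (decayExp (Config d)))⁻¹ *
        ‖ψ ((2 : ℝ) • x - q)‖ :=
      (memLp_decay_comp (1 : ℝ) (by norm_num) 0).integrable_mul hmem.norm
    refine (((integrable_decay (V := Config d)).mul_prod h4).const_mul C).mono' ?_
      (Filter.Eventually.of_forall fun x => ?_)
    · have hc : Continuous fun x : Config d × Config d => phasePt x.2 x.1 := by
        simp only [← phaseMk_apply]; fun_prop
      refine AEStronglyMeasurable.mul (c.continuous.comp hc).aestronglyMeasurable ?_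
      exact ((stronglyMeasurable_reflect ε hm).comp_measurable
        (hc.measurable.prodMk measurable_const)).aestronglyMeasurable
    · rw [norm_mul, reflect, norm_mul, mul_comm Complex.I, Complex.norm_exp_ofReal_mul_I, one_mul,
        posPart_phasePt, zero_add, one_smul]
      calc _ ≤ C * (((1 + ‖x.2‖) ^ (decayExp (Config d)))⁻¹ *
            ((1 + ‖x.1‖) ^ (decayExp (Config d)))⁻¹) * ‖ψ ((2 : ℝ) • x.2 - q)‖ := by
              gcongr; exact h _ _
        _ = _ := by ring
  rw [weyl, integral_phase]
  simp only [h1]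
  rw [integral_const_mul]
  have h3 := integral_prod_symm (μ := (volume : Measure (Config d)))
    (ν := (volume : Measure (Config d)))
    (f := fun x : Config d × Config d => c (phasePt x.1 x.2) * reflect ε ψ (phasePt x.1 x.2) q)
    h2.swap
  rw [Measure.volume_eq_prod, h3, ← mul_assoc]
  congr 1
  push_cast
  rw [mul_assoc, mul_pow, mul_inv]
  field_simp

end SchwartzSymbol

/-! ### Weyl operators with Schwartz symbols as superpositions of translations -/

section Translate

open Real FourierTransform

variable {d : ℕ}

/-- The Weyl translation with frequency `ξ`, that is, the quantization of `z ↦ e^{2πi ξ·z}`. -/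
def translate (ε : ℝ) (ψ : Config d → ℂ) (ξ : Phase d) (q : Config d) : ℂ :=
  𝐞 (inner ℝ (posPart ξ) (q + (π * ε) • momPart ξ)) * ψ (q + (2 * π * ε) • momPart ξ)

/-- The inverse Fourier transform in the position variables. -/
def partialInv (g : 𝓢(Phase d, ℂ)) (x w : Config d) : ℂ :=
  ∫ v, 𝐞 (inner ℝ v x) • g (phasePt v w)

theorem integrable_partialInv (g : 𝓢(Phase d, ℂ)) (x : Config d) :
    Integrable (fun y : Config d × Config d => 𝐞 (inner ℝ y.2 x) • g (phasePt y.2 y.1))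
      (volume.prod volume) := by
  have h1 : Integrable (fun y : Config d × Config d => g (phasePt y.1 y.2)) :=
    integrable_phase_iff.1 g.integrable
  refine h1.swap.norm.mono' ?_ (Filter.Eventually.of_forall fun y => ?_)
  · have hc : Continuous fun x : Config d × Config d => phasePt x.2 x.1 := by
      simp only [← phaseMk_apply]; fun_prop
    exact Continuous.aestronglyMeasurable
      ((continuous_fourierChar.comp (by fun_prop)).smul (g.continuous.comp hc))
  · rw [Circle.norm_smul]; rfl

theorem continuous_partialInv (g : 𝓢(Phase d, ℂ)) (x : Config d) : Continuous (partialInv g x) := by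
  obtain ⟨C, hC, h⟩ := exists_decay_bound g (decayExp (Config d)) 0
  refine continuous_of_dominated (bound := fun v => C * ((1 + ‖v‖) ^ (decayExp (Config d)))⁻¹)
    (fun w => ?_) (fun w => Filter.Eventually.of_forall fun v => ?_)
    (integrable_decay.const_mul C) (Filter.Eventually.of_forall fun v => ?_)
  · have hc : Continuous fun v : Config d => phasePt v w := by
      simp only [← phaseMk_apply]; fun_prop
    exact Continuous.aestronglyMeasurable
      ((continuous_fourierChar.comp (by fun_prop)).smul (g.continuous.comp hc))
  · rw [Circle.norm_smul]
    simpa using h v w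
  · have hc : Continuous fun w : Config d => phasePt v w := by
      simp only [← phaseMk_apply]; fun_prop
    exact continuous_const.smul (g.continuous.comp hc)

theorem fourierInv_partialInv (g : 𝓢(Phase d, ℂ)) (x p : Config d) :
    𝓕⁻ (partialInv g x) p = 𝓕⁻ (g : Phase d → ℂ) (phasePt x p) := by
  have h1 := integrable_partialInv g x
  rw [Real.fourierInv_eq, Real.fourierInv_eq, integral_phase]
  have h2 : Integrable (fun y : Config d × Config d =>
      𝐞 (inner ℝ (phasePt y.2 y.1) (phasePt x p)) • g (phasePt y.2 y.1))
      (volume.prod volume) := by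
    have h3 : Integrable (fun y : Config d × Config d => g (phasePt y.1 y.2)) :=
      integrable_phase_iff.1 g.integrable
    refine h3.swap.norm.mono' ?_ (Filter.Eventually.of_forall fun y => ?_)
    · have hc : Continuous fun x : Config d × Config d => phasePt x.2 x.1 := by
        simp only [← phaseMk_apply]; fun_prop
      exact Continuous.aestronglyMeasurable
        ((continuous_fourierChar.comp (by fun_prop)).smul (g.continuous.comp hc))
    · rw [Circle.norm_smul]; rfl
  have h4 := integral_prod_symm (μ := (volume : Measure (Config d)))
    (ν := (volume : Measure (Config d)))
    (f := fun y : Config d × Config d =>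
      𝐞 (inner ℝ (phasePt y.1 y.2) (phasePt x p)) • g (phasePt y.1 y.2)) h2.swap
  rw [Measure.volume_eq_prod, h4]
  congr 1
  ext1 w
  rw [partialInv, Circle.smul_def, smul_eq_mul, ← integral_const_mul]
  congr 1
  ext1 v
  rw [inner_phase]
  simp only [posPart_phasePt, momPart_phasePt]
  rw [AddChar.map_add_eq_mul, Circle.smul_def, Circle.smul_def, Circle.coe_mul]
  simp only [smul_eq_mul]
  ring

/-- By Fubini, a partial inversion in the position variables followed by one in the momentum
variables is the full inversion and recovers c. The claim is Fourier inversion in p alone, applied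
to the continuous integrable function `partialInv (𝓕 c) x`. -/
theorem fourier_symbol_momentum (c : 𝓢(Phase d, ℂ)) (x w : Config d) :
    ∫ p, 𝐞 (-(inner ℝ p w)) • c (phasePt x p) = partialInv (𝓕 c) x w := by
  have e : ∀ p, 𝓕⁻ (partialInv (𝓕 c) x) p = c (phasePt x p) := fun p => by
    rw [fourierInv_partialInv, ← SchwartzMap.fourierInv_coe, FourierPair.fourierInv_fourier_eq]
  have hi : Integrable (𝓕 (partialInv (𝓕 c) x)) := by
    have e2 : ∀ p, 𝓕 (partialInv (𝓕 c) x) p = c (phasePt x (-p)) := fun p => by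
      rw [← e, Real.fourierInv_eq_fourier_neg, neg_neg]
    obtain ⟨C, hC, h⟩ := exists_decay_bound c 0 (decayExp (Config d))
    refine (integrable_decay.const_mul C).mono' ?_ (Filter.Eventually.of_forall fun p => ?_)
    · have hc : Continuous fun p : Config d => phasePt x (-p) := by
        simp only [← phaseMk_apply]; fun_prop
      have : 𝓕 (partialInv (𝓕 c) x) = fun p => c (phasePt x (-p)) := funext e2
      rw [this]
      exact (c.continuous.comp hc).aestronglyMeasurable
    · rw [e2]
      simpa using h x (-p)
  have h := MeasureTheory.Integrable.fourier_fourierInv_eq (V := Config d)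
    (f := partialInv (𝓕 c) x) (integrable_partialInv (𝓕 c) x).integral_prod_left hi
    (v := w) (continuous_partialInv (𝓕 c) x).continuousAt
  rw [← h, Real.fourier_eq]
  simp only [e]

theorem stronglyMeasurable_translate (ε : ℝ) {ψ : Config d → ℂ} (hψ : Continuous ψ) :
    StronglyMeasurable (Function.uncurry (translate (d := d) ε ψ)) := by
  refine Continuous.stronglyMeasurable ?_
  simp only [Function.uncurry_def, translate]
  refine Continuous.mul ?_ (hψ.comp (by fun_prop))
  exact continuous_subtype_val.comp (continuous_fourierChar.comp (by fun_prop))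

theorem norm_translate (ε : ℝ) (ψ : Config d → ℂ) (ξ : Phase d) (q : Config d) :
    ‖translate ε ψ ξ q‖ = ‖ψ (q + (2 * π * ε) • momPart ξ)‖ := by
  rw [translate, norm_mul, Circle.norm_coe, one_mul]

theorem eLpNorm_translate (ε : ℝ) {ψ : Config d → ℂ} (hψ : AEStronglyMeasurable ψ volume)
    (ξ : Phase d) : eLpNorm (translate ε ψ ξ) 2 volume = eLpNorm ψ 2 volume := by
  have h := eLpNorm_comp_measurePreserving (p := 2) (μ := volume) hψ
    (measurePreserving_add_right volume ((2 * π * ε) • momPart ξ))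
  rw [← h]
  refine eLpNorm_congr_norm_ae (Filter.Eventually.of_forall fun q => ?_)
  rw [norm_translate]
  rfl

theorem integrable_mul_translate (g : 𝓢(Phase d, ℂ)) (ψ : 𝓢(Config d, ℂ)) (ε : ℝ)
    (q : Config d) : Integrable (fun ξ => g ξ * translate ε ψ ξ q) := by
  obtain ⟨C, hC, h⟩ := (ψ.isUniformSchwartz (ι := Unit)).bound 0 0
  refine (g.integrable.norm.mul_const C).mono' ?_ (Filter.Eventually.of_forall fun ξ => ?_)
  · refine g.continuous.aestronglyMeasurable.mul ?_
    exact ((stronglyMeasurable_translate ε ψ.continuous).comp_measurable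
      measurable_prodMk_right).aestronglyMeasurable
  · rw [norm_mul, norm_translate]
    gcongr
    simpa using h () (q + (2 * π * ε) • momPart ξ)

/-- Weyl quantization as a superposition of translations. -/
theorem weyl_eq_translate (c : 𝓢(Phase d, ℂ)) (ψ : 𝓢(Config d, ℂ)) {ε : ℝ} (hε : 0 < ε)
    (q : Config d) : weyl ε c ψ q = ∫ ξ, (𝓕 c) ξ * translate ε ψ ξ q := by
  have hint := integrable_weyl_symbol c (ψ.memLp 2) ε q
  have hinner : ∀ y : Config d, ∫ p, c (phasePt ((2 : ℝ)⁻¹ • (q + y)) p) *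
      Complex.exp (Complex.I * ((inner ℝ (q - y) p / ε : ℝ) : ℂ)) * ψ y =
      partialInv (𝓕 c) ((2 : ℝ)⁻¹ • (q + y)) ((2 * π * ε)⁻¹ • (y - q)) * ψ y := fun y => by
    rw [integral_mul_const, ← fourier_symbol_momentum]
    congr 2
    ext1 p
    rw [Circle.smul_def, smul_eq_mul, mul_comm, inner_sub_left, exp_phase hε.ne', ← Circle.coe_mul,
      ← AddChar.map_add_eq_mul, inner_smul_right, inner_sub_right, real_inner_comm p y,
      real_inner_comm p q]
    congr 3
    ring
  rw [weyl, integral_integral_swap hint]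
  simp only [hinner]
  -- The substitution y = q + 2πε w has Jacobian (2πε)^d, which cancels the prefactor; the resulting
  -- bound is therefore uniform in ε.
  have h1 : ∀ G : Config d → ℂ, ∫ y, G y =
      (((2 * π * ε) ^ d : ℝ) : ℂ) * ∫ w, G (q + (2 * π * ε) • w) := fun G => by
    have hpos : 0 < (2 * π * ε) ^ d := by positivity
    rw [Measure.integral_comp_smul_of_nonneg (μ := (volume : Measure (Config d)))
      (fun w => G (q + w)) (2 * π * ε) (hR := by positivity), integral_add_left_eq_self,
      finrank_euclideanSpace_fin, Complex.real_smul, ← mul_assoc, ← Complex.ofReal_mul,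
      mul_inv_cancel₀ hpos.ne', Complex.ofReal_one, one_mul]
  have hpos : (((2 * π * ε) ^ d : ℝ) : ℂ) ≠ 0 := by
    have : 0 < (2 * π * ε) ^ d := by positivity
    exact_mod_cast this.ne'
  rw [h1, ← mul_assoc, inv_mul_cancel₀ hpos, one_mul, integral_phase]
  have h2 := integrable_phase_iff.1 (integrable_mul_translate (𝓕 c) ψ ε q)
  rw [Measure.volume_eq_prod] at h2 ⊢
  rw [integral_prod_symm _ h2]
  congr 1
  ext1 w
  have e1 : (2 : ℝ)⁻¹ • (q + (q + (2 * π * ε) • w)) = q + (π * ε) • w := by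
    rw [← add_assoc, ← two_smul ℝ q, smul_add, smul_smul, smul_smul]
    congr 1
    · norm_num
    · congr 1; ring
  have e2 : (2 * π * ε)⁻¹ • (q + (2 * π * ε) • w - q) = w := by
    rw [add_sub_cancel_left, smul_smul, inv_mul_cancel₀ (by positivity), one_smul]
  rw [e1, e2, partialInv, ← integral_mul_const]
  congr 1
  ext1 v
  rw [translate, posPart_phasePt, momPart_phasePt, Circle.smul_def, smul_eq_mul]
  ring

end Translate

/-! ### Bounded operators on L², their norms and self-adjointness -/

section OpL2

open Real FourierTransform

variable {d : ℕ}

/-- Reflections are isometries of L². The estimate holds for all of L², so it serves to define the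
operator; its factor ε^{-d} is what controls large ε. -/
theorem eLpNorm_weyl_le (c : 𝓢(Phase d, ℂ)) (ε : ℝ) (ψ : L2 d) :
    eLpNorm (weyl ε c ψ) 2 volume ≤
      ENNReal.ofReal (|((π * ε) ^ d)⁻¹| * ∫ z, ‖c z‖) * eLpNorm ψ 2 volume := by
  have hm := Lp.stronglyMeasurable ψ
  have h1 := eLpNorm_superposition_le (μ := (volume : Measure (Phase d)))
    (ν := (volume : Measure (Config d))) c.continuous.aestronglyMeasurable
    (stronglyMeasurable_reflect ε hm) (fun z => (reflect_memLp ε hm z).le)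
  have e : weyl ε c ψ = (((π * ε) ^ d : ℝ) : ℂ)⁻¹ • fun q => ∫ z, c z * reflect ε ψ z q := by
    ext1 q
    exact weyl_eq_reflect c hm (Lp.memLp ψ) ε q
  rw [e, eLpNorm_const_smul, ENNReal.ofReal_mul (abs_nonneg _), mul_assoc]
  refine mul_le_mul' (le_of_eq ?_) (h1.trans_eq ?_)
  · rw [← Complex.ofReal_inv, ← ofReal_norm, Complex.norm_real, Real.norm_eq_abs]
  · rw [ofReal_integral_norm_eq_lintegral_enorm c.integrable]

theorem stronglyMeasurable_weyl (c : 𝓢(Phase d, ℂ)) (ε : ℝ) {ψ : Config d → ℂ}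
    (hm : StronglyMeasurable ψ) (hψ : MemLp ψ 2) : StronglyMeasurable (weyl ε c ψ) := by
  have e : weyl ε c ψ = fun q => (((π * ε) ^ d : ℝ) : ℂ)⁻¹ * ∫ z, c z * reflect ε ψ z q :=
    funext fun q => weyl_eq_reflect c hm hψ ε q
  rw [e]
  have h1 : StronglyMeasurable (Function.uncurry fun (q : Config d) (z : Phase d) =>
      c z * reflect ε ψ z q) := by
    have ha : StronglyMeasurable fun x : Config d × Phase d => c x.2 :=
      (c.continuous.comp continuous_snd).stronglyMeasurable
    have hb := (stronglyMeasurable_reflect ε hm).comp_measurable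
      (measurable_swap (α := Config d) (β := Phase d))
    exact ha.mul hb
  have h2 : StronglyMeasurable fun q => ∫ z, c z * reflect ε ψ z q :=
    StronglyMeasurable.integral_prod_right (ν := (volume : Measure (Phase d))) h1
  exact stronglyMeasurable_const.mul h2

theorem memLp_weyl (c : 𝓢(Phase d, ℂ)) (ε : ℝ) (ψ : L2 d) : MemLp (weyl ε c ψ) 2 := by
  have h1 : StronglyMeasurable (weyl ε c ψ) :=
    stronglyMeasurable_weyl c ε (Lp.stronglyMeasurable ψ) (Lp.memLp ψ)
  have h2 : eLpNorm (weyl ε c ψ) 2 volume < ⊤ := (eLpNorm_weyl_le c ε ψ).trans_lt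
    (ENNReal.mul_lt_top ENNReal.ofReal_lt_top (Lp.eLpNorm_lt_top ψ))
  exact ⟨h1.aestronglyMeasurable, h2⟩

/-- The Weyl quantization of a Schwartz symbol as a bounded operator. -/
def opL2 (ε : ℝ) (c : 𝓢(Phase d, ℂ)) : L2 d →L[ℂ] L2 d :=
  LinearMap.mkContinuous
    { toFun := fun ψ => (memLp_weyl c ε ψ).toLp
      map_add' := fun ψ φ => by
        rw [← MemLp.toLp_add]
        refine MemLp.toLp_congr _ _ (Filter.Eventually.of_forall fun q => ?_)
        rw [weyl_congr_ae ε c (Lp.coeFn_add ψ φ)]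
        exact weyl_add_fun c (Lp.memLp ψ) (Lp.memLp φ) ε q
      map_smul' := fun k ψ => by
        rw [RingHom.id_apply, ← MemLp.toLp_const_smul]
        refine MemLp.toLp_congr _ _ (Filter.Eventually.of_forall fun q => ?_)
        rw [weyl_congr_ae ε c (Lp.coeFn_smul k ψ)]
        exact weyl_smul_fun c ψ k ε q }
    (|((π * ε) ^ d)⁻¹| * ∫ z, ‖c z‖) fun ψ => by
      have hnn : 0 ≤ |((π * ε) ^ d)⁻¹| * ∫ z, ‖c z‖ :=
        mul_nonneg (abs_nonneg _) (integral_nonneg fun _ => norm_nonneg _)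
      rw [LinearMap.coe_mk, AddHom.coe_mk, Lp.norm_toLp, Lp.norm_def]
      refine (ENNReal.toReal_mono (ENNReal.mul_ne_top ENNReal.ofReal_ne_top
        (Lp.eLpNorm_ne_top ψ)) (eLpNorm_weyl_le c ε ψ)).trans_eq ?_
      rw [ENNReal.toReal_mul, ENNReal.toReal_ofReal hnn]

theorem coeFn_opL2 (ε : ℝ) (c : 𝓢(Phase d, ℂ)) (ψ : L2 d) :
    ⇑(opL2 ε c ψ) =ᵐ[volume] weyl ε c ψ :=
  (memLp_weyl c ε ψ).coeFn_toLp

theorem norm_opL2_le (ε : ℝ) (c : 𝓢(Phase d, ℂ)) :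
    ‖opL2 ε c‖ ≤ |((π * ε) ^ d)⁻¹| * ∫ z, ‖c z‖ :=
  LinearMap.mkContinuous_norm_le _
    (mul_nonneg (abs_nonneg _) (integral_nonneg fun _ => norm_nonneg _)) _

attribute [irreducible] opL2

theorem coeFn_opL2_toLp (ε : ℝ) (c : 𝓢(Phase d, ℂ)) (ψ : 𝓢(Config d, ℂ)) :
    ⇑(opL2 ε c (ψ.toLp 2)) =ᵐ[volume] weyl ε c ψ := by
  have h := coeFn_opL2 ε c (ψ.toLp 2)
  rwa [weyl_congr_ae ε c (ψ.coeFn_toLp 2)] at h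

theorem denseRange_toLp : DenseRange (fun ψ : 𝓢(Config d, ℂ) => (ψ.toLp 2 : L2 d)) :=
  SchwartzMap.denseRange_toLpCLM (E := Config d) (F := ℂ) (μ := volume) (p := 2) (by norm_num)

/-- Translations are isometries of L². In contrast to the bound from reflections, no power of ε
appears, which is what small ε requires. -/
theorem eLpNorm_weyl_le_fourier {ε : ℝ} (hε : 0 < ε) (c : 𝓢(Phase d, ℂ)) (φ : 𝓢(Config d, ℂ)) :
    eLpNorm (weyl ε c φ) 2 volume ≤
      ENNReal.ofReal (∫ ξ, ‖(𝓕 c) ξ‖) * eLpNorm φ 2 volume := by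
  have h1 := eLpNorm_superposition_le (μ := (volume : Measure (Phase d)))
    (ν := (volume : Measure (Config d))) (𝓕 c).continuous.aestronglyMeasurable
    (stronglyMeasurable_translate ε φ.continuous)
    (eLpNorm_translate ε φ.continuous.aestronglyMeasurable · |>.le)
  rw [← ofReal_integral_norm_eq_lintegral_enorm (𝓕 c).integrable] at h1
  have e : weyl ε c φ = fun q => ∫ ξ, (𝓕 c) ξ * translate ε φ ξ q :=
    funext fun q => weyl_eq_translate c φ hε q
  rwa [← e] at h1

theorem toReal_le_of_le_ofReal_mul {x y : ENNReal} {K : ℝ} (hK : 0 ≤ K) (hy : y ≠ ⊤)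
    (h : x ≤ ENNReal.ofReal K * y) : x.toReal ≤ K * y.toReal := by
  have h2 := ENNReal.toReal_mono (ENNReal.mul_ne_top ENNReal.ofReal_ne_top hy) h
  rwa [ENNReal.toReal_mul, ENNReal.toReal_ofReal hK] at h2

theorem eLpNorm_schwartz_ne_top (φ : 𝓢(Config d, ℂ)) :
    eLpNorm (⇑φ) 2 (volume : Measure (Config d)) ≠ ⊤ := by
  have h : MemLp (⇑φ) 2 (volume : Measure (Config d)) := φ.memLp 2
  exact h.2.ne

theorem norm_le_of_coeFn_ae {ε : ℝ} (hε : 0 < ε) (c : 𝓢(Phase d, ℂ)) (φ : 𝓢(Config d, ℂ))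
    (u : L2 d) (hu : ⇑u =ᵐ[volume] weyl ε c φ) {K : ℝ} (hK : ∫ ξ, ‖(𝓕 c) ξ‖ = K) :
    ‖u‖ ≤ K * (eLpNorm (⇑φ) 2 (volume : Measure (Config d))).toReal := by
  have hnn : 0 ≤ K := hK ▸ integral_nonneg fun _ => norm_nonneg _
  rw [Lp.norm_def, eLpNorm_congr_ae hu]
  exact toReal_le_of_le_ofReal_mul hnn (eLpNorm_schwartz_ne_top φ)
    (hK ▸ eLpNorm_weyl_le_fourier hε c φ)

theorem norm_opL2_toLp_le_fourier {ε : ℝ} (hε : 0 < ε) (c : 𝓢(Phase d, ℂ))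
    (φ : 𝓢(Config d, ℂ)) {K : ℝ} (hK : ∫ ξ, ‖(𝓕 c) ξ‖ = K) :
    ‖opL2 ε c (φ.toLp 2)‖ ≤ K * ‖(φ.toLp 2 : L2 d)‖ := by
  have h := norm_le_of_coeFn_ae hε c φ _ (coeFn_opL2_toLp ε c φ) hK
  rwa [← SchwartzMap.norm_toLp] at h

theorem norm_opL2_le_fourier {ε : ℝ} (hε : 0 < ε) (c : 𝓢(Phase d, ℂ)) :
    ‖opL2 ε c‖ ≤ ∫ ξ, ‖(𝓕 c) ξ‖ := by
  obtain ⟨K, hK⟩ : ∃ K, ∫ ξ, ‖(𝓕 c) ξ‖ = K := ⟨_, rfl⟩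
  have hnn : 0 ≤ K := hK ▸ integral_nonneg fun _ => norm_nonneg _
  have hd := norm_opL2_toLp_le_fourier hε c (hK := hK)
  rw [hK]
  generalize opL2 ε c = R at hd ⊢
  refine ContinuousLinearMap.opNorm_le_bound _ hnn fun ψ => ?_
  -- The superposition of translations was established for Schwartz functions only; the inequality
  -- extends to L² by density.
  exact denseRange_toLp.induction_on (p := fun ψ => ‖R ψ‖ ≤ K * ‖ψ‖) ψ
    (isClosed_le R.continuous.norm (continuous_const.mul continuous_norm)) hd

theorem opL2_add (ε : ℝ) (c c' : 𝓢(Phase d, ℂ)) : opL2 ε (c + c') = opL2 ε c + opL2 ε c' := by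
  ext1 ψ
  rw [add_apply]
  refine Lp.ext ?_
  filter_upwards [coeFn_opL2 ε (c + c') ψ, coeFn_opL2 ε c ψ, coeFn_opL2 ε c' ψ,
    Lp.coeFn_add (opL2 ε c ψ) (opL2 ε c' ψ)] with q h1 h2 h3 h4
  rw [h1, h4, Pi.add_apply, h2, h3, weyl_add_symbol c c' (Lp.memLp ψ)]

theorem opL2_smul (ε : ℝ) (k : ℂ) (c : 𝓢(Phase d, ℂ)) : opL2 ε (k • c) = k • opL2 ε c := by
  ext1 ψ
  rw [smul_apply]
  refine Lp.ext ?_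
  filter_upwards [coeFn_opL2 ε (k • c) ψ, coeFn_opL2 ε c ψ,
    Lp.coeFn_smul k (opL2 ε c ψ)] with q h1 h2 h3
  rw [h1, h3, Pi.smul_apply, h2, weyl_smul_symbol, smul_eq_mul]

/-- Each reflection is a symmetric operator, by the substitution q ↦ 2x - q, where x is the position
of its centre. Superposing reflections with a real density preserves the symmetry. -/
theorem inner_weyl_schwartz (ε : ℝ) (c : 𝓢(Phase d, ℂ)) (hc : ∀ z, (starRingEnd ℂ) (c z) = c z)
    (ψ φ : 𝓢(Config d, ℂ)) :
    ∫ q, (starRingEnd ℂ) (weyl ε c ψ q) * φ q = ∫ q, (starRingEnd ℂ) (ψ q) * weyl ε c φ q := by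
  have hb : ∀ f g : 𝓢(Config d, ℂ), Integrable (fun x : Config d × Phase d =>
      (starRingEnd ℂ) (f x.1) * (c x.2 * reflect ε g x.2 x.1)) (volume.prod volume) := fun f g => by
    obtain ⟨C, hC, h⟩ := (g.isUniformSchwartz (ι := Unit)).bound 0 0
    refine ((f.integrable.norm.mul_prod c.integrable.norm).mul_const C).mono' ?_
      (Filter.Eventually.of_forall fun x => ?_)
    · refine AEStronglyMeasurable.mul
        (Complex.continuous_conj.comp (f.continuous.comp continuous_fst)).aestronglyMeasurable
        (AEStronglyMeasurable.mul (c.continuous.comp continuous_snd).aestronglyMeasurable ?_)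
      exact ((stronglyMeasurable_reflect ε g.continuous.stronglyMeasurable).comp_measurable
        measurable_swap).aestronglyMeasurable
    · rw [norm_mul, norm_mul, RCLike.norm_conj, reflect, norm_mul, mul_comm Complex.I,
        Complex.norm_exp_ofReal_mul_I, one_mul, ← mul_assoc]
      gcongr
      simpa using h () ((2 : ℝ) • posPart x.2 - x.1)
  have hleft : ∀ f g : 𝓢(Config d, ℂ), ∫ q, (starRingEnd ℂ) (f q) * weyl ε c g q =
      (((π * ε) ^ d : ℝ) : ℂ)⁻¹ *
        ∫ z, c z * ∫ q, (starRingEnd ℂ) (f q) * reflect ε g z q := fun f g => by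
    simp only [weyl_eq_reflect c g.continuous.stronglyMeasurable (g.memLp 2) ε]
    simp only [mul_left_comm ((starRingEnd ℂ) (f _))]
    rw [integral_const_mul]
    congr 1
    simp only [← integral_const_mul]
    rw [← integral_integral_swap (f := fun q z =>
      (c z * ((starRingEnd ℂ) (f q) * reflect ε g z q)))]
    · congr 1
      ext1 q
      congr 1
      ext1 z
      ring
    · refine (hb f g).congr (Filter.Eventually.of_forall fun x => ?_)
      simp only [Function.uncurry]
      ring
  have hrefl : ∀ z, (starRingEnd ℂ) (∫ q, (starRingEnd ℂ) (φ q) * reflect ε ψ z q) =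
      ∫ q, (starRingEnd ℂ) (ψ q) * reflect ε φ z q := fun z => by
    rw [← integral_conj, ← integral_sub_left_eq_self _ volume ((2 : ℝ) • posPart z)]
    congr 1
    ext1 q
    have e1 : (2 : ℝ) • posPart z - ((2 : ℝ) • posPart z - q) = q := by abel
    have e2 : (2 : ℝ) • posPart z - q - posPart z = -(q - posPart z) := by
      rw [two_smul]; abel
    simp only [reflect, map_mul, Complex.conj_conj, e1, e2, ← Complex.exp_conj, Complex.conj_I,
      Complex.conj_ofReal, inner_neg_left]
    push_cast
    ring_nf
  have e : ∫ q, (starRingEnd ℂ) (weyl ε c ψ q) * φ q =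
      (starRingEnd ℂ) (∫ q, (starRingEnd ℂ) (φ q) * weyl ε c ψ q) := by
    rw [← integral_conj]
    congr 1
    ext1 q
    simp [mul_comm]
  rw [e, hleft, hleft, map_mul, map_inv₀, Complex.conj_ofReal, ← integral_conj]
  congr 2
  ext1 z
  rw [map_mul, hc, hrefl]

theorem isSelfAdjoint_opL2 (ε : ℝ) (c : 𝓢(Phase d, ℂ))
    (hc : ∀ z, (starRingEnd ℂ) (c z) = c z) : IsSelfAdjoint (opL2 ε c) := by
  rw [ContinuousLinearMap.isSelfAdjoint_iff_isSymmetric]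
  intro ψ φ
  refine DenseRange.induction_on₂ (denseRange_toLp (d := d))
    (p := fun ψ φ : L2 d => inner ℂ (opL2 ε c ψ) φ = inner ℂ ψ (opL2 ε c φ))
    (isClosed_eq (by fun_prop) (by fun_prop)) (fun f g => ?_) ψ φ
  rw [L2.inner_def, L2.inner_def]
  have h := inner_weyl_schwartz ε c hc f g
  calc _ = ∫ q, (starRingEnd ℂ) (weyl ε c f q) * g q := by
        refine integral_congr_ae ?_
        filter_upwards [coeFn_opL2_toLp ε c f, g.coeFn_toLp 2] with q h1 h2
        rw [h1, h2, RCLike.inner_apply, mul_comm]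
    _ = ∫ q, (starRingEnd ℂ) (f q) * weyl ε c g q := h
    _ = _ := by
        refine integral_congr_ae ?_
        filter_upwards [coeFn_opL2_toLp ε c g, f.coeFn_toLp 2] with q h1 h2
        rw [h1, h2, RCLike.inner_apply, mul_comm]

/-- A linear map of the Schwartz space that extends to a bounded self-adjoint operator is
essentially self-adjoint. -/
theorem isEssentiallySelfAdjoint_onSchwartz {T : 𝓢(Config d, ℂ) →ₗ[ℂ] 𝓢(Config d, ℂ)}
    {R : L2 d →L[ℂ] L2 d} (hR : IsSelfAdjoint R)
    (h : ∀ ψ, (T ψ).toLp 2 = R (ψ.toLp 2)) : IsEssentiallySelfAdjoint (onSchwartz T) := by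
  set S := R.toLinearMap.toPMap ⊤
  have hdense : Dense ((onSchwartz T).domain : Set (L2 d)) := denseRange_toLp (d := d)
  have hgraph : (S.graph : Set (L2 d × L2 d)) = {x | x.2 = R x.1} := by
    ext x
    simp only [SetLike.mem_coe, LinearPMap.mem_graph_iff, Set.mem_ofPred_eq]
    constructor
    · rintro ⟨y, h1, h2⟩
      rw [← h2, ← h1]; rfl
    · intro hx
      exact ⟨⟨x.1, trivial⟩, rfl, hx.symm⟩
  have hval : ∀ ψ : 𝓢(Config d, ℂ), ∃ y : (onSchwartz T).domain,
      (y : L2 d) = ψ.toLp 2 ∧ onSchwartz T y = R (ψ.toLp 2) := fun ψ => by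
    refine ⟨⟨ψ.toLp 2, ψ, rfl⟩, rfl, ?_⟩
    rw [← h]
    have e : (LinearEquiv.ofInjective
        (SchwartzMap.toLpCLM ℂ ℂ 2 (volume : Measure (Config d))).toLinearMap
        (SchwartzMap.injective_toLp 2 volume)).symm ⟨ψ.toLp 2, ψ, rfl⟩ = ψ := by
      rw [LinearEquiv.symm_apply_eq]
      rfl
    change (T ((LinearEquiv.ofInjective
        (SchwartzMap.toLpCLM ℂ ℂ 2 (volume : Measure (Config d))).toLinearMap
        (SchwartzMap.injective_toLp 2 volume)).symm ⟨ψ.toLp 2, ψ, rfl⟩)).toLp 2 = _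
    rw [e]
  -- The graph of R is closed and contains the graph of the restriction. Conversely, x ↦ (x, R x) is
  -- continuous and Schwartz functions are dense, so the restricted graph is dense in that of R.
  have hclosure : (onSchwartz T).graph.topologicalClosure = S.graph := by
    refine SetLike.coe_injective ?_
    rw [Submodule.topologicalClosure_coe]
    refine subset_antisymm (closure_minimal ?_ ?_) ?_
    · rintro x hx
      obtain ⟨y, h1, h2⟩ := (LinearPMap.mem_graph_iff _).1 hx
      obtain ⟨ψ, hψ⟩ := y.2
      obtain ⟨y', h3, h4⟩ := hval ψ
      have : y = y' := Subtype.ext (hψ.symm.trans h3.symm)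
      rw [hgraph]
      change x.2 = R x.1
      rw [← h2, ← h1, this, h4, h3]
    · rw [hgraph]
      exact isClosed_eq continuous_snd (R.continuous.comp continuous_fst)
    · rw [hgraph]
      rintro ⟨x, y⟩ hx
      have hx' : y = R x := hx
      subst hx'
      have hc : Continuous fun x : L2 d => (x, R x) := by fun_prop
      refine closure_mono ?_ (hc.range_subset_closure_image_dense
        (denseRange_toLp (d := d)) ⟨x, rfl⟩)
      rintro _ ⟨_, ⟨ψ, rfl⟩, rfl⟩
      obtain ⟨y', h3, h4⟩ := hval ψ
      exact (LinearPMap.mem_graph_iff _).2 ⟨y', h3, h4⟩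
  have hclosable : (onSchwartz T).IsClosable := ⟨S, hclosure⟩
  refine ⟨hdense, hclosable, ?_⟩
  have hS : (onSchwartz T).closure = S := by
    refine LinearPMap.eq_of_eq_graph ?_
    rw [← hclosable.graph_closure_eq_closure_graph, hclosure]
  rw [hS, LinearPMap.isSelfAdjoint_def,
    ContinuousLinearMap.toPMap_adjoint_eq_adjoint_toPMap_of_dense R dense_univ,
    ← ContinuousLinearMap.star_eq_adjoint, hR.star_eq]

end OpL2

/-! ### Symbols of products and the convergence of the integrals involved -/

section Twist

open Real FourierTransform

variable {d : ℕ}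

/-- The symbol `z ↦ ∫ e^{2πi ξ·z} a(z + κ Jξ) h(ξ) dξ`. -/
def twist (κ : ℝ) (h : Phase d → ℂ) (a : Phase d → ℝ) (z : Phase d) : ℂ :=
  ∫ ξ, (𝐞 (inner ℝ ξ z) : ℂ) * ((a (z + κ • symp ξ) : ℂ) * h ξ)

/-- The linear map `(z, ξ) ↦ z + κ Jξ`. -/
def shear (d : ℕ) (κ : ℝ) : Phase d × Phase d →L[ℝ] Phase d :=
  ContinuousLinearMap.fst ℝ _ _ + κ • symp.comp (ContinuousLinearMap.snd ℝ _ _)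

theorem shear_apply (κ : ℝ) (z ξ : Phase d) : shear d κ (z, ξ) = z + κ • symp ξ := rfl

theorem norm_shear_le (κ : ℝ) : ‖shear d κ‖ ≤ 1 + |κ| := by
  refine ContinuousLinearMap.opNorm_le_bound _ (by positivity) fun x => ?_
  rw [← Prod.mk.eta (p := x), shear_apply, add_mul, one_mul]
  refine (norm_add_le _ _).trans (add_le_add (norm_fst_le x) ?_)
  rw [norm_smul, norm_symp, Real.norm_eq_abs]
  exact mul_le_mul_of_nonneg_left (norm_snd_le x) (abs_nonneg κ)

theorem twist_eq_osc (κ : ℝ) (h : Phase d → ℂ) (a : Phase d → ℝ) :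
    twist κ h a = osc (-ContinuousLinearMap.id ℝ (Phase d))
      (fun x => (a (shear d κ x) : ℂ) * h x.2) := by
  ext1 z
  simp only [twist, osc, neg_apply, ContinuousLinearMap.id_apply, inner_neg_right, neg_neg,
    Circle.smul_def, smul_eq_mul, shear_apply]

theorem HasSymbolGrowth.isAmplitude_twist {ι : Type} {M : ℕ} {a : Phase d → ℝ}
    (ha : HasSymbolGrowth M a) {κ : ι → ℝ} {K : ℝ} (hκ : ∀ i, |κ i| ≤ K) {h : ι → Phase d → ℂ}
    (hh : IsUniformSchwartz h) :
    IsAmplitude M (fun i (x : Phase d × Phase d) => (a (shear d (κ i) x) : ℂ) * h i x.2) :=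
  ha.isAmplitude (fun i => shear d (κ i)) (K := 1 + K)
    (fun i => (norm_shear_le (κ i)).trans (by linarith [hκ i])) hh

theorem HasSymbolGrowth.isUniformSchwartz_twist {ι : Type} {M : ℕ} {a : Phase d → ℝ}
    (ha : HasSymbolGrowth M a) {κ : ι → ℝ} {K : ℝ} (hκ : ∀ i, |κ i| ≤ K) {h : ι → Phase d → ℂ}
    (hh : IsUniformSchwartz h) : IsUniformSchwartz (fun i => twist (κ i) (h i) a) := by
  simp only [twist_eq_osc]
  exact (ha.isAmplitude_twist hκ hh).isUniformSchwartz_osc _ (K := 1) fun x => by simp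

theorem integrable_decay_mul {X V : Type} [NormedAddCommGroup X] [InnerProductSpace ℝ X]
    [FiniteDimensional ℝ X] [MeasurableSpace X] [BorelSpace X]
    [NormedAddCommGroup V] [InnerProductSpace ℝ V] [FiniteDimensional ℝ V] [MeasurableSpace V]
    [BorelSpace V] {f : X × V → ℂ} (hf : Continuous f) {C : ℝ}
    (h : ∀ x v, (1 + ‖x‖) ^ decayExp X * ((1 + ‖v‖) ^ decayExp V * ‖f (x, v)‖) ≤ C) :
    Integrable f (volume.prod volume) := by
  refine ((integrable_decay (V := X)).mul_prod (integrable_decay (V := V))).const_mul C |>.mono'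
    hf.aestronglyMeasurable (Filter.Eventually.of_forall fun x => ?_)
  have := h x.1 x.2
  rw [← mul_inv, ← div_eq_mul_inv, le_div_iff₀ (by positivity)]
  calc _ = _ := by ring
    _ ≤ _ := this

/-- Absolute convergence of the integrals in the position and frequency variables. -/
theorem integrable_position_frequency {M : ℕ} {a : Phase d → ℝ} (ha : HasSymbolGrowth M a)
    (h : 𝓢(Phase d, ℂ)) (ψ : 𝓢(Config d, ℂ)) (B : Phase d × Config d →L[ℝ] Phase d) (z : Phase d)
    (T : Phase d →L[ℝ] Config d) {u : Phase d × Config d → ℂ} (hu : Continuous u)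
    (hu1 : ∀ x, ‖u x‖ = 1) :
    Integrable (fun x : Phase d × Config d =>
      u x * (h x.1 * ((a (B x + z) : ℂ) * ψ (x.2 + T x.1)))) (volume.prod volume) := by
  obtain ⟨C, hC, hac⟩ := ha.2 0
  set D := decayExp (Config d)
  obtain ⟨C', hC', hψ⟩ := (ψ.isUniformSchwartz (ι := Unit)).bound 0 (D + M)
  obtain ⟨C'', hC'', hh⟩ := (h.isUniformSchwartz (ι := Unit)).bound 0
    (decayExp (Phase d) + (D + M) + M)
  refine integrable_decay_mul (C := C'' * (C * (1 + ‖z‖ + ‖B‖) ^ M * (C' * (1 + ‖T‖) ^ (D + M)))) ?_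
    fun ξ y => ?_
  · have := ha.1.continuous
    have := h.continuous
    have := ψ.continuous
    fun_prop
  have h1 := hψ () (y + T ξ)
  have h2 := hh () ξ
  have h3 := hac (B (ξ, y) + z)
  simp only [norm_iteratedFDeriv_zero] at h1 h2 h3
  have h4 : 1 + ‖B (ξ, y) + z‖ ≤ (1 + ‖z‖ + ‖B‖) * ((1 + ‖ξ‖) * (1 + ‖y‖)) := by
    have e1 := norm_add_le (B (ξ, y)) z
    have e2 := B.le_opNorm (ξ, y)
    have e3 : ‖(ξ, y)‖ ≤ (1 + ‖ξ‖) * (1 + ‖y‖) := by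
      have := norm_nonneg ξ; have := norm_nonneg y
      refine max_le ?_ ?_ <;> simp only <;> nlinarith
    have e4 : 1 ≤ (1 + ‖ξ‖) * (1 + ‖y‖) := by
      have := norm_nonneg ξ; have := norm_nonneg y
      nlinarith
    have := mul_le_mul_of_nonneg_left e3 (norm_nonneg B)
    have := mul_le_mul_of_nonneg_left e4 (norm_nonneg z)
    nlinarith
  have h5 : 1 + ‖y‖ ≤ (1 + ‖T‖) * ((1 + ‖ξ‖) * (1 + ‖y + T ξ‖)) := by
    have e1 : ‖y‖ ≤ ‖y + T ξ‖ + ‖T ξ‖ := by simpa using norm_sub_le (y + T ξ) (T ξ)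
    have e2 := T.le_opNorm ξ
    have := norm_nonneg T; have := norm_nonneg ξ; have := norm_nonneg (y + T ξ)
    have : 0 ≤ ‖T‖ * ‖y + T ξ‖ := by positivity
    have : 0 ≤ ‖ξ‖ * ‖y + T ξ‖ := by positivity
    have : 0 ≤ ‖T‖ * (‖ξ‖ * ‖y + T ξ‖) := by positivity
    nlinarith
  rw [norm_mul, hu1, one_mul, norm_mul, norm_mul, Complex.norm_real]
  calc (1 + ‖ξ‖) ^ decayExp (Phase d) * ((1 + ‖y‖) ^ D *
        (‖h ξ‖ * (‖a (B (ξ, y) + z)‖ * ‖ψ (y + T ξ)‖)))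
      ≤ (1 + ‖ξ‖) ^ decayExp (Phase d) * ((1 + ‖y‖) ^ D * (‖h ξ‖ *
          (C * ((1 + ‖z‖ + ‖B‖) * ((1 + ‖ξ‖) * (1 + ‖y‖))) ^ M * ‖ψ (y + T ξ)‖))) := by
        gcongr
        exact h3.trans (by gcongr)
    _ = (1 + ‖ξ‖) ^ (decayExp (Phase d) + M) * (‖h ξ‖ * (C * (1 + ‖z‖ + ‖B‖) ^ M *
          ((1 + ‖y‖) ^ (D + M) * ‖ψ (y + T ξ)‖))) := by
        rw [pow_add, pow_add, mul_pow, mul_pow]; ring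
    _ ≤ (1 + ‖ξ‖) ^ (decayExp (Phase d) + M) * (‖h ξ‖ * (C * (1 + ‖z‖ + ‖B‖) ^ M *
          (((1 + ‖T‖) * ((1 + ‖ξ‖) * (1 + ‖y + T ξ‖))) ^ (D + M) * ‖ψ (y + T ξ)‖))) := by
        gcongr
    _ = ((1 + ‖ξ‖) ^ (decayExp (Phase d) + (D + M) + M) * ‖h ξ‖) * (C * (1 + ‖z‖ + ‖B‖) ^ M *
          (((1 + ‖y + T ξ‖) ^ (D + M) * ‖ψ (y + T ξ)‖) * (1 + ‖T‖) ^ (D + M))) := by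
        rw [pow_add _ (decayExp (Phase d) + (D + M)) M, pow_add _ (decayExp (Phase d)) (D + M),
          pow_add _ (decayExp (Phase d)) M, mul_pow, mul_pow]; ring
    _ ≤ C'' * (C * (1 + ‖z‖ + ‖B‖) ^ M * (C' * (1 + ‖T‖) ^ (D + M))) := by
        gcongr

/-- The frequency of the position integral. -/
def posFreq (d : ℕ) (ε r : ℝ) : Config d × (Phase d × Config d) →L[ℝ] Config d :=
  (2 * π * ε)⁻¹ • (ContinuousLinearMap.snd ℝ _ _).comp (ContinuousLinearMap.snd ℝ _ _) -
    r • posPart.comp ((ContinuousLinearMap.fst ℝ _ _).comp (ContinuousLinearMap.snd ℝ _ _))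

theorem posFreq_apply (ε r : ℝ) (q p : Config d) (ξ : Phase d) :
    posFreq d ε r (q, (ξ, p)) = (2 * π * ε)⁻¹ • p - r • posPart ξ := rfl

theorem norm_momentum_le {ε : ℝ} (hε : 0 < ε) (r : ℝ) (q p : Config d) (ξ : Phase d) :
    1 + ‖p‖ ≤ (1 + 2 * π * ε * (1 + |r|)) * ((1 + ‖ξ‖) * (1 + ‖posFreq d ε r (q, (ξ, p))‖)) := by
  set w := posFreq d ε r (q, (ξ, p)) with hw
  have hp : 0 < 2 * π * ε := by positivity
  have e1 : p = (2 * π * ε) • (w + r • posPart ξ) := by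
    rw [hw, posFreq_apply, sub_add_cancel, smul_smul, mul_inv_cancel₀ hp.ne', one_smul]
  have e2 : ‖p‖ ≤ 2 * π * ε * (‖w‖ + |r| * ‖ξ‖) := by
    conv_lhs => rw [e1, norm_smul, Real.norm_of_nonneg hp.le]
    gcongr
    refine (norm_add_le _ _).trans ?_
    rw [norm_smul, Real.norm_eq_abs]
    gcongr
    exact norm_posPart_le ξ
  have := norm_nonneg w; have := norm_nonneg ξ; have := abs_nonneg r
  have e3 : ‖w‖ + |r| * ‖ξ‖ ≤ (1 + |r|) * ((1 + ‖ξ‖) * (1 + ‖w‖)) := by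
    have : 0 ≤ ‖ξ‖ * ‖w‖ := by positivity
    have : 0 ≤ |r| * (‖ξ‖ * ‖w‖) := by positivity
    have : 0 ≤ |r| * ‖w‖ := by positivity
    nlinarith
  have e4 := mul_le_mul_of_nonneg_left e3 hp.le
  have e5 : 1 ≤ (1 + ‖ξ‖) * (1 + ‖w‖) := by nlinarith
  linarith

/-- Absolute convergence of the integrals in the momentum and frequency variables, after the
integration in the position variable. -/
theorem integrable_momentum_frequency {M : ℕ} {a : Phase d → ℝ} (ha : HasSymbolGrowth M a)
    (h : 𝓢(Phase d, ℂ)) (ψ : 𝓢(Config d, ℂ))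
    (B : (Config d × (Phase d × Config d)) × Config d →L[ℝ] Phase d) {ε : ℝ} (hε : 0 < ε) (r : ℝ)
    (q : Config d) {u : Phase d × Config d → ℂ} (hu : Continuous u) (hu1 : ∀ x, ‖u x‖ = 1) :
    Integrable (fun x : Phase d × Config d => u x * (h x.1 *
      osc (posFreq d ε r) (fun z => (a (B z) : ℂ) * ψ z.2) (q, x))) (volume.prod volume) := by
  have hF : IsAmplitude M (fun (_ : Unit) (z : (Config d × (Phase d × Config d)) × Config d) =>
      (a (B z) : ℂ) * ψ z.2) :=
    ha.isAmplitude (fun _ => B) (fun _ => le_rfl) (ψ.isUniformSchwartz (ι := Unit))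
  set D := decayExp (Config d)
  -- D powers of decay are left for integrability in p; the other M absorb the growth (1 + ‖p‖)^M of
  -- the oscillatory integral.
  set N := D + M
  obtain ⟨C, hC, ho⟩ := hF.osc_decay (posFreq d ε r) N
  obtain ⟨C'', hC'', hh⟩ := (h.isUniformSchwartz (ι := Unit)).bound 0 (decayExp (Phase d) + N + M)
  set K := 1 + 2 * π * ε * (1 + |r|)
  have hK : 0 ≤ K := by positivity
  refine integrable_decay_mul (C := C'' * (K ^ N * (C * (1 + ‖q‖) ^ M))) ?_ fun ξ p => ?_
  · have := (hF.contDiff_osc (posFreq d ε r) ()).continuous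
    have := h.continuous
    fun_prop
  have h1 := ho () (q, (ξ, p))
  have h2 := hh () ξ
  simp only [norm_iteratedFDeriv_zero] at h2
  set o := ‖osc (posFreq d ε r) (fun z => (a (B z) : ℂ) * ψ z.2) (q, (ξ, p))‖
  set w := ‖posFreq d ε r (q, (ξ, p))‖
  have h3 : 1 + ‖p‖ ≤ K * ((1 + ‖ξ‖) * (1 + w)) := norm_momentum_le hε r q p ξ
  have h4 : 1 + ‖(q, (ξ, p))‖ ≤ (1 + ‖q‖) * ((1 + ‖ξ‖) * (1 + ‖p‖)) := by
    have := norm_nonneg ξ; have := norm_nonneg p; have := norm_nonneg q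
    have e : 0 ≤ ‖ξ‖ * ‖p‖ := by positivity
    have : 0 ≤ ‖q‖ * (‖ξ‖ + ‖p‖ + ‖ξ‖ * ‖p‖) := by positivity
    have : ‖(q, (ξ, p))‖ ≤ ‖q‖ + (‖ξ‖ + ‖p‖) := by
      refine max_le ?_ (max_le ?_ ?_) <;> simp only <;> linarith
    nlinarith
  have hp : 0 < (1 + ‖p‖) ^ M := by positivity
  have h5 : (1 + ‖p‖) ^ D * o ≤ K ^ N * (C * (1 + ‖q‖) ^ M) * (1 + ‖ξ‖) ^ (N + M) := by
    refine le_of_mul_le_mul_right ?_ hp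
    calc (1 + ‖p‖) ^ D * o * (1 + ‖p‖) ^ M = (1 + ‖p‖) ^ N * o := by
          rw [pow_add]; ring
      _ ≤ (K * ((1 + ‖ξ‖) * (1 + w))) ^ N * o := by gcongr
      _ = K ^ N * (1 + ‖ξ‖) ^ N * ((1 + w) ^ N * o) := by rw [mul_pow, mul_pow]; ring
      _ ≤ K ^ N * (1 + ‖ξ‖) ^ N * (C * ((1 + ‖q‖) * ((1 + ‖ξ‖) * (1 + ‖p‖))) ^ M) := by
          exact mul_le_mul_of_nonneg_left (h1.trans (by gcongr)) (by positivity)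
      _ = _ := by rw [mul_pow, mul_pow, pow_add]; ring
  rw [norm_mul, hu1, one_mul, norm_mul]
  calc (1 + ‖ξ‖) ^ decayExp (Phase d) * ((1 + ‖p‖) ^ D * (‖h ξ‖ * o))
      = (1 + ‖ξ‖) ^ decayExp (Phase d) * (‖h ξ‖ * ((1 + ‖p‖) ^ D * o)) := by ring
    _ ≤ (1 + ‖ξ‖) ^ decayExp (Phase d) * (‖h ξ‖ *
          (K ^ N * (C * (1 + ‖q‖) ^ M) * (1 + ‖ξ‖) ^ (N + M))) := by gcongr
    _ = ((1 + ‖ξ‖) ^ (decayExp (Phase d) + N + M) * ‖h ξ‖) * (K ^ N * (C * (1 + ‖q‖) ^ M)) := by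
        rw [pow_add, pow_add, pow_add]; ring
    _ ≤ _ := by gcongr

/-- The triple integrals below need not converge absolutely, since a may grow in p and the decay in
p appears only after the y-integration. So ξ is moved past y for fixed p, and then past p once the
y-integral has been carried out. -/
theorem integral_rotate {X V V' : Type} [MeasureSpace X] [MeasureSpace V] [MeasureSpace V']
    [SFinite (volume : Measure X)] [SFinite (volume : Measure V)] [SFinite (volume : Measure V')]
    {f : X → V → V' → ℂ}
    (h1 : ∀ p, Integrable (fun x : X × V' => f x.1 p x.2) (volume.prod volume))
    (h2 : Integrable (fun x : X × V => ∫ y, f x.1 x.2 y) (volume.prod volume)) :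
    ∫ p, ∫ y, ∫ ξ, f ξ p y = ∫ ξ, ∫ p, ∫ y, f ξ p y := by
  rw [integral_integral_swap (f := fun ξ p => ∫ y, f ξ p y) h2]
  congr 1
  ext1 p
  exact (integral_integral_swap (f := fun ξ y => f ξ p y) (h1 p)).symm

end Twist

/-! ### Composition of Weyl operators -/

section Composition

open Real FourierTransform

variable {d : ℕ}

theorem weyl_eq_char {ε : ℝ} (hε : ε ≠ 0) (a : Phase d → ℂ) (ψ : Config d → ℂ) (q : Config d) :
    weyl ε a ψ q = (((2 * π * ε) ^ d : ℝ) : ℂ)⁻¹ * ∫ p : Config d, ∫ y : Config d,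
      a (phasePt ((2 : ℝ)⁻¹ • (q + y)) p) * (𝐞 (inner ℝ (q - y) p * (2 * π * ε)⁻¹) : ℂ) * ψ y := by
  rw [weyl]
  congr 2
  ext1 p
  congr 1
  ext1 y
  have h := exp_phase hε (inner ℝ (q - y) p) 0
  rw [sub_zero, zero_mul, neg_zero, AddChar.map_zero_eq_one, Circle.coe_one, mul_one] at h
  rw [h]

/-- The linear map `((q, (ξ, p)), y) ↦ ((q + y) / 2, p) + S ξ`. -/
def midPtAdd (S : Phase d →L[ℝ] Phase d) :
    (Config d × (Phase d × Config d)) × Config d →L[ℝ] Phase d :=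
  (midPt d).comp ((((ContinuousLinearMap.fst ℝ (Config d) (Phase d × Config d)).prod
    ((ContinuousLinearMap.snd ℝ (Phase d) (Config d)).comp (ContinuousLinearMap.snd ℝ _ _))).comp
      (ContinuousLinearMap.fst ℝ _ (Config d))).prod (ContinuousLinearMap.snd ℝ _ _)) +
  S.comp ((ContinuousLinearMap.fst ℝ (Phase d) (Config d)).comp
    ((ContinuousLinearMap.snd ℝ (Config d) _).comp (ContinuousLinearMap.fst ℝ _ (Config d))))

theorem midPtAdd_apply (S : Phase d →L[ℝ] Phase d) (q p y : Config d) (ξ : Phase d) :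
    midPtAdd S ((q, (ξ, p)), y) = phasePt ((2 : ℝ)⁻¹ • (q + y)) p + S ξ :=
  congrArg (· + S ξ) (midPt_apply q p y)

/-- The modulated and translated symbol `z ↦ e^{2πi ξ·z} a(z + κ Jξ)`. -/
def twistSymbol (κ : ℝ) (a : Phase d → ℝ) (ξ z : Phase d) : ℂ :=
  (𝐞 (inner ℝ ξ z) : ℂ) * (a (z + κ • symp ξ) : ℂ)

/-- A superposition of symbols passes through the Weyl quantization; the content is the exchange of
the ξ-integral with the conditionally convergent y- and p-integrals. -/
theorem weyl_twist {M : ℕ} {a : Phase d → ℝ} (ha : HasSymbolGrowth M a) (h : 𝓢(Phase d, ℂ))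
    (ψ : 𝓢(Config d, ℂ)) {ε : ℝ} (hε : 0 < ε) (κ : ℝ) (q : Config d) :
    weyl ε (twist κ h a) ψ q = ∫ ξ, h ξ * weyl ε (twistSymbol κ a ξ) ψ q := by
  have hchar : ∀ t : ℝ, ‖(𝐞 t : ℂ)‖ = 1 := fun t => Circle.norm_coe _
  have hcont : Continuous fun t : ℝ => (𝐞 t : ℂ) :=
    continuous_subtype_val.comp continuous_fourierChar
  set f : Phase d → Config d → Config d → ℂ := fun ξ p y =>
    (𝐞 (inner ℝ ξ (phasePt ((2 : ℝ)⁻¹ • (q + y)) p)) : ℂ) *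
      ((a (phasePt ((2 : ℝ)⁻¹ • (q + y)) p + κ • symp ξ) : ℂ) * h ξ) *
      (𝐞 (inner ℝ (q - y) p * (2 * π * ε)⁻¹) : ℂ) * ψ y with hf
  have h1 : ∀ p, Integrable (fun x : Phase d × Config d => f x.1 p x.2) (volume.prod volume) := by
    intro p
    have hi := integrable_position_frequency ha h ψ
      (phaseMk.comp (((2 : ℝ)⁻¹ • ContinuousLinearMap.snd ℝ (Phase d) (Config d)).prod 0) +
        κ • symp.comp (ContinuousLinearMap.fst ℝ (Phase d) (Config d)))
      (phasePt ((2 : ℝ)⁻¹ • q) p) 0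
      (u := fun x => (𝐞 (inner ℝ x.1 (phaseMk ((2 : ℝ)⁻¹ • (q + x.2), p))) : ℂ) *
        (𝐞 (inner ℝ (q - x.2) p * (2 * π * ε)⁻¹) : ℂ))
      (by fun_prop) (fun x => by rw [norm_mul, hchar, hchar, one_mul])
    refine hi.congr (Filter.Eventually.of_forall fun x => ?_)
    have e : phaseMk ((2 : ℝ)⁻¹ • x.2, (0 : Config d)) + κ • symp x.1 + phasePt ((2 : ℝ)⁻¹ • q) p =
        phasePt ((2 : ℝ)⁻¹ • (q + x.2)) p + κ • symp x.1 := by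
      rw [phaseMk_apply, add_right_comm, ← phasePt_add, zero_add, ← smul_add, add_comm x.2]
    simp only [add_apply, smul_apply, ContinuousLinearMap.comp_apply, ContinuousLinearMap.prod_apply,
      ContinuousLinearMap.coe_snd', ContinuousLinearMap.coe_fst', zero_apply, add_zero, hf]
    rw [e, phaseMk_apply]
    ring
  -- The half of ξ·z that depends on y is collected in the frequency p/(2πε) - ξ_q/2, with ξ_q the
  -- position part of ξ; hence the parameter 2⁻¹. The remaining phase does not depend on y and has
  -- modulus one.
  have hosc : ∀ ξ p, (𝐞 (inner ℝ q p * (2 * π * ε)⁻¹ + (2 : ℝ)⁻¹ * inner ℝ (posPart ξ) q +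
      inner ℝ (momPart ξ) p) : ℂ) * (h ξ * osc (posFreq d ε 2⁻¹) (fun z =>
        (a (midPtAdd (κ • symp) z) : ℂ) * ψ z.2) (q, (ξ, p))) =
      ∫ y, f ξ p y := fun ξ p => by
    rw [osc, ← mul_assoc, ← integral_const_mul]
    congr 1
    ext1 y
    simp only [hf, midPtAdd_apply, posFreq_apply, Circle.smul_def, smul_eq_mul, smul_apply]
    have e : (𝐞 (inner ℝ q p * (2 * π * ε)⁻¹ + (2 : ℝ)⁻¹ * inner ℝ (posPart ξ) q +
        inner ℝ (momPart ξ) p) : ℂ) *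
        (𝐞 (-inner ℝ y ((2 * π * ε)⁻¹ • p - (2 : ℝ)⁻¹ • posPart ξ)) : ℂ) =
        (𝐞 (inner ℝ ξ (phasePt ((2 : ℝ)⁻¹ • (q + y)) p)) : ℂ) *
          (𝐞 (inner ℝ (q - y) p * (2 * π * ε)⁻¹) : ℂ) := by
      rw [← Circle.coe_mul, ← Circle.coe_mul, ← AddChar.map_add_eq_mul, ← AddChar.map_add_eq_mul,
        inner_phase, posPart_phasePt, momPart_phasePt, inner_sub_right, inner_sub_left,
        inner_smul_right, inner_smul_right, inner_smul_right, inner_add_right,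
        real_inner_comm (posPart ξ) y]
      ring_nf
    linear_combination (h ξ * ((a (phasePt ((2 : ℝ)⁻¹ • (q + y)) p + κ • symp ξ) : ℂ) * ψ y)) * e
  have h2 : Integrable (fun x : Phase d × Config d => ∫ y, f x.1 x.2 y) (volume.prod volume) := by
    refine (integrable_momentum_frequency ha h ψ _ hε 2⁻¹ q (u := fun x =>
      (𝐞 (inner ℝ q x.2 * (2 * π * ε)⁻¹ + (2 : ℝ)⁻¹ * inner ℝ (posPart x.1) q +
      inner ℝ (momPart x.1) x.2) : ℂ)) (by fun_prop) (fun x => hchar _)).congr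
      (Filter.Eventually.of_forall fun x => hosc x.1 x.2)
  have h3 := integral_rotate h1 h2
  rw [weyl_eq_char hε.ne']
  calc _ = (((2 * π * ε) ^ d : ℝ) : ℂ)⁻¹ * ∫ p, ∫ y, ∫ ξ, f ξ p y := by
        simp only [hf, integral_mul_const]
        rfl
    _ = _ := by
        rw [h3, ← integral_const_mul]
        congr 1
        ext1 ξ
        rw [weyl_eq_char hε.ne', mul_left_comm]
        congr 1
        rw [← integral_const_mul]
        congr 1
        ext1 p
        rw [← integral_const_mul]
        congr 1
        ext1 y
        simp only [hf, twistSymbol]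
        ring

/-- The analogous exchange for a superposition of functions. It is applied to op(c)ψ written as an
integral of translates of ψ. -/
theorem weyl_superposition {M : ℕ} {a : Phase d → ℝ} (ha : HasSymbolGrowth M a)
    (h : 𝓢(Phase d, ℂ)) (ψ : 𝓢(Config d, ℂ)) {ε : ℝ} (hε : 0 < ε) (q : Config d) :
    weyl ε (fun z => (a z : ℂ)) (fun y => ∫ ξ, h ξ * translate ε ψ ξ y) q =
      ∫ ξ, h ξ * weyl ε (fun z => (a z : ℂ)) (translate ε ψ ξ) q := by
  have hchar : ∀ t : ℝ, ‖(𝐞 t : ℂ)‖ = 1 := fun t => Circle.norm_coe _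
  have hcont : Continuous fun t : ℝ => (𝐞 t : ℂ) :=
    continuous_subtype_val.comp continuous_fourierChar
  set f : Phase d → Config d → Config d → ℂ := fun ξ p y =>
    (a (phasePt ((2 : ℝ)⁻¹ • (q + y)) p) : ℂ) *
      (𝐞 (inner ℝ (q - y) p * (2 * π * ε)⁻¹) : ℂ) * (h ξ * translate ε ψ ξ y) with hf
  have h1 : ∀ p, Integrable (fun x : Phase d × Config d => f x.1 p x.2) (volume.prod volume) := by
    intro p
    have hi := integrable_position_frequency ha h ψ
      (phaseMk.comp (((2 : ℝ)⁻¹ • ContinuousLinearMap.snd ℝ (Phase d) (Config d)).prod 0))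
      (phasePt ((2 : ℝ)⁻¹ • q) p) ((2 * π * ε) • momPart)
      (u := fun x => (𝐞 (inner ℝ (q - x.2) p * (2 * π * ε)⁻¹) : ℂ) *
        (𝐞 (inner ℝ (posPart x.1) (x.2 + (π * ε) • momPart x.1)) : ℂ))
      (by fun_prop) (fun x => by rw [norm_mul, hchar, hchar, one_mul])
    refine hi.congr (Filter.Eventually.of_forall fun x => ?_)
    have e : phaseMk ((2 : ℝ)⁻¹ • x.2, (0 : Config d)) + phasePt ((2 : ℝ)⁻¹ • q) p =
        phasePt ((2 : ℝ)⁻¹ • (q + x.2)) p := by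
      rw [phaseMk_apply, ← phasePt_add, zero_add, ← smul_add, add_comm x.2]
    simp only [smul_apply, ContinuousLinearMap.comp_apply, ContinuousLinearMap.prod_apply,
      ContinuousLinearMap.coe_snd', zero_apply, e, hf, translate]
    ring
  have hosc : ∀ ξ p, (𝐞 (inner ℝ q p * (2 * π * ε)⁻¹ + inner ℝ (momPart ξ) p -
      π * ε * inner ℝ (posPart ξ) (momPart ξ)) : ℂ) * (h ξ * osc (posFreq d ε 1) (fun z =>
        (a (midPtAdd (-(π * ε) • phaseMk.comp (momPart.prod 0)) z) : ℂ) *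
              ψ z.2) (q, (ξ, p))) =
      ∫ y, f ξ p y := fun ξ p => by
    -- Shifting y by 2πε times the momentum part of ξ frees ψ from its dependence on ξ. The shift
    -- reappears in a as a displacement of the position by half of it, and the modulation now
    -- contributes all of ξ_q to the frequency, so the parameter is 1.
    rw [← integral_sub_right_eq_self _ ((2 * π * ε) • momPart ξ), osc, ← mul_assoc,
      ← integral_const_mul]
    congr 1
    ext1 y
    have e1 : phasePt ((2 : ℝ)⁻¹ • (q + y)) p + (-(π * ε) • phaseMk.comp (momPart.prod 0)) ξ =
        phasePt ((2 : ℝ)⁻¹ • (q + (y - (2 * π * ε) • momPart ξ))) p := by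
      rw [smul_apply, ContinuousLinearMap.comp_apply, ContinuousLinearMap.prod_apply, ← map_smul,
        Prod.smul_mk, phaseMk_apply, ← phasePt_add, zero_apply, smul_zero, add_zero,
        ← add_sub_assoc, smul_sub, smul_smul, neg_smul, ← sub_eq_add_neg]
      congr 3
      ring
    simp only [hf, midPtAdd_apply, posFreq_apply, Circle.smul_def, smul_eq_mul, translate,
      sub_add_cancel, e1]
    have e : (𝐞 (inner ℝ q p * (2 * π * ε)⁻¹ + inner ℝ (momPart ξ) p -
        π * ε * inner ℝ (posPart ξ) (momPart ξ)) : ℂ) *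
        (𝐞 (-inner ℝ y ((2 * π * ε)⁻¹ • p - (1 : ℝ) • posPart ξ)) : ℂ) =
        (𝐞 (inner ℝ (q - (y - (2 * π * ε) • momPart ξ)) p * (2 * π * ε)⁻¹) : ℂ) *
          (𝐞 (inner ℝ (posPart ξ) (y - (2 * π * ε) • momPart ξ + (π * ε) • momPart ξ)) : ℂ) := by
      have hp : (2 * π * ε) ≠ 0 := by positivity
      rw [← Circle.coe_mul, ← Circle.coe_mul, ← AddChar.map_add_eq_mul, ← AddChar.map_add_eq_mul]
      congr 2
      simp only [inner_sub_right, inner_sub_left, inner_smul_right, inner_smul_left, inner_add_right,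
        real_inner_comm (posPart ξ) y, RCLike.conj_to_real]
      field_simp
      ring
    linear_combination (h ξ * ((a (phasePt ((2 : ℝ)⁻¹ • (q + (y - (2 * π * ε) • momPart ξ))) p) :
      ℂ) * ψ y)) * e
  have h2 : Integrable (fun x : Phase d × Config d => ∫ y, f x.1 x.2 y) (volume.prod volume) := by
    refine (integrable_momentum_frequency ha h ψ _ hε 1 q (u := fun x =>
      (𝐞 (inner ℝ q x.2 * (2 * π * ε)⁻¹ + inner ℝ (momPart x.1) x.2 -
      π * ε * inner ℝ (posPart x.1) (momPart x.1)) : ℂ)) (by fun_prop) (fun x => hchar _)).congr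
      (Filter.Eventually.of_forall fun x => hosc x.1 x.2)
  have h3 := integral_rotate h1 h2
  rw [weyl_eq_char hε.ne']
  simp only [← integral_const_mul]
  calc _ = (((2 * π * ε) ^ d : ℝ) : ℂ)⁻¹ * ∫ p, ∫ y, ∫ ξ, f ξ p y := by
        simp only [hf, integral_const_mul]
    _ = _ := by
        rw [h3, ← integral_const_mul]
        congr 1
        ext1 ξ
        rw [weyl_eq_char hε.ne', mul_left_comm]
        congr 1
        rw [← integral_const_mul]
        congr 1
        ext1 p
        rw [← integral_const_mul]
        congr 1
        ext1 y
        simp only [hf]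
        ring

/-- Lebesgue measure is invariant under shifts of y and p. The shift of y moves the midpoint by half
its length and that of p moves the momentum, which together displace the argument of a by -πε Jξ;
the phases combine to e^{2πi ξ·z}. -/
theorem weyl_comp_translate (a : Phase d → ℝ) (ψ : Config d → ℂ) {ε : ℝ} (hε : 0 < ε)
    (ξ : Phase d) (q : Config d) : weyl ε (fun z => (a z : ℂ)) (translate ε ψ ξ) q =
      weyl ε (twistSymbol (-(π * ε)) a ξ) ψ q := by
  have hp : (2 * π * ε) ≠ 0 := by positivity
  rw [weyl_eq_char hε.ne', weyl_eq_char hε.ne',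
    ← integral_add_right_eq_self _ ((π * ε) • posPart ξ)]
  congr 2
  ext1 p
  rw [← integral_sub_right_eq_self _ ((2 * π * ε) • momPart ξ)]
  congr 1
  ext1 y
  have e1 : phasePt ((2 : ℝ)⁻¹ • (q + (y - (2 * π * ε) • momPart ξ))) (p + (π * ε) • posPart ξ) =
      phasePt ((2 : ℝ)⁻¹ • (q + y)) p + (-(π * ε)) • symp ξ := by
    rw [symp_apply, ← phaseMk_apply _ (-posPart ξ), ← map_smul phaseMk, Prod.smul_mk,
      phaseMk_apply, ← phasePt_add, ← add_sub_assoc, smul_sub, smul_smul, smul_neg, neg_smul, neg_smul, neg_neg,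
      ← sub_eq_add_neg]
    congr 3
    ring
  have e2 : (𝐞 (inner ℝ (q - (y - (2 * π * ε) • momPart ξ)) (p + (π * ε) • posPart ξ) *
      (2 * π * ε)⁻¹) : ℂ) * (𝐞 (inner ℝ (posPart ξ) (y - (2 * π * ε) • momPart ξ +
        (π * ε) • momPart ξ)) : ℂ) = (𝐞 (inner ℝ ξ (phasePt ((2 : ℝ)⁻¹ • (q + y)) p)) : ℂ) *
      (𝐞 (inner ℝ (q - y) p * (2 * π * ε)⁻¹) : ℂ) := by
    rw [← Circle.coe_mul, ← Circle.coe_mul, ← AddChar.map_add_eq_mul, ← AddChar.map_add_eq_mul]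
    congr 2
    rw [inner_phase, posPart_phasePt, momPart_phasePt]
    simp only [inner_sub_right, inner_sub_left, inner_smul_right, inner_smul_left, inner_add_right,
      real_inner_comm (posPart ξ) y, real_inner_comm (posPart ξ) q,
      real_inner_comm (posPart ξ) (momPart ξ), RCLike.conj_to_real]
    field_simp
    ring
  rw [translate, twistSymbol, e1, sub_add_cancel]
  linear_combination ((a (phasePt ((2 : ℝ)⁻¹ • (q + y)) p + (-(π * ε)) • symp ξ) : ℂ) * ψ y) * e2

/-- Here q is shifted instead of y, and p in the opposite direction, so the displacement is +πε Jξ.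
This sign is the only difference between the two products. -/
theorem translate_weyl (a : Phase d → ℝ) (ψ : Config d → ℂ) {ε : ℝ} (hε : 0 < ε)
    (ξ : Phase d) (q : Config d) : translate ε (weyl ε (fun z => (a z : ℂ)) ψ) ξ q =
      weyl ε (twistSymbol (π * ε) a ξ) ψ q := by
  have hp : (2 * π * ε) ≠ 0 := by positivity
  rw [translate, weyl_eq_char hε.ne', weyl_eq_char hε.ne',
    ← integral_sub_right_eq_self _ ((π * ε) • posPart ξ), mul_left_comm, ← integral_const_mul]
  congr 2
  ext1 p
  rw [← integral_const_mul]
  congr 1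
  ext1 y
  have e1 : phasePt ((2 : ℝ)⁻¹ • (q + (2 * π * ε) • momPart ξ + y)) (p - (π * ε) • posPart ξ) =
      phasePt ((2 : ℝ)⁻¹ • (q + y)) p + (π * ε) • symp ξ := by
    rw [symp_apply, ← phaseMk_apply _ (-posPart ξ), ← map_smul phaseMk, Prod.smul_mk,
      phaseMk_apply, ← phasePt_add, add_right_comm, smul_add _ (q + y), smul_smul, smul_neg, ← sub_eq_add_neg]
    congr 3
    ring
  have e2 : (𝐞 (inner ℝ (posPart ξ) (q + (π * ε) • momPart ξ)) : ℂ) *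
      (𝐞 (inner ℝ (q + (2 * π * ε) • momPart ξ - y) (p - (π * ε) • posPart ξ) *
      (2 * π * ε)⁻¹) : ℂ) = (𝐞 (inner ℝ ξ (phasePt ((2 : ℝ)⁻¹ • (q + y)) p)) : ℂ) *
      (𝐞 (inner ℝ (q - y) p * (2 * π * ε)⁻¹) : ℂ) := by
    rw [← Circle.coe_mul, ← Circle.coe_mul, ← AddChar.map_add_eq_mul, ← AddChar.map_add_eq_mul]
    congr 2
    rw [inner_phase, posPart_phasePt, momPart_phasePt]
    simp only [inner_sub_right, inner_sub_left, inner_smul_right, inner_smul_left, inner_add_right,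
      inner_add_left, real_inner_comm (posPart ξ) y, real_inner_comm (posPart ξ) q,
      real_inner_comm (posPart ξ) (momPart ξ), RCLike.conj_to_real]
    field_simp
    ring
  rw [twistSymbol, e1]
  linear_combination ((a (phasePt ((2 : ℝ)⁻¹ • (q + y)) p + (π * ε) • symp ξ) : ℂ) * ψ y) * e2

/-- Composition of Weyl quantized operators. -/
theorem weyl_weyl_right {M : ℕ} {a : Phase d → ℝ} (ha : HasSymbolGrowth M a) (c : 𝓢(Phase d, ℂ))
    (ψ : 𝓢(Config d, ℂ)) {ε : ℝ} (hε : 0 < ε) (q : Config d) :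
    weyl ε (fun z => (a z : ℂ)) (weyl ε c ψ) q = weyl ε (twist (-(π * ε)) (𝓕 c : 𝓢(Phase d, ℂ)) a) ψ q := by
  have e : weyl ε c ψ = fun y => ∫ ξ, (𝓕 c) ξ * translate ε ψ ξ y :=
    funext fun y => weyl_eq_translate c ψ hε y
  rw [e, weyl_superposition ha _ _ hε, weyl_twist ha _ _ hε]
  simp only [weyl_comp_translate a _ hε]

theorem weyl_weyl_left {M : ℕ} {a : Phase d → ℝ} (ha : HasSymbolGrowth M a) (c : 𝓢(Phase d, ℂ))
    (ψ : 𝓢(Config d, ℂ)) {ε : ℝ} (hε : 0 < ε) (q : Config d) :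
    weyl ε c (weyl ε (fun z => (a z : ℂ)) ψ) q = weyl ε (twist (π * ε) (𝓕 c : 𝓢(Phase d, ℂ)) a) ψ q := by
  -- The superposition of translations requires a Schwartz argument, which op(a)ψ is by `weylMap`.
  rw [← coe_weylMap ha hε.ne', weyl_eq_translate c _ hε, weyl_twist ha _ _ hε]
  simp only [coe_weylMap, translate_weyl a _ hε]

end Composition

/-! ### Gaussian factors, uniformly down to width parameter zero -/

section Gaussian

open Real

variable {ι E : Type} [NormedAddCommGroup E] [InnerProductSpace ℝ E]

/-- The Gaussian `e^{-s π² |ξ|²}`. -/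
def gaussF {E : Type} [NormedAddCommGroup E] (s : ℝ) (ξ : E) : ℝ := Real.exp (-s * (π ^ 2 * ‖ξ‖ ^ 2))

theorem gaussF_nonneg {E : Type} [NormedAddCommGroup E] (s : ℝ) (ξ : E) : 0 ≤ gaussF s ξ := (Real.exp_pos _).le

theorem gaussF_le_one {E : Type} [NormedAddCommGroup E] {s : ℝ} (hs : 0 ≤ s) (ξ : E) : gaussF s ξ ≤ 1 :=
  Real.exp_le_one_iff.2 (by rw [neg_mul]; exact neg_nonpos.2 (by positivity))

theorem contDiff_gaussF (s : ℝ) : ContDiff ℝ ∞ (gaussF s : E → ℝ) :=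
  Real.contDiff_exp.comp (contDiff_const.mul (contDiff_const.mul (contDiff_norm_sq ℝ)))

theorem hasDerivAt_gaussF {E : Type} [NormedAddCommGroup E] (s : ℝ) (ξ : E) :
    HasDerivAt (fun s => gaussF s ξ) (-(π ^ 2 * ‖ξ‖ ^ 2) * gaussF s ξ) s := by
  have h := ((hasDerivAt_neg s).mul_const (π ^ 2 * ‖ξ‖ ^ 2)).exp
  refine h.congr_deriv ?_
  rw [gaussF]
  ring

/-- Every derivative of exp at the exponent is the Gaussian itself, so the bound for derivatives of
a composition keeps the factor `gaussF s ξ` and costs a polynomial that is uniform for s in [0, S].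
-/
theorem norm_iteratedFDeriv_gaussF_le (n : ℕ) (S : ℝ) : ∃ (C : ℝ) (m : ℕ), 0 ≤ C ∧
    ∀ s ∈ Set.Icc 0 S, ∀ ξ : E, ‖iteratedFDeriv ℝ n (gaussF s) ξ‖ ≤ C * (1 + ‖ξ‖) ^ m * gaussF s ξ := by
  have hT : (fun ξ : E => π ^ 2 * ‖ξ‖ ^ 2).HasTemperateGrowth :=
    (Function.HasTemperateGrowth.const (π ^ 2)).mul
      (Function.hasTemperateGrowth_norm_sq (H := E))
  obtain ⟨k, C, hC, hb⟩ := hT.norm_iteratedFDeriv_le_uniform n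
  refine ⟨n.factorial * (1 + |S| * C) ^ n, k * n, by positivity, fun s hs ξ => ?_⟩
  have hf : ContDiff ℝ ∞ (fun ξ : E => -s * (π ^ 2 * ‖ξ‖ ^ 2)) :=
    contDiff_const.mul (contDiff_const.mul (contDiff_norm_sq ℝ))
  have hsS : s ≤ |S| := hs.2.trans (le_abs_self S)
  have h1 : 1 ≤ (1 + ‖ξ‖) ^ k := one_le_pow₀ (by linarith [norm_nonneg ξ])
  set D := (1 + |S| * C) * (1 + ‖ξ‖) ^ k
  have hD1 : 1 ≤ D := one_le_mul_of_one_le_of_one_le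
    (le_add_of_nonneg_right (by positivity)) h1
  have h := norm_iteratedFDeriv_comp_le (𝕜 := ℝ) (g := Real.exp) (n := n) (N := ∞)
    Real.contDiff_exp hf (by exact_mod_cast le_top) ξ (C := gaussF s ξ) (D := D) (fun i _ => ?_)
    (fun i hi hin => ?_)
  · refine h.trans_eq ?_
    rw [mul_pow, ← pow_mul]
    ring
  · rw [norm_iteratedFDeriv_eq_norm_iteratedDeriv, iteratedDeriv_eq_iterate, Real.iter_deriv_exp,
      Real.norm_of_nonneg (Real.exp_pos _).le]
    exact le_rfl
  · have e : (fun ξ : E => -s * (π ^ 2 * ‖ξ‖ ^ 2)) = (-s) • fun ξ : E => π ^ 2 * ‖ξ‖ ^ 2 := rfl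
    rw [e, iteratedFDeriv_const_smul_apply (hT.1.contDiffAt.of_le (by exact_mod_cast le_top)),
      norm_smul, norm_neg, Real.norm_of_nonneg hs.1]
    calc s * ‖iteratedFDeriv ℝ i (fun ξ : E => π ^ 2 * ‖ξ‖ ^ 2) ξ‖
        ≤ |S| * (C * (1 + ‖ξ‖) ^ k) := mul_le_mul hsS (hb i hin ξ) (norm_nonneg _) (abs_nonneg S)
      _ ≤ D := by
          have : D = (1 + ‖ξ‖) ^ k + |S| * (C * (1 + ‖ξ‖) ^ k) := by simp only [D]; ring
          rw [this]
          linarith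
      _ ≤ D ^ i := le_self_pow₀ hD1 (by omega)

/-- A device for products: they are estimated as amplitudes with a dummy parameter, which is then
set to 0. -/
theorem IsAmplitude.isUniformSchwartz_slice {M : ℕ} {F : ι → E × E → ℂ} (hF : IsAmplitude M F) :
    IsUniformSchwartz (fun i v => F i (0, v)) := by
  have hc : ContDiff ℝ ∞ fun v : E => ((0 : E), v) := contDiff_const.prodMk contDiff_id
  refine ⟨fun i => (hF.smooth i).comp hc, fun k N => ?_⟩
  obtain ⟨C, hC, hb⟩ := hF.bound k N
  refine ⟨C, hC, fun i v => ?_⟩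
  have h1 := hF.norm_iteratedFDeriv_slice_le i 0 v k
  have h2 := hb i 0 v
  rw [norm_zero, add_zero, one_pow, mul_one] at h2
  exact (mul_le_mul_of_nonneg_left h1 (by positivity)).trans h2

theorem pow_mul_gaussF_le {E : Type} [NormedAddCommGroup E] (N : ℕ) (ξ : E) :
    (1 + ‖ξ‖) ^ N * gaussF 1 ξ ≤ 2 ^ N * (2 + N.factorial) := by
  set t := ‖ξ‖
  have ht : 0 ≤ t := norm_nonneg ξ
  have h1 := one_add_pow_le ht N
  have h2 : t ^ N ≤ 1 + (t ^ 2) ^ N := by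
    rw [← pow_mul, mul_comm, pow_mul]
    nlinarith [sq_nonneg (t ^ N - 1)]
  -- A single term of the exponential series, together with π ≥ 1.
  have h3 : (t ^ 2) ^ N ≤ N.factorial * Real.exp (π ^ 2 * t ^ 2) := by
    have h := Real.pow_div_factorial_le_exp (π ^ 2 * t ^ 2) (by positivity) N
    rw [div_le_iff₀ (by positivity)] at h
    have hpi : 1 ≤ π ^ 2 := one_le_pow₀ (by linarith [Real.pi_gt_three])
    refine le_trans (pow_le_pow_left₀ (by positivity) ?_ N) (h.trans_eq (mul_comm _ _))
    exact le_mul_of_one_le_left (by positivity) hpi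
  have h4 : Real.exp (π ^ 2 * t ^ 2) * gaussF 1 ξ = 1 := by
    rw [gaussF, ← Real.exp_add]
    simp [t]
  have h5 := gaussF_nonneg 1 ξ
  have h6 := gaussF_le_one zero_le_one ξ
  calc (1 + t) ^ N * gaussF 1 ξ
      ≤ 2 ^ N * (2 + N.factorial * Real.exp (π ^ 2 * t ^ 2)) * gaussF 1 ξ := by
        gcongr
        refine h1.trans (mul_le_mul_of_nonneg_left ?_ (by positivity))
        linarith
    _ = 2 ^ N * (2 * gaussF 1 ξ + N.factorial * (Real.exp (π ^ 2 * t ^ 2) * gaussF 1 ξ)) := by ring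
    _ ≤ _ := by
        rw [h4, mul_one]
        gcongr
        linarith

theorem isUniformSchwartz_gaussF : IsUniformSchwartz (fun _ : ι => (gaussF 1 : E → ℝ)) := by
  refine ⟨fun _ => contDiff_gaussF 1, fun k N => ?_⟩
  obtain ⟨C, m, hC, h⟩ := norm_iteratedFDeriv_gaussF_le (E := E) k 1
  refine ⟨C * (2 ^ (N + m) * (2 + (N + m).factorial)), by positivity, fun _ ξ => ?_⟩
  calc (1 + ‖ξ‖) ^ N * ‖iteratedFDeriv ℝ k (gaussF 1) ξ‖
      ≤ (1 + ‖ξ‖) ^ N * (C * (1 + ‖ξ‖) ^ m * gaussF 1 ξ) := by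
        gcongr
        exact h 1 ⟨zero_le_one, le_rfl⟩ ξ
    _ = C * ((1 + ‖ξ‖) ^ (N + m) * gaussF 1 ξ) := by rw [pow_add]; ring
    _ ≤ _ := mul_le_mul_of_nonneg_left (pow_mul_gaussF_le _ ξ) hC

/-- At s = 0 the Gaussian is 1, so it is used only as a multiplier with bounds uniform in s, and all
decay comes from ψ. -/
theorem IsUniformSchwartz.gaussF_mul {ψ : ι → E → ℂ} (hψ : IsUniformSchwartz ψ) {s : ι → ℝ} {S : ℝ}
    (hs : ∀ i, s i ∈ Set.Icc 0 S) : IsUniformSchwartz (fun i ξ => (gaussF (s i) ξ : ℂ) * ψ i ξ) := by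
  have hm : IsMultiplier 0 (fun i (z : E × E) => gaussF (s i) z.2) := by
    refine ⟨fun i => (contDiff_gaussF (s i)).comp contDiff_snd, fun k => ?_⟩
    obtain ⟨C, m, hC, h⟩ := norm_iteratedFDeriv_gaussF_le (E := E) k S
    refine ⟨C, m, hC, fun i x v => ?_⟩
    have h1 := norm_iteratedFDeriv_comp_clm_le (contDiff_gaussF (s i))
      (ContinuousLinearMap.snd ℝ E E) k (x, v)
    have h2 : ‖ContinuousLinearMap.snd ℝ E E‖ ^ k ≤ 1 :=
      pow_le_one₀ (norm_nonneg (ContinuousLinearMap.snd ℝ E E))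
        (ContinuousLinearMap.norm_snd_le ℝ E E)
    rw [pow_zero, mul_one]
    refine h1.trans ((mul_le_of_le_one_right (norm_nonneg _) h2).trans ?_)
    exact (h (s i) (hs i) v).trans
      (mul_le_of_le_one_right (by positivity) (gaussF_le_one (hs i).1 v))
  have h := hm.bilin (ContinuousLinearMap.lsmul ℝ ℝ) (hψ.isAmplitude (X := E))
  exact h.isUniformSchwartz_slice

end Gaussian

/-! ### Differentiation under the integral and Taylor's formula on [0, 1] -/

section UnitInterval

/-- `f` is continuous on `[0, 1]` with derivative `f'` on `(0, 1)`. -/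
def HasDerivUnit (f f' : ℝ → ℂ) : Prop :=
  ContinuousOn f (Set.Icc 0 1) ∧ ∀ s ∈ Set.Ioo (0 : ℝ) 1, HasDerivAt f (f' s) s

theorem HasDerivUnit.add {f f' g g' : ℝ → ℂ} (hf : HasDerivUnit f f') (hg : HasDerivUnit g g') :
    HasDerivUnit (fun s => f s + g s) (fun s => f' s + g' s) :=
  ⟨hf.1.add hg.1, fun s hs => (hf.2 s hs).add (hg.2 s hs)⟩

theorem HasDerivUnit.const_mul {f f' : ℝ → ℂ} (hf : HasDerivUnit f f') (c : ℂ) :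
    HasDerivUnit (fun s => c * f s) (fun s => c * f' s) :=
  ⟨continuousOn_const.mul hf.1, fun s hs => (hf.2 s hs).const_mul c⟩

theorem HasDerivUnit.sum {κ : Type} (S : Finset κ) {f f' : κ → ℝ → ℂ}
    (hf : ∀ j ∈ S, HasDerivUnit (f j) (f' j)) :
    HasDerivUnit (fun s => ∑ j ∈ S, f j s) (fun s => ∑ j ∈ S, f' j s) :=
  ⟨continuousOn_finsetSum _ fun j hj => (hf j hj).1, fun s hs =>
    HasDerivAt.fun_sum fun j hj => (hf j hj).2 s hs⟩

/-- Dominated convergence gives continuity up to the endpoints and differentiability inside. Nothing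
is asked for s < 0, where the Gaussian factor would grow. -/
theorem HasDerivUnit.integral {V : Type} [MeasurableSpace V] {μ : Measure V} {φ φ' : ℝ → V → ℂ}
    (h : ∀ v, HasDerivUnit (φ · v) (φ' · v))
    (hm : ∀ s ∈ Set.Icc (0 : ℝ) 1, AEStronglyMeasurable (φ s) μ)
    (hm' : ∀ s ∈ Set.Icc (0 : ℝ) 1, AEStronglyMeasurable (φ' s) μ) {B : V → ℝ}
    (hB : Integrable B μ) (hb : ∀ s ∈ Set.Icc (0 : ℝ) 1, ∀ v, ‖φ s v‖ ≤ B v)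
    (hb' : ∀ s ∈ Set.Icc (0 : ℝ) 1, ∀ v, ‖φ' s v‖ ≤ B v) :
    HasDerivUnit (fun s => ∫ v, φ s v ∂μ) (fun s => ∫ v, φ' s v ∂μ) := by
  refine ⟨?_, fun s hs => ?_⟩
  · intro s hs
    refine tendsto_integral_filter_of_dominated_convergence B ?_ ?_ hB ?_
    · exact eventually_nhdsWithin_of_forall hm
    · exact eventually_nhdsWithin_of_forall fun t ht =>
        Filter.Eventually.of_forall (hb t ht)
    · exact Filter.Eventually.of_forall fun v => (h v).1 s hs
  · have hnhds : Set.Ioo (0 : ℝ) 1 ∈ nhds s := Ioo_mem_nhds hs.1 hs.2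
    have hs' := Set.Ioo_subset_Icc_self hs
    refine (hasDerivAt_integral_of_dominated_loc_of_deriv_le (bound := B) hnhds ?_ ?_
      (hm' s hs') ?_ hB ?_).2
    · filter_upwards [hnhds] with t ht using hm t (Set.Ioo_subset_Icc_self ht)
    · exact hB.mono' (hm s hs') (Filter.Eventually.of_forall (hb s hs'))
    · exact Filter.Eventually.of_forall fun v t ht => hb' t (Set.Ioo_subset_Icc_self ht) v
    · exact Filter.Eventually.of_forall fun v t ht => (h v).2 t ht

/-- Taylor's formula for a chain of derivatives. -/
theorem norm_sub_taylor_le (n : ℕ) : ∀ {f : ℕ → ℝ → ℂ},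
    (∀ k, HasDerivUnit (f k) (f (k + 1))) → ∀ {C : ℝ},
    (∀ s ∈ Set.Icc (0 : ℝ) 1, ‖f n s‖ ≤ C) → ∀ s ∈ Set.Icc (0 : ℝ) 1,
      ‖f 0 s - ∑ k ∈ Finset.range n, (s : ℂ) ^ k / (k.factorial : ℂ) * f k 0‖ ≤ C * s ^ n := by
  induction n with
  | zero =>
    intro f _ C hC s hs
    simpa using hC s hs
  | succ n ih =>
    intro f hf C hC s hs
    have hC0 : 0 ≤ C := (norm_nonneg _).trans (hC s hs)
    -- The induction hypothesis is applied to the chain starting at f 1; integrating its bound C t^n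
    -- ≤ C s^n over [0, s] gives C s^{n+1}. The sharper factor 1/(n+1)! is not needed.
    have h1 := ih (f := fun k => f (k + 1)) (fun k => hf (k + 1)) hC
    set P : ℝ → ℂ := fun t => ∑ k ∈ Finset.range (n + 1), (t : ℂ) ^ k / (k.factorial : ℂ) * f k 0
    set Q : ℝ → ℂ := fun t => ∑ k ∈ Finset.range n, (t : ℂ) ^ k / (k.factorial : ℂ) * f (k + 1) 0
    have hP : ∀ t : ℝ, HasDerivAt P (Q t) t := fun t => by
      have e : P = fun t : ℝ => (∑ k ∈ Finset.range n,
          (t : ℂ) ^ (k + 1) / ((k + 1).factorial : ℂ) * f (k + 1) 0) + f 0 0 := by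
        ext1 t
        simp only [P]
        rw [Finset.sum_range_succ']
        simp
      rw [e]
      refine HasDerivAt.add_const _ ?_
      refine HasDerivAt.fun_sum (u := Finset.range n) (A := fun k (t : ℝ) =>
        (t : ℂ) ^ (k + 1) / ((k + 1).factorial : ℂ) * f (k + 1) 0)
        (A' := fun k => (t : ℂ) ^ k / (k.factorial : ℂ) * f (k + 1) 0) (x := t) fun k _ => by
          have h2 := (((Complex.ofRealCLM.hasDerivAt (x := t)).pow (k + 1)).div_const
            ((k + 1).factorial : ℂ)).mul_const (f (k + 1) 0)
          refine h2.congr_deriv ?_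
          simp only [Nat.factorial_succ, Complex.ofRealCLM_apply, Nat.add_sub_cancel]
          have : ((k + 1 : ℕ) : ℂ) ≠ 0 := by exact_mod_cast Nat.succ_ne_zero k
          have : (k.factorial : ℂ) ≠ 0 := by exact_mod_cast k.factorial_ne_zero
          push_cast
          field_simp
    have hQc : Continuous Q := by
      refine continuous_finsetSum _ fun k _ => ?_
      exact ((Complex.continuous_ofReal.pow k).div_const _).mul_const _
    have hPc : Continuous P := continuous_iff_continuousAt.2 fun t => (hP t).continuousAt
    have hsub : Set.Icc 0 s ⊆ Set.Icc (0 : ℝ) 1 := Set.Icc_subset_Icc_right hs.2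
    have hcont : ContinuousOn (fun t => f 1 t - Q t) (Set.Icc 0 s) :=
      ((hf 1).1.mono hsub).sub hQc.continuousOn
    have h3 := intervalIntegral.integral_eq_sub_of_hasDerivAt_of_le (a := 0) (b := s) hs.1
      (f := fun t => f 0 t - P t) (f' := fun t => f 1 t - Q t)
      (((hf 0).1.mono hsub).sub hPc.continuousOn)
      (fun t ht => ((hf 0).2 t ⟨ht.1, ht.2.trans_le hs.2⟩).sub (hP t))
      (hcont.intervalIntegrable_of_Icc hs.1)
    have hP0 : P 0 = f 0 0 := by
      simp only [P]
      rw [Finset.sum_range_succ']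
      simp
    simp only [hP0, sub_self, sub_zero] at h3
    rw [← h3]
    have h4 := intervalIntegral.norm_integral_le_of_norm_le_const (a := 0) (b := s) (C := C * s ^ n)
      (f := fun t => f 1 t - Q t) fun t ht => by
        rw [Set.uIoc_of_le hs.1] at ht
        refine (h1 t ⟨ht.1.le, ht.2.trans hs.2⟩).trans ?_
        exact mul_le_mul_of_nonneg_left (pow_le_pow_left₀ ht.1.le ht.2 n) hC0
    rw [sub_zero, abs_of_nonneg hs.1, mul_assoc, ← pow_succ] at h4
    exact h4

end UnitInterval

/-! ### Derivatives of Schwartz functions and their Fourier transforms -/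

section SchwartzDerivatives

open FourierTransform LineDeriv Laplacian

variable {d : ℕ}

/-- The complexification of a real Schwartz function. -/
def complexify (b : 𝓢(Phase d, ℝ)) : 𝓢(Phase d, ℂ) := b.postcompCLM (𝕜 := ℝ) Complex.ofRealCLM

theorem complexify_apply (b : 𝓢(Phase d, ℝ)) (z : Phase d) : complexify b z = (b z : ℂ) := rfl

/-- The partial derivative of a Schwartz function. -/
def schwartzPartial (j : Fin d ⊕ Fin d) (b : 𝓢(Phase d, ℝ)) : 𝓢(Phase d, ℝ) :=
  ∂_{(EuclideanSpace.single j (1 : ℝ) : Phase d)} b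

/-- The Laplacian of a Schwartz function. -/
def schwartzLaplacian (b : 𝓢(Phase d, ℝ)) : 𝓢(Phase d, ℝ) := Δ b

theorem coe_schwartzPartial (j : Fin d ⊕ Fin d) (b : 𝓢(Phase d, ℝ)) :
    ⇑(schwartzPartial j b) = partialDeriv j b :=
  funext fun z => SchwartzMap.lineDerivOp_apply_eq_fderiv _ b z

theorem coe_schwartzLaplacian (b : 𝓢(Phase d, ℝ)) :
    ⇑(schwartzLaplacian b) = Laplacian.laplacian (b : Phase d → ℝ) :=
  funext fun z => SchwartzMap.laplacian_apply b z

theorem coe_iterate_schwartzLaplacian (l : ℕ) (b : 𝓢(Phase d, ℝ)) :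
    ⇑(schwartzLaplacian^[l] b) =
      (Laplacian.laplacian : (Phase d → ℝ) → Phase d → ℝ)^[l] (b : Phase d → ℝ) := by
  induction l generalizing b with
  | zero => rfl
  | succ l ih => rw [Function.iterate_succ_apply, Function.iterate_succ_apply, ih,
      coe_schwartzLaplacian]

theorem schwartzLaplacian_eq_sum (b : 𝓢(Phase d, ℝ)) :
    schwartzLaplacian b = ∑ j, schwartzPartial j (schwartzPartial j b) := by
  rw [schwartzLaplacian, SchwartzMap.laplacian_eq_sum (EuclideanSpace.basisFun _ ℝ)]
  simp [schwartzPartial]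

theorem schwartzPartial_comm (i j : Fin d ⊕ Fin d) (b : 𝓢(Phase d, ℝ)) :
    schwartzPartial i (schwartzPartial j b) = schwartzPartial j (schwartzPartial i b) := by
  ext z
  have h1 : ContDiff ℝ ∞ (fderiv ℝ b) := (b.smooth ⊤).fderiv_right (by norm_cast)
  have h2 : ∀ v w : Phase d, fderiv ℝ (fun z => fderiv ℝ b z v) z w =
      fderiv ℝ (fderiv ℝ b) z w v := fun v w => by
    have := ((h1.differentiable (by simp)) z).hasFDerivAt.clm_apply (hasFDerivAt_const v z)
    rw [this.fderiv]
    simp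
  have h3 := second_derivative_symmetric (f := b) (f' := fderiv ℝ b) (x := z)
    (fun y => b.hasFDerivAt y) ((h1.differentiable (by simp)) z).hasFDerivAt
  rw [coe_schwartzPartial, coe_schwartzPartial, coe_schwartzPartial, coe_schwartzPartial]
  have e : ∀ j, partialDeriv j b = fun z => fderiv ℝ b z (EuclideanSpace.single j 1) :=
    fun j => rfl
  rw [e, e, partialDeriv, partialDeriv, h2, h2]
  exact h3 _ _

theorem schwartzLaplacian_partial (j : Fin d ⊕ Fin d) (b : 𝓢(Phase d, ℝ)) :
    schwartzLaplacian (schwartzPartial j b) = schwartzPartial j (schwartzLaplacian b) := by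
  rw [schwartzLaplacian_eq_sum, schwartzLaplacian_eq_sum]
  conv_rhs => rw [schwartzPartial, lineDerivOp_sum]
  refine Finset.sum_congr rfl fun i _ => ?_
  rw [schwartzPartial_comm i j b, schwartzPartial_comm i j]
  rfl

theorem complexify_lineDeriv (v : Phase d) (b : 𝓢(Phase d, ℝ)) :
    complexify (∂_{v} b) = ∂_{v} (complexify b) := by
  ext z
  rw [complexify_apply, SchwartzMap.lineDerivOp_apply_eq_fderiv,
    SchwartzMap.lineDerivOp_apply_eq_fderiv]
  have h := (Complex.ofRealCLM.hasFDerivAt.comp z (b.hasFDerivAt z)).fderiv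
  exact (congrArg (· v) h).symm

theorem fourier_complexify_partial (j : Fin d ⊕ Fin d) (b : 𝓢(Phase d, ℝ)) (ξ : Phase d) :
    𝓕 (complexify (schwartzPartial j b)) ξ =
      2 * Real.pi * Complex.I * (ξ j : ℂ) * 𝓕 (complexify b) ξ := by
  obtain ⟨v, hv⟩ : ∃ v : Phase d, EuclideanSpace.single j (1 : ℝ) = v := ⟨_, rfl⟩
  have : (inner ℝ · v : Phase d → ℝ).HasTemperateGrowth :=
    ((innerSL ℝ).flip v).hasTemperateGrowth
  have e : inner ℝ ξ v = ξ j := by simp [← hv, EuclideanSpace.inner_single_right]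
  rw [schwartzPartial, hv, complexify_lineDeriv, SchwartzMap.fourier_lineDerivOp_eq]
  simp [SchwartzMap.smulLeftCLM_apply_apply this, mul_assoc, e]

theorem fourier_complexify_laplacian (b : 𝓢(Phase d, ℝ)) (ξ : Phase d) :
    𝓕 (complexify (schwartzLaplacian b)) ξ =
      -(4 * Real.pi ^ 2 * (‖ξ‖ : ℂ) ^ 2) * 𝓕 (complexify b) ξ := by
  have e : complexify (schwartzLaplacian b) =
      ∑ j, complexify (schwartzPartial j (schwartzPartial j b)) := by
    rw [schwartzLaplacian_eq_sum]
    exact map_sum (SchwartzMap.postcompCLM (𝕜 := ℝ) Complex.ofRealCLM) _ _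
  have e2 : 𝓕 (∑ j, complexify (schwartzPartial j (schwartzPartial j b))) =
      ∑ j, 𝓕 (complexify (schwartzPartial j (schwartzPartial j b))) :=
    map_sum (fourierCLM ℂ 𝓢(Phase d, ℂ)) _ _
  have e3 : (‖ξ‖ : ℂ) ^ 2 = ∑ j, (ξ j : ℂ) ^ 2 := by
    rw [← Complex.ofReal_pow, EuclideanSpace.real_norm_sq_eq]
    push_cast
    rfl
  rw [e, e2, sum_apply, e3, Finset.mul_sum, ← Finset.sum_neg_distrib, Finset.sum_mul]
  refine Finset.sum_congr rfl fun j _ => ?_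
  rw [fourier_complexify_partial, fourier_complexify_partial]
  linear_combination (4 * Real.pi ^ 2 * (ξ j : ℂ) ^ 2 * (𝓕 (complexify b)) ξ) * Complex.I_sq

theorem fderiv_eq_sum_partialDeriv {a : Phase d → ℝ} (z v : Phase d) :
    fderiv ℝ a z v = ∑ j, v j * partialDeriv j a z := by
  conv_lhs => rw [← (EuclideanSpace.basisFun (Fin d ⊕ Fin d) ℝ).sum_repr v]
  simp [partialDeriv]

end SchwartzDerivatives

/-! ### The composition symbol as a function of the parameter and its Taylor remainder -/

section Family

open Real FourierTransform

variable {d : ℕ}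

/-- The symbol of the composition of the Weyl quantization of `a` with the Anti-Wick quantization
of `b` at parameter `s`, in the order given by the sign `σ`. -/
def compSymbol (σ : ℝ) (b : 𝓢(Phase d, ℝ)) (a : Phase d → ℝ) (s : ℝ) : Phase d → ℂ :=
  twist (-(σ * π * s)) (fun ξ => (gaussF s ξ : ℂ) * 𝓕 (complexify b) ξ) a

/-- The iterated derivatives of `compSymbol σ b a` with respect to the parameter. -/
def compSymbolDeriv (σ : ℝ) :
    ℕ → 𝓢(Phase d, ℝ) → (Phase d → ℝ) → ℝ → Phase d → ℂ
  | 0, b, a => compSymbol σ b a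
  | k + 1, b, a => fun s z =>
      4⁻¹ * compSymbolDeriv σ k (schwartzLaplacian b) a s z +
        ∑ j, ∑ i, (Complex.I * σ / 2 * matJ d j i) *
          compSymbolDeriv σ k (schwartzPartial i b) (partialDeriv j a) s z

theorem isUniformSchwartz_compSymbolDeriv {M : ℕ} (σ S : ℝ) (k : ℕ) :
    ∀ (b : 𝓢(Phase d, ℝ)) {a : Phase d → ℝ}, HasSymbolGrowth M a →
      IsUniformSchwartz (fun s : Set.Icc (0 : ℝ) S => compSymbolDeriv σ k b a s) := by
  induction k with
  | zero =>
    intro b a ha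
    refine ha.isUniformSchwartz_twist (K := |σ * π| * |S|) (fun s => ?_)
      (((𝓕 (complexify b)).isUniformSchwartz).gaussF_mul fun s => s.2)
    rw [abs_neg, abs_mul]
    gcongr 1
    exact abs_le_abs_of_nonneg s.2.1 s.2.2
  | succ k ih =>
    intro b a ha
    exact ((ih (schwartzLaplacian b) ha).const_smul _).add
      (IsUniformSchwartz.sum _ fun j _ => IsUniformSchwartz.sum _ fun i _ =>
        (ih (schwartzPartial i b) (ha.partialDeriv j)).const_smul _)

/-- The integrand of `compSymbol`. -/
def compIntegrand (σ : ℝ) (b : 𝓢(Phase d, ℝ)) (a : Phase d → ℝ) (s : ℝ) (z ξ : Phase d) : ℂ :=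
  (𝐞 (inner ℝ ξ z) : ℂ) * ((a (z + (-(σ * π * s)) • symp ξ) : ℂ) *
    ((gaussF s ξ : ℂ) * 𝓕 (complexify b) ξ))

theorem compSymbol_eq (σ : ℝ) (b : 𝓢(Phase d, ℝ)) (a : Phase d → ℝ) (s : ℝ) (z : Phase d) :
    compSymbol σ b a s z = ∫ ξ, compIntegrand σ b a s z ξ := rfl

theorem exists_compIntegrand_bound {M : ℕ} (σ : ℝ) (b : 𝓢(Phase d, ℝ)) {a : Phase d → ℝ}
    (ha : HasSymbolGrowth M a) (z : Phase d) : ∃ C : ℝ, ∀ s ∈ Set.Icc (0 : ℝ) 1, ∀ ξ,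
      ‖compIntegrand σ b a s z ξ‖ ≤ C * ((1 + ‖ξ‖) ^ decayExp (Phase d))⁻¹ := by
  have h := ha.isAmplitude_twist (κ := fun s : Set.Icc (0 : ℝ) 1 => -(σ * π * s)) (K := |σ * π|)
    (fun s => ?_) (((𝓕 (complexify b)).isUniformSchwartz).gaussF_mul fun s => s.2)
  · obtain ⟨C, hC, hb⟩ := h.bound 0 (decayExp (Phase d))
    refine ⟨C * (1 + ‖z‖) ^ M, fun s hs ξ => ?_⟩
    have := hb ⟨s, hs⟩ z ξ
    rw [norm_iteratedFDeriv_zero] at this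
    rw [compIntegrand, norm_mul, Circle.norm_coe, one_mul, ← div_eq_mul_inv,
      le_div_iff₀ (by positivity), mul_comm]
    exact this
  · rw [abs_neg, abs_mul, abs_of_nonneg s.2.1]
    exact mul_le_of_le_one_right (abs_nonneg _) s.2.2

theorem continuous_compIntegrand {M : ℕ} (σ : ℝ) (b : 𝓢(Phase d, ℝ)) {a : Phase d → ℝ}
    (ha : HasSymbolGrowth M a) (s : ℝ) (z : Phase d) : Continuous (compIntegrand σ b a s z) := by
  have h1 := ha.1.continuous
  have h2 := (contDiff_gaussF (E := Phase d) s).continuous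
  have h3 := (𝓕 (complexify b)).continuous
  have h4 : Continuous fun t : ℝ => (𝐞 t : ℂ) :=
    continuous_subtype_val.comp continuous_fourierChar
  unfold compIntegrand
  fun_prop

theorem integrable_compIntegrand {M : ℕ} (σ : ℝ) (b : 𝓢(Phase d, ℝ)) {a : Phase d → ℝ}
    (ha : HasSymbolGrowth M a) {s : ℝ} (hs : 0 ≤ s) (z : Phase d) :
    Integrable (compIntegrand σ b a s z) := by
  have h := (ha.isAmplitude_twist (κ := fun _ : Unit => -(σ * π * s)) (fun _ => le_rfl)
    (((𝓕 (complexify b)).isUniformSchwartz (ι := Unit)).gaussF_mul (s := fun _ => s) (S := s)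
      fun _ => ⟨hs, le_rfl⟩)).integrable_osc (-ContinuousLinearMap.id ℝ (Phase d)) () z
  refine h.congr (Filter.Eventually.of_forall fun ξ => ?_)
  simp only [neg_apply, ContinuousLinearMap.id_apply, inner_neg_right, neg_neg, Circle.smul_def,
    smul_eq_mul, shear_apply, compIntegrand]

/-- The Gaussian contributes -π²|ξ|² b̂, a quarter of the transform of Δb. The shift contributes -σπ
Σ J_ji ξ_i ∂_j a, and ξ_i b̂ is the transform of ∂_i b divided by 2πi, whence the constant iσ/2. -/
theorem hasDerivAt_compIntegrand {M : ℕ} (σ : ℝ) (b : 𝓢(Phase d, ℝ)) {a : Phase d → ℝ}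
    (ha : HasSymbolGrowth M a) (s : ℝ) (z ξ : Phase d) :
    HasDerivAt (fun s => compIntegrand σ b a s z ξ)
      (4⁻¹ * compIntegrand σ (schwartzLaplacian b) a s z ξ +
        ∑ j, ∑ i, (Complex.I * σ / 2 * matJ d j i) *
          compIntegrand σ (schwartzPartial i b) (partialDeriv j a) s z ξ) s := by
  have hp : HasDerivAt (fun s : ℝ => z + (-(σ * π * s)) • symp ξ) ((-(σ * π)) • symp ξ) s := by
    have h0 : HasDerivAt (fun s : ℝ => -(σ * π * s)) (-(σ * π)) s := by
      simpa using ((hasDerivAt_id s).const_mul (σ * π)).fun_neg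
    exact (h0.smul_const (symp ξ)).const_add z
  have hd : HasDerivAt (fun s : ℝ => a (z + (-(σ * π * s)) • symp ξ))
      (fderiv ℝ a (z + (-(σ * π * s)) • symp ξ) ((-(σ * π)) • symp ξ)) s :=
    (((ha.1.differentiable (by simp)) _).hasFDerivAt).comp_hasDerivAt s hp
  have h := (hd.ofReal_comp.mul ((hasDerivAt_gaussF s ξ).ofReal_comp.mul_const
    (𝓕 (complexify b) ξ))).const_mul (𝐞 (inner ℝ ξ z) : ℂ)
  refine h.congr_deriv ?_
  rw [map_smul, fderiv_eq_sum_partialDeriv]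
  simp only [compIntegrand, fourier_complexify_partial, fourier_complexify_laplacian,
    symp_apply_eq_matJ, smul_eq_mul]
  push_cast
  have e : ∀ j, ∑ i, (Complex.I * σ / 2 * matJ d j i) * ((𝐞 (inner ℝ ξ z) : ℂ) *
      ((partialDeriv j a (z + (-(σ * π * s)) • symp ξ) : ℂ) * ((gaussF s ξ : ℂ) *
        (2 * π * Complex.I * (ξ i : ℂ) * 𝓕 (complexify b) ξ)))) =
      (𝐞 (inner ℝ ξ z) : ℂ) * (-(σ * π) * ((∑ i, (matJ d j i : ℂ) * (ξ i : ℂ)) *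
        (partialDeriv j a (z + (-(σ * π * s)) • symp ξ) : ℂ))) *
          ((gaussF s ξ : ℂ) * 𝓕 (complexify b) ξ) := fun j => by
    simp only [Finset.mul_sum, Finset.sum_mul]
    refine Finset.sum_congr rfl fun i _ => ?_
    linear_combination (σ * π * (matJ d j i : ℂ) * (𝐞 (inner ℝ ξ z) : ℂ) *
      (partialDeriv j a (z + (-(σ * π * s)) • symp ξ) : ℂ) * (gaussF s ξ : ℂ) * (ξ i : ℂ) *
      𝓕 (complexify b) ξ) * Complex.I_sq
  rw [Finset.sum_congr rfl fun j _ => e j, ← Finset.sum_mul, ← Finset.mul_sum, ← Finset.mul_sum]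
  ring

theorem hasDerivUnit_compSymbol {M : ℕ} (σ : ℝ) (b : 𝓢(Phase d, ℝ)) {a : Phase d → ℝ}
    (ha : HasSymbolGrowth M a) (z : Phase d) :
    HasDerivUnit (fun s => compSymbol σ b a s z) (fun s => compSymbolDeriv σ 1 b a s z) := by
  set φ' : ℝ → Phase d → ℂ := fun s ξ => 4⁻¹ * compIntegrand σ (schwartzLaplacian b) a s z ξ +
        ∑ j, ∑ i, (Complex.I * σ / 2 * matJ d j i) *
          compIntegrand σ (schwartzPartial i b) (partialDeriv j a) s z ξ with hφ'
  obtain ⟨C₀, h0⟩ := exists_compIntegrand_bound σ b ha z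
  obtain ⟨C₁, h1⟩ := exists_compIntegrand_bound σ (schwartzLaplacian b) ha z
  choose C₂ h2 using fun j i =>
    exists_compIntegrand_bound σ (schwartzPartial i b) (ha.partialDeriv j) z
  have hcont' : ∀ s, Continuous (φ' s) := fun s => by
    refine ((continuous_compIntegrand σ _ ha s z).const_mul _).add ?_
    exact continuous_finsetSum _ fun j _ => continuous_finsetSum _ fun i _ =>
      (continuous_compIntegrand σ _ (ha.partialDeriv j) s z).const_mul _
  set C' : ℝ := ‖(4⁻¹ : ℂ)‖ * C₁ + ∑ j, ∑ i, ‖Complex.I * σ / 2 * matJ d j i‖ * C₂ j i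
  have hb' : ∀ s ∈ Set.Icc (0 : ℝ) 1, ∀ ξ,
      ‖φ' s ξ‖ ≤ C' * ((1 + ‖ξ‖) ^ decayExp (Phase d))⁻¹ := fun s hs ξ => by
    refine (norm_add_le _ _).trans ?_
    rw [add_mul]
    refine add_le_add ?_ ?_
    · rw [norm_mul, mul_assoc]
      exact mul_le_mul_of_nonneg_left (h1 s hs ξ) (norm_nonneg _)
    · rw [Finset.sum_mul]
      refine (norm_sum_le _ _).trans (Finset.sum_le_sum fun j _ => ?_)
      rw [Finset.sum_mul]
      refine (norm_sum_le _ _).trans (Finset.sum_le_sum fun i _ => ?_)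
      rw [norm_mul, mul_assoc]
      exact mul_le_mul_of_nonneg_left (h2 j i s hs ξ) (norm_nonneg _)
  have hD : ∀ ξ : Phase d, 0 ≤ ((1 + ‖ξ‖) ^ decayExp (Phase d))⁻¹ := fun ξ => by positivity
  have h := HasDerivUnit.integral (μ := (volume : Measure (Phase d)))
    (φ := fun s ξ => compIntegrand σ b a s z ξ) (φ' := φ')
    (B := fun ξ => max C₀ C' * ((1 + ‖ξ‖) ^ decayExp (Phase d))⁻¹)
    (fun ξ => ⟨fun s _ => (hasDerivAt_compIntegrand σ b ha s z ξ).continuousAt.continuousWithinAt,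
      fun s _ => hasDerivAt_compIntegrand σ b ha s z ξ⟩)
    (fun s _ => (continuous_compIntegrand σ b ha s z).aestronglyMeasurable)
    (fun s _ => (hcont' s).aestronglyMeasurable) (integrable_decay.const_mul _)
    (fun s hs ξ => (h0 s hs ξ).trans (mul_le_mul_of_nonneg_right (le_max_left _ _) (hD ξ)))
    (fun s hs ξ => (hb' s hs ξ).trans (mul_le_mul_of_nonneg_right (le_max_right _ _) (hD ξ)))
  refine ⟨h.1, fun s hs => (h.2 s hs).congr_deriv ?_⟩
  have hi : ∀ j i, Integrable fun ξ => (Complex.I * σ / 2 * matJ d j i) *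
      compIntegrand σ (schwartzPartial i b) (partialDeriv j a) s z ξ := fun j i =>
    (integrable_compIntegrand σ _ (ha.partialDeriv j) hs.1.le z).const_mul _
  rw [hφ']
  simp only
  rw [integral_add ((integrable_compIntegrand σ _ ha hs.1.le z).const_mul _)
    (integrable_finsetSum _ fun j _ => integrable_finsetSum _ fun i _ => hi j i),
    integral_finsetSum _ fun j _ => integrable_finsetSum _ fun i _ => hi j i,
    integral_const_mul]
  simp only [integral_finsetSum _ fun i _ => hi _ i, integral_const_mul]
  rfl

/-- The first derivative has the form of the original symbol for other pairs (a, b), and ∂_j a has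
the same growth order M as a. So the general case reduces to the first derivative by linearity. -/
theorem hasDerivUnit_compSymbolDeriv {M : ℕ} (σ : ℝ) (k : ℕ) :
    ∀ (b : 𝓢(Phase d, ℝ)) {a : Phase d → ℝ}, HasSymbolGrowth M a → ∀ z,
      HasDerivUnit (fun s => compSymbolDeriv σ k b a s z)
        (fun s => compSymbolDeriv σ (k + 1) b a s z) := by
  induction k with
  | zero => intro b a ha z; exact hasDerivUnit_compSymbol σ b ha z
  | succ k ih =>
    intro b a ha z
    exact ((ih _ ha z).const_mul _).add (HasDerivUnit.sum _ fun j _ => HasDerivUnit.sum _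
      fun i _ => (ih _ (ha.partialDeriv j) z).const_mul _)

theorem IsUniformSchwartz.fourier {ι : Type} {ψ : ι → Phase d → ℂ} (hψ : IsUniformSchwartz ψ) :
    IsUniformSchwartz (fun i => 𝓕 (ψ i)) :=
  (hψ.isAmplitude (X := Phase d)).isUniformSchwartz_osc (ContinuousLinearMap.id ℝ (Phase d))
    (K := 1) fun x => by simp

/-- The iterated derivatives of `compSymbol` as Schwartz functions. -/
def compSchwartz {M : ℕ} (σ : ℝ) (k : ℕ) (b : 𝓢(Phase d, ℝ)) {a : Phase d → ℝ}
    (ha : HasSymbolGrowth M a) {s : ℝ} (hs : 0 ≤ s) : 𝓢(Phase d, ℂ) :=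
  (isUniformSchwartz_compSymbolDeriv σ s k b ha).toSchwartz ⟨s, hs, le_rfl⟩

theorem coe_compSchwartz {M : ℕ} (σ : ℝ) (k : ℕ) (b : 𝓢(Phase d, ℝ)) {a : Phase d → ℝ}
    (ha : HasSymbolGrowth M a) {s : ℝ} (hs : 0 ≤ s) :
    ⇑(compSchwartz σ k b ha hs) = compSymbolDeriv σ k b a s := rfl

/-- The derivatives are bounded families of Schwartz functions on [0, 1], hence dominated by one
integrable function. This transfers the chain of derivatives to the Fourier side, where the operator
norm is measured. -/
theorem hasDerivUnit_fourier_compSymbolDeriv {M : ℕ} (σ : ℝ) (k : ℕ) (b : 𝓢(Phase d, ℝ))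
    {a : Phase d → ℝ} (ha : HasSymbolGrowth M a) (η : Phase d) :
    HasDerivUnit (fun s => 𝓕 (compSymbolDeriv σ k b a s) η)
      (fun s => 𝓕 (compSymbolDeriv σ (k + 1) b a s) η) := by
  have hk : ∀ k, ∃ C, ∀ s ∈ Set.Icc (0 : ℝ) 1, ∀ z,
      ‖compSymbolDeriv σ k b a s z‖ ≤ C * ((1 + ‖z‖) ^ decayExp (Phase d))⁻¹ := fun k => by
    obtain ⟨C, hC, h⟩ :=
      (isUniformSchwartz_compSymbolDeriv σ 1 k b ha).bound 0 (decayExp (Phase d))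
    refine ⟨C, fun s hs z => ?_⟩
    have := h ⟨s, hs⟩ z
    rw [norm_iteratedFDeriv_zero] at this
    rwa [← div_eq_mul_inv, le_div_iff₀ (by positivity), mul_comm]
  have hc : ∀ k, ∀ s ∈ Set.Icc (0 : ℝ) 1, AEStronglyMeasurable
      (fun z => 𝐞 (-(inner ℝ z η)) • compSymbolDeriv σ k b a s z) := fun k s hs => by
    have h := ((isUniformSchwartz_compSymbolDeriv σ 1 k b ha).smooth ⟨s, hs⟩).continuous
    exact Continuous.aestronglyMeasurable
      ((continuous_fourierChar.comp (by fun_prop)).smul h)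
  obtain ⟨C, h⟩ := hk k
  obtain ⟨C', h'⟩ := hk (k + 1)
  have hD : ∀ ξ : Phase d, 0 ≤ ((1 + ‖ξ‖) ^ decayExp (Phase d))⁻¹ := fun ξ => by positivity
  simp only [Real.fourier_eq]
  refine HasDerivUnit.integral (B := fun ξ => max C C' * ((1 + ‖ξ‖) ^ decayExp (Phase d))⁻¹)
    (fun z => ?_) (hc k) (hc (k + 1)) (integrable_decay.const_mul _)
    (fun s hs ξ => ?_) (fun s hs ξ => ?_)
  · simp only [Circle.smul_def, smul_eq_mul]
    exact (hasDerivUnit_compSymbolDeriv σ k b ha z).const_mul _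
  · rw [Circle.norm_smul]
    exact (h s hs ξ).trans (mul_le_mul_of_nonneg_right (le_max_left _ _) (hD ξ))
  · rw [Circle.norm_smul]
    exact (h' s hs ξ).trans (mul_le_mul_of_nonneg_right (le_max_right _ _) (hD ξ))

/-- The remainder of the Taylor expansion of `compSymbol` at `s = 0`. -/
def compRemainder {M : ℕ} (σ : ℝ) (n : ℕ) (b : 𝓢(Phase d, ℝ)) {a : Phase d → ℝ}
    (ha : HasSymbolGrowth M a) {s : ℝ} (hs : 0 ≤ s) : 𝓢(Phase d, ℂ) :=
  compSchwartz σ 0 b ha hs -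
    ∑ k ∈ Finset.range n, ((s : ℂ) ^ k / (k.factorial : ℂ)) • compSchwartz σ k b ha le_rfl

/-- Taylor's formula is applied for each fixed frequency η. Its constant is a bound for the
transform of the n-th derivative, which decays in η uniformly in s, so the pointwise bounds can be
integrated. -/
theorem exists_integral_fourier_compRemainder_le {M : ℕ} (σ : ℝ) (n : ℕ) (b : 𝓢(Phase d, ℝ))
    {a : Phase d → ℝ} (ha : HasSymbolGrowth M a) : ∃ C : ℝ, 0 ≤ C ∧ ∀ s (hs : 0 ≤ s), s ≤ 1 →
      ∫ η, ‖𝓕 (compRemainder σ n b ha hs) η‖ ≤ C * s ^ n := by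
  obtain ⟨C, hC, h⟩ :=
    (isUniformSchwartz_compSymbolDeriv σ 1 n b ha).fourier.bound 0 (decayExp (Phase d))
  have hI : 0 ≤ ∫ η : Phase d, ((1 + ‖η‖) ^ decayExp (Phase d))⁻¹ :=
    integral_nonneg fun η => by positivity
  refine ⟨C * ∫ η : Phase d, ((1 + ‖η‖) ^ decayExp (Phase d))⁻¹, by positivity,
    fun s hs hs1 => ?_⟩
  have hb : ∀ η, ‖𝓕 (compRemainder σ n b ha hs) η‖ ≤
      C * s ^ n * ((1 + ‖η‖) ^ decayExp (Phase d))⁻¹ := fun η => by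
    have h1 := norm_sub_taylor_le n
      (f := fun k s => 𝓕 (compSymbolDeriv σ k b a s) η)
      (fun k => hasDerivUnit_fourier_compSymbolDeriv σ k b ha η)
      (C := C * ((1 + ‖η‖) ^ decayExp (Phase d))⁻¹) (fun s hs => by
        have := h ⟨s, hs⟩ η
        rw [norm_iteratedFDeriv_zero] at this
        rwa [← div_eq_mul_inv, le_div_iff₀ (by positivity), mul_comm]) s ⟨hs, hs1⟩
    have e : 𝓕 (compRemainder σ n b ha hs) = 𝓕 (compSchwartz σ 0 b ha hs) -
        ∑ k ∈ Finset.range n, ((s : ℂ) ^ k / (k.factorial : ℂ)) •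
          𝓕 (compSchwartz σ k b ha le_rfl) := by
      have := map_sub (fourierCLM ℂ 𝓢(Phase d, ℂ)) (compSchwartz σ 0 b ha hs)
        (∑ k ∈ Finset.range n, ((s : ℂ) ^ k / (k.factorial : ℂ)) • compSchwartz σ k b ha le_rfl)
      rw [map_sum] at this
      simp only [map_smul] at this
      exact this
    rw [e, sub_apply, sum_apply]
    simp only [smul_apply, smul_eq_mul, SchwartzMap.fourier_coe, coe_compSchwartz]
    refine h1.trans_eq (by ring)
  refine (integral_mono (𝓕 (compRemainder σ n b ha hs)).integrable.norm
    (integrable_decay.const_mul _) hb).trans_eq ?_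
  rw [integral_const_mul]
  ring

end Family

/-! ### Identification of the Taylor coefficients -/

section Moyal

open Real FourierTransform

variable {d : ℕ}

/-- The value of the iterated bidifferential operator on a product. -/
def bidiffProd : ℕ → (Phase d → ℝ) → (Phase d → ℝ) → Phase d → Phase d → ℝ
  | 0, a, b => fun z z' => a z * b z'
  | m + 1, a, b => fun z z' =>
      (1 / 2) * ∑ i, ∑ j, matJ d i j * bidiffProd m (partialDeriv j a) (partialDeriv i b) z z'

theorem contDiff_partialDeriv {a : Phase d → ℝ} (ha : ContDiff ℝ ∞ a) (j : Fin d ⊕ Fin d) :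
    ContDiff ℝ ∞ (partialDeriv j a) := by
  have h1 : ContDiff ℝ ∞ (fderiv ℝ a) := ha.fderiv_right (by norm_cast)
  exact h1.clm_apply contDiff_const

theorem partialDeriv_sum {κ : Type} [Fintype κ] (j : Fin d ⊕ Fin d) (c : κ → ℝ)
    {u : κ → Phase d → ℝ} (hu : ∀ x, ContDiff ℝ ∞ (u x)) (z : Phase d) :
    partialDeriv j (fun w => ∑ x, c x * u x w) z = ∑ x, c x * partialDeriv j (u x) z := by
  have h : HasFDerivAt (fun w => ∑ x, c x * u x w) (∑ x, c x • fderiv ℝ (u x) z) z :=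
    HasFDerivAt.fun_sum fun x _ =>
      (((hu x).differentiable (by simp)) z).hasFDerivAt.const_mul (c x)
  rw [partialDeriv, h.fderiv]
  simp [partialDeriv]

/-- Finite sums of products of smooth functions are stable under A(D), with an enlarged index type.
Iterating needs this explicit form, because A(D) is not additive on arbitrary, possibly
nondifferentiable functions. -/
theorem bidiff_sum {κ : Type} [Fintype κ] (c : κ → ℝ) {u v : κ → Phase d → ℝ}
    (hu : ∀ x, ContDiff ℝ ∞ (u x)) (hv : ∀ x, ContDiff ℝ ∞ (v x)) :
    bidiff (fun w w' => ∑ x, c x * (u x w * v x w')) = fun w w' =>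
      ∑ x : κ × (Fin d ⊕ Fin d) × (Fin d ⊕ Fin d), (1 / 2 * (matJ d x.2.1 x.2.2 * c x.1)) *
        (partialDeriv x.2.2 (u x.1) w * partialDeriv x.2.1 (v x.1) w') := by
  ext z z'
  have h1 : ∀ j w', partialDeriv j (fun w => ∑ x, c x * (u x w * v x w')) z =
      ∑ x, (c x * partialDeriv j (u x) z) * v x w' := fun j w' => by
    have e : (fun w => ∑ x, c x * (u x w * v x w')) = fun w => ∑ x, (c x * v x w') * u x w := by
      ext1 w
      exact Finset.sum_congr rfl fun x _ => by ring
    rw [e, partialDeriv_sum j _ hu]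
    exact Finset.sum_congr rfl fun x _ => by ring
  rw [bidiff]
  simp only [h1, partialDeriv_sum _ _ hv]
  simp only [Fintype.sum_prod_type, Finset.mul_sum]
  conv_rhs => rw [Finset.sum_comm]
  refine Finset.sum_congr rfl fun i _ => ?_
  conv_rhs => rw [Finset.sum_comm]
  exact Finset.sum_congr rfl fun j _ => Finset.sum_congr rfl fun x _ => by ring

theorem iterate_bidiff_sum (m : ℕ) : ∀ {κ : Type} [Fintype κ] (c : κ → ℝ)
    {u v : κ → Phase d → ℝ}, (∀ x, ContDiff ℝ ∞ (u x)) → (∀ x, ContDiff ℝ ∞ (v x)) → ∀ z z',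
      bidiff^[m] (fun w w' => ∑ x, c x * (u x w * v x w')) z z' =
        ∑ x, c x * bidiffProd m (u x) (v x) z z' := by
  induction m with
  | zero => intro κ _ c u v hu hv z z'; rfl
  | succ m ih =>
    intro κ _ c u v hu hv z z'
    rw [Function.iterate_succ_apply, bidiff_sum c hu hv,
      ih (κ := κ × (Fin d ⊕ Fin d) × (Fin d ⊕ Fin d))
        (fun x => 1 / 2 * (matJ d x.2.1 x.2.2 * c x.1)) (u := fun x => partialDeriv x.2.2 (u x.1))
        (v := fun x => partialDeriv x.2.1 (v x.1)) (fun x => contDiff_partialDeriv (hu x.1) _)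
        (fun x => contDiff_partialDeriv (hv x.1) _)]
    simp only [bidiffProd, Fintype.sum_prod_type, Finset.mul_sum]
    refine Finset.sum_congr rfl fun x _ => Finset.sum_congr rfl fun i _ =>
      Finset.sum_congr rfl fun j _ => by ring

theorem matJ_antisymm (i j : Fin d ⊕ Fin d) : matJ d j i = -matJ d i j := by
  cases i <;> cases j <;> simp [matJ, Matrix.one_apply, eq_comm]

/-- Each application of A(D) changes sign under exchange of the two arguments, since J is
antisymmetric. -/
theorem bidiffProd_swap (m : ℕ) : ∀ (a b : Phase d → ℝ) (z z' : Phase d),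
    bidiffProd m b a z z' = (-1) ^ m * bidiffProd m a b z' z := by
  induction m with
  | zero => intro a b z z'; simp only [bidiffProd]; ring
  | succ m ih =>
    intro a b z z'
    simp only [bidiffProd]
    rw [Finset.sum_comm]
    simp only [fun i j => ih (partialDeriv j a) (partialDeriv i b) z z', Finset.mul_sum]
    refine Finset.sum_congr rfl fun i _ => Finset.sum_congr rfl fun j _ => ?_
    rw [matJ_antisymm i j]
    ring

/-- On the diagonal the exchanged term equals the first one times (-1)^m. The coefficient thus
vanishes for even m, and it splits into the contributions of the two products in the commutator. -/
theorem moyalTheta_eq (m : ℕ) {a b : Phase d → ℝ} (ha : ContDiff ℝ ∞ a) (hb : ContDiff ℝ ∞ b)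
    (z : Phase d) : moyalTheta m a b z =
      ((-Complex.I) ^ m - Complex.I ^ m) / (m.factorial : ℂ) * (bidiffProd m a b z z : ℂ) := by
  have e : (fun w w' => a w * b w' - b w * a w') = fun w w' : Phase d =>
      ∑ x : Bool, (cond x (-1) 1 : ℝ) * ((cond x b a) w * (cond x a b) w') := by
    ext w w'
    simp
    ring
  rw [moyalTheta, e, iterate_bidiff_sum m _ (by rintro (_ | _); exacts [ha, hb])
    (by rintro (_ | _); exacts [hb, ha]), Fintype.sum_bool]
  simp only [cond_true, cond_false]
  rw [bidiffProd_swap m a b]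
  have : (-Complex.I) ^ m = (-1) ^ m * Complex.I ^ m := by rw [← mul_pow]; ring_nf
  have h2 : ((-1 : ℂ) ^ m) * (-1) ^ m = 1 := by rw [← mul_pow]; simp
  rw [this]
  push_cast
  linear_combination (-Complex.I ^ m / (m.factorial : ℂ) * (bidiffProd m a b z z : ℂ)) * h2

/-- At s = 0 neither shift nor Gaussian is left, and Fourier inversion gives the pointwise product
for both orders of composition. -/
theorem compSymbol_zero (σ : ℝ) (b : 𝓢(Phase d, ℝ)) (a : Phase d → ℝ) (z : Phase d) :
    compSymbol σ b a 0 z = ((a z * b z : ℝ) : ℂ) := by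
  have h : 𝓕⁻ (𝓕 (complexify b)) z = complexify b z := by
    rw [FourierPair.fourierInv_fourier_eq]
  rw [SchwartzMap.fourierInv_coe, Real.fourierInv_eq, complexify_apply] at h
  rw [compSymbol_eq]
  simp only [compIntegrand, mul_zero, neg_zero, zero_smul, add_zero, gaussF, zero_mul, Real.exp_zero,
    Complex.ofReal_one, one_mul, mul_left_comm _ (a z : ℂ)]
  rw [integral_const_mul, Complex.ofReal_mul, ← h]
  simp only [Circle.smul_def, smul_eq_mul]

/-- The s-derivative acts as Δ/4 on b plus -iσ A(D) on the pair. These two operations commute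
because Δ commutes with partial derivatives, so the binomial theorem applies. -/
theorem compSymbolDeriv_zero (σ : ℝ) (n : ℕ) : ∀ (b : 𝓢(Phase d, ℝ)) (a : Phase d → ℝ)
    (z : Phase d), compSymbolDeriv σ n b a 0 z = ∑ x ∈ Finset.HasAntidiagonal.antidiagonal n,
      (n.choose x.1 : ℂ) * ((4 : ℂ)⁻¹ ^ x.1 * (-Complex.I * σ) ^ x.2 *
        (bidiffProd x.2 a (schwartzLaplacian^[x.1] b) z z : ℂ)) := by
  induction n with
  | zero =>
    intro b a z
    simp [compSymbolDeriv, compSymbol_zero, bidiffProd]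
  | succ n ih =>
    intro b a z
    rw [Finset.sum_antidiagonal_choose_succ_mul (R := ℂ) (fun l m => (4 : ℂ)⁻¹ ^ l *
      (-Complex.I * σ) ^ m * (bidiffProd m a (schwartzLaplacian^[l] b) z z : ℂ)) n, compSymbolDeriv]
    refine (add_comm _ _).trans (congrArg₂ _ ?_ ?_)
    · simp only [ih, Finset.mul_sum]
      refine ((Finset.sum_congr rfl fun j _ => Finset.sum_comm).trans Finset.sum_comm).trans ?_
      refine Finset.sum_congr rfl fun x _ => ?_
      have hc : ∀ i, ⇑(schwartzLaplacian^[x.1] (schwartzPartial i b)) =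
          partialDeriv i (schwartzLaplacian^[x.1] b) := fun i => by
        rw [← coe_schwartzPartial]
        congr 1
        exact (Function.Commute.iterate_left (schwartzLaplacian_partial i) x.1).eq b
      simp only [bidiffProd, hc]
      rw [Finset.sum_comm]
      push_cast
      simp only [Finset.mul_sum]
      refine Finset.sum_congr rfl fun i _ => Finset.sum_congr rfl fun j _ => ?_
      -- The recursion contains J_ji and `bidiffProd` contains J_ij; this sign turns iσ/2 into -iσ
      -- times 1/2.
      rw [matJ_antisymm i j]
      push_cast
      ring
    · rw [ih, Finset.mul_sum]
      refine Finset.sum_congr rfl fun x hx => ?_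
      rw [Nat.choose_symm_of_eq_add (Finset.HasAntidiagonal.mem_antidiagonal.1 hx).symm,
        Function.iterate_succ_apply]
      ring

/-- The binomial coefficient divided by (k + 1)! is 1/(ℓ! m!), and the difference over σ = ±1
produces (-i)^m - i^m, as in the Moyal coefficients. -/
theorem commTheta_eq {a : Phase d → ℝ} (ha : ContDiff ℝ ∞ a) (b : 𝓢(Phase d, ℝ)) (k : ℕ)
    (z : Phase d) : commTheta k a b z = Complex.I / ((k + 1).factorial : ℂ) *
      (compSymbolDeriv 1 (k + 1) b a 0 z - compSymbolDeriv (-1) (k + 1) b a 0 z) := by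
  rw [commTheta, compSymbolDeriv_zero, compSymbolDeriv_zero, ← Finset.sum_sub_distrib,
    div_mul_eq_mul_div, mul_div_assoc, Finset.sum_div]
  congr 1
  refine Finset.sum_congr rfl fun x hx => ?_
  rw [← coe_iterate_schwartzLaplacian, moyalTheta_eq _ ha (SchwartzMap.smooth _ ⊤)]
  have hx' := Finset.HasAntidiagonal.mem_antidiagonal.1 hx
  have h1 : ((k + 1).factorial : ℂ) =
      ((k + 1).choose x.1 : ℂ) * (x.1.factorial : ℂ) * (x.2.factorial : ℂ) := by
    rw [← hx', ← Nat.add_choose_mul_factorial_mul_factorial x.1 x.2]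
    push_cast
    rw [Nat.choose_symm_add]
  have h2 : (((k + 1).choose x.1 : ℕ) : ℂ) ≠ 0 := by
    exact_mod_cast (Nat.choose_pos (by omega)).ne'
  have h3 : (x.1.factorial : ℂ) ≠ 0 := by exact_mod_cast x.1.factorial_ne_zero
  have h4 : (x.2.factorial : ℂ) ≠ 0 := by exact_mod_cast x.2.factorial_ne_zero
  rw [h1]
  push_cast
  simp only [mul_one, mul_neg, neg_neg, inv_pow]
  field_simp

end Moyal

/-! ### The commutator symbol for large ε -/

section LargeParameter

open Real FourierTransform

variable {d : ℕ}

/-- Dilations by δ⁻¹ ≤ 1 keep the derivatives of h bounded, though not its decay; the decay in u is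
supplied by the Gaussian, whose width is fixed after rescaling. -/
theorem isUniformSchwartz_dilate (h : 𝓢(Phase d, ℂ)) : IsUniformSchwartz
    (fun (δ : Set.Ici (1 : ℝ)) (u : Phase d) => h ((δ : ℝ)⁻¹ • u) * (gaussF 1 u : ℂ)) := by
  have hm := (h.hasSymbolGrowth 0).isMultiplier
    (fun δ : Set.Ici (1 : ℝ) => (δ : ℝ)⁻¹ • ContinuousLinearMap.snd ℝ (Phase d) (Phase d))
    (K := 1) fun δ => by
      have h1 : (0 : ℝ) < δ := zero_lt_one.trans_le δ.2
      rw [norm_smul, norm_inv, Real.norm_of_nonneg h1.le]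
      exact mul_le_one₀ (inv_le_one_of_one_le₀ δ.2)
        (norm_nonneg (ContinuousLinearMap.snd ℝ (Phase d) (Phase d)))
        (ContinuousLinearMap.norm_snd_le ℝ (Phase d) (Phase d))
  have h2 := ((isUniformSchwartz_gaussF (ι := Set.Ici (1 : ℝ)) (E := Phase d)).clm_comp
    Complex.ofRealCLM).isAmplitude (X := Phase d)
  exact (hm.bilin (ContinuousLinearMap.mul ℝ ℂ) h2).isUniformSchwartz_slice

/-- The symmetric difference `u ↦ a(z - κ Ju) - a(z + κ Ju)`. -/
def diffSymbol (a : Phase d → ℝ) (κ : ℝ) (z u : Phase d) : ℝ :=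
  a (z + (-κ) • symp u) - a (z + κ • symp u)

theorem contDiff_shift {a : Phase d → ℝ} (ha : ContDiff ℝ ∞ a) (κ : ℝ) (z : Phase d) :
    ContDiff ℝ ∞ (fun u => a (z + κ • symp u)) :=
  ha.comp (contDiff_const.add (κ • symp : Phase d →L[ℝ] Phase d).contDiff)

theorem norm_iteratedFDeriv_shift_le {a : Phase d → ℝ} (ha : ContDiff ℝ ∞ a) (κ : ℝ)
    (z u : Phase d) (n : ℕ) : ‖iteratedFDeriv ℝ n (fun u => a (z + κ • symp u)) u‖ ≤
      ‖iteratedFDeriv ℝ n a (z + κ • symp u)‖ * |κ| ^ n := by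
  have hL : ‖κ • (symp : Phase d →L[ℝ] Phase d)‖ ≤ |κ| := by
    rw [norm_smul, Real.norm_eq_abs]
    refine mul_le_of_le_one_right (abs_nonneg κ) ?_
    exact ContinuousLinearMap.opNorm_le_bound _ zero_le_one fun v => by rw [norm_symp, one_mul]
  have h := norm_iteratedFDeriv_comp_clm_le (f := fun w => a (z + w))
    (ha.comp (contDiff_const.add contDiff_id)) (κ • symp) n u
  rw [iteratedFDeriv_comp_add_left] at h
  refine h.trans ?_
  exact mul_le_mul_of_nonneg_left (pow_le_pow_left₀ (norm_nonneg (κ • symp)) hL n) (norm_nonneg _)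

theorem contDiff_diffSymbol {a : Phase d → ℝ} (ha : ContDiff ℝ ∞ a) (κ : ℝ) (z : Phase d) :
    ContDiff ℝ ∞ (diffSymbol a κ z) :=
  (contDiff_shift ha (-κ) z).sub (contDiff_shift ha κ z)

theorem norm_iteratedFDeriv_diffSymbol_le {a : Phase d → ℝ} (ha : ContDiff ℝ ∞ a) (κ : ℝ)
    (z u : Phase d) (n : ℕ) {K : ℝ}
    (hK : ∀ w, ‖w‖ ≤ ‖z‖ + |κ| * ‖u‖ → ‖iteratedFDeriv ℝ n a w‖ ≤ K) :
    ‖iteratedFDeriv ℝ n (diffSymbol a κ z) u‖ ≤ 2 * K * |κ| ^ n := by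
  have e : diffSymbol a κ z = (fun u => a (z + (-κ) • symp u)) - fun u => a (z + κ • symp u) := rfl
  have hs : ∀ κ', |κ'| = |κ| → ‖z + κ' • symp u‖ ≤ ‖z‖ + |κ| * ‖u‖ := fun κ' h => by
    refine (norm_add_le _ _).trans_eq ?_
    rw [norm_smul, norm_symp, Real.norm_eq_abs, h]
  rw [e, iteratedFDeriv_sub_apply
    ((contDiff_shift ha (-κ) z).contDiffAt.of_le (by exact_mod_cast le_top))
    ((contDiff_shift ha κ z).contDiffAt.of_le (by exact_mod_cast le_top))]
  refine (norm_sub_le _ _).trans ?_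
  have h1 := norm_iteratedFDeriv_shift_le ha (-κ) z u n
  have h2 := norm_iteratedFDeriv_shift_le ha κ z u n
  rw [abs_neg] at h1
  have h3 := mul_le_mul_of_nonneg_right (hK _ (hs (-κ) (abs_neg κ))) (by positivity : 0 ≤ |κ| ^ n)
  have h4 := mul_le_mul_of_nonneg_right (hK _ (hs κ rfl)) (by positivity : 0 ≤ |κ| ^ n)
  linarith

/-- The gradient of a at the points involved is at most of order δ(1 + ‖y‖)(1 + ‖u‖). For n = 0 the
mean value inequality and for n = 1 the chain rule supply a second factor δ. From order two on, the
derivatives of a are bounded and only the chain rule factor of order δ^n is left. -/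
theorem exists_diffSymbol_bound {a : Phase d → ℝ} (ha : IsSubquadratic a) (n : ℕ) :
    ∃ C : ℝ, 0 ≤ C ∧ ∀ δ : ℝ, 1 ≤ δ → ∀ y u,
      ‖iteratedFDeriv ℝ n (diffSymbol a (π * δ) (δ • y)) u‖ ≤
        C * (δ ^ 2 * (1 + ‖y‖) + δ ^ n) * (1 + ‖u‖) ^ 2 := by
  obtain ⟨C, hC, hg⟩ := ha.hasSymbolGrowth_fderiv.2 0
  simp only [norm_iteratedFDeriv_zero, pow_one] at hg
  have hpi := Real.pi_gt_three
  have hz : ∀ (δ : ℝ), 1 ≤ δ → ∀ (y u w : Phase d), ‖w‖ ≤ ‖δ • y‖ + |π * δ| * ‖u‖ →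
      ‖fderiv ℝ a w‖ ≤ C * (π * (δ * ((1 + ‖y‖) * (1 + ‖u‖)))) := fun δ hδ y u w hw => by
    refine (hg w).trans (mul_le_mul_of_nonneg_left ?_ hC)
    have hδ0 : 0 < δ := by linarith
    rw [norm_smul, Real.norm_of_nonneg hδ0.le, abs_of_pos (by positivity)] at hw
    have h1 : 0 ≤ ‖y‖ * ‖u‖ := by positivity
    have h2 : 1 ≤ π * δ := by nlinarith
    have h3 : δ * ‖y‖ ≤ π * δ * ‖y‖ := by
      have : 0 ≤ δ * ‖y‖ := by positivity
      nlinarith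
    have h4 : 0 ≤ π * δ * (‖y‖ * ‖u‖) := by positivity
    linarith
  match n with
  | 0 =>
    refine ⟨2 * π ^ 2 * C, by positivity, fun δ hδ y u => ?_⟩
    have hδ0 : 0 < δ := by linarith
    rw [norm_iteratedFDeriv_zero, diffSymbol, pow_zero]
    have hm : ∀ κ', |κ'| = |π * δ| →
        δ • y + κ' • symp u ∈ Metric.closedBall (δ • y) (|π * δ| * ‖u‖) := fun κ' h => by
      rw [mem_closedBall_iff_norm, add_sub_cancel_left, norm_smul, norm_symp, Real.norm_eq_abs, h]
    have h := (convex_closedBall (δ • y) (|π * δ| * ‖u‖)).norm_image_sub_le_of_norm_fderiv_le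
      (𝕜 := ℝ) (f := a) (C := C * (π * (δ * ((1 + ‖y‖) * (1 + ‖u‖)))))
      (fun w _ => (ha.1.differentiable (by simp)) w) (fun w hw => hz δ hδ y u w (by
        rw [mem_closedBall_iff_norm] at hw
        have := norm_sub_norm_le w (δ • y)
        linarith)) (hm (π * δ) rfl) (hm (-(π * δ)) (abs_neg _))
    refine h.trans ?_
    have e : ‖δ • y + -(π * δ) • symp u - (δ • y + (π * δ) • symp u)‖ = 2 * (π * δ) * ‖u‖ := by
      have : δ • y + -(π * δ) • symp u - (δ • y + (π * δ) • symp u) =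
          (-(2 * (π * δ))) • symp u := by module
      rw [this, norm_smul, norm_symp, norm_neg, Real.norm_of_nonneg (by positivity)]
    rw [e]
    have hu : ‖u‖ ≤ 1 + ‖u‖ := by linarith
    calc C * (π * (δ * ((1 + ‖y‖) * (1 + ‖u‖)))) * (2 * (π * δ) * ‖u‖)
        ≤ C * (π * (δ * ((1 + ‖y‖) * (1 + ‖u‖)))) * (2 * (π * δ) * (1 + ‖u‖)) := by gcongr
      _ = 2 * π ^ 2 * C * (δ ^ 2 * (1 + ‖y‖)) * (1 + ‖u‖) ^ 2 := by ring
      _ ≤ _ := by gcongr; linarith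
  | 1 =>
    refine ⟨2 * π ^ 2 * C, by positivity, fun δ hδ y u => ?_⟩
    have hδ0 : 0 < δ := by linarith
    have h := norm_iteratedFDeriv_diffSymbol_le ha.1 (π * δ) (δ • y) u 1 fun w hw => by
      rw [norm_iteratedFDeriv_one]
      exact hz δ hδ y u w hw
    rw [pow_one, abs_of_pos (by positivity)] at h
    refine h.trans ?_
    have hu : 1 + ‖u‖ ≤ (1 + ‖u‖) ^ 2 := le_self_pow₀ (by linarith [norm_nonneg u]) (by norm_num)
    calc 2 * (C * (π * (δ * ((1 + ‖y‖) * (1 + ‖u‖))))) * (π * δ)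
        = 2 * π ^ 2 * C * (δ ^ 2 * (1 + ‖y‖)) * (1 + ‖u‖) := by ring
      _ ≤ _ := by gcongr; linarith [pow_nonneg hδ0.le 1]
  | n + 2 =>
    obtain ⟨K, hK⟩ := ha.2 (n + 2) (by omega)
    have hK0 : 0 ≤ K := (norm_nonneg _).trans (hK 0)
    refine ⟨2 * K * π ^ (n + 2), by positivity, fun δ hδ y u => ?_⟩
    have hδ0 : 0 < δ := by linarith
    have h := norm_iteratedFDeriv_diffSymbol_le ha.1 (π * δ) (δ • y) u (n + 2) fun w _ => hK w
    rw [abs_of_pos (by positivity), mul_pow] at h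
    have hu : 1 ≤ (1 + ‖u‖) ^ 2 := one_le_pow₀ (by linarith [norm_nonneg u])
    calc _ ≤ _ := h
      _ = 2 * K * π ^ (n + 2) * δ ^ (n + 2) * 1 := by ring
      _ ≤ _ := by
          gcongr
          have : 0 ≤ δ ^ 2 * (1 + ‖y‖) := by positivity
          linarith

/-- The integrand of the rescaled commutator symbol. -/
def commIntegrand (h : 𝓢(Phase d, ℂ)) (a : Phase d → ℝ) (δ : ℝ) (y u : Phase d) : ℂ :=
  diffSymbol a (π * δ) (δ • y) u • (h (δ⁻¹ • u) * (gaussF 1 u : ℂ))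

/-- N integrations by parts in u. The term δ²(1 + ‖y‖) comes from derivatives of order at most one
of the symmetric difference, δ^N from the higher ones. -/
theorem exists_fourier_commIntegrand_bound {a : Phase d → ℝ} (ha : IsSubquadratic a)
    (h : 𝓢(Phase d, ℂ)) (N : ℕ) : ∃ C : ℝ, 0 ≤ C ∧ ∀ δ : ℝ, 1 ≤ δ → ∀ y w,
      ‖w‖ ^ N * ‖𝓕 (commIntegrand h a δ y) w‖ ≤ C * (δ ^ 2 * (1 + ‖y‖) + δ ^ N) := by
  have hw := isUniformSchwartz_dilate h
  choose C hC hb using exists_diffSymbol_bound ha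
  choose K hK hk using hw.bound
  set D := decayExp (Phase d)
  set A : ℕ → ℝ := fun n => ∑ i ∈ Finset.range (n + 1), (n.choose i : ℝ) * C i * K (n - i) (D + 2)
  have hA : ∀ n, 0 ≤ A n := fun n => Finset.sum_nonneg fun i _ =>
    mul_nonneg (mul_nonneg (Nat.cast_nonneg _) (hC _)) (hK _ _)
  have hsm : ∀ δ : ℝ, 1 ≤ δ → ∀ y, ContDiff ℝ ∞ (commIntegrand h a δ y) := fun δ hδ y =>
    (contDiff_diffSymbol ha.1 _ _).smul (hw.smooth ⟨δ, hδ⟩)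
  have hpt : ∀ n (δ : ℝ), 1 ≤ δ → ∀ y u, ‖iteratedFDeriv ℝ n (commIntegrand h a δ y) u‖ ≤
      A n * (δ ^ 2 * (1 + ‖y‖) + δ ^ n) * ((1 + ‖u‖) ^ D)⁻¹ := fun n δ hδ y u => by
    have h1 := (ContinuousLinearMap.lsmul ℝ ℝ : ℝ →L[ℝ] ℂ →L[ℝ] ℂ).norm_iteratedFDeriv_le_of_bilinear
      (contDiff_diffSymbol ha.1 (π * δ) (δ • y)) (hw.smooth ⟨δ, hδ⟩) u (n := n)
      (by exact_mod_cast le_top)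
    have hP : 0 ≤ δ ^ 2 * (1 + ‖y‖) + δ ^ n := by positivity
    have h2 : ‖iteratedFDeriv ℝ n (commIntegrand h a δ y) u‖ ≤
        1 * ∑ i ∈ Finset.range (n + 1), (n.choose i : ℝ) *
          ‖iteratedFDeriv ℝ i (diffSymbol a (π * δ) (δ • y)) u‖ *
          ‖iteratedFDeriv ℝ (n - i) (fun u => h (δ⁻¹ • u) * (gaussF 1 u : ℂ)) u‖ := by
      refine h1.trans (mul_le_mul_of_nonneg_right ?_ ?_)
      · exact ContinuousLinearMap.opNorm_lsmul_le
      · positivity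
    rw [one_mul] at h2
    rw [← div_eq_mul_inv, le_div_iff₀ (by positivity), mul_comm]
    calc _ ≤ (1 + ‖u‖) ^ D * ∑ i ∈ Finset.range (n + 1), (n.choose i : ℝ) *
          ‖iteratedFDeriv ℝ i (diffSymbol a (π * δ) (δ • y)) u‖ *
          ‖iteratedFDeriv ℝ (n - i) (fun u => h (δ⁻¹ • u) * (gaussF 1 u : ℂ)) u‖ := by gcongr
      _ ≤ ∑ i ∈ Finset.range (n + 1),
          (n.choose i : ℝ) * C i * K (n - i) (D + 2) * (δ ^ 2 * (1 + ‖y‖) + δ ^ n) := by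
          rw [Finset.mul_sum]
          refine Finset.sum_le_sum fun i hi => ?_
          have hi' : i ≤ n := Nat.lt_succ_iff.1 (Finset.mem_range.1 hi)
          have e1 := hb i δ hδ y u
          have e2 := hk (n - i) (D + 2) ⟨δ, hδ⟩ u
          have e3 : δ ^ i ≤ δ ^ n := pow_le_pow_right₀ hδ hi'
          set X := ‖iteratedFDeriv ℝ (n - i) (fun u => h (δ⁻¹ • u) * (gaussF 1 u : ℂ)) u‖
          calc (1 + ‖u‖) ^ D * ((n.choose i : ℝ) *
                ‖iteratedFDeriv ℝ i (diffSymbol a (π * δ) (δ • y)) u‖ * X)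
              ≤ (1 + ‖u‖) ^ D * ((n.choose i : ℝ) *
                (C i * (δ ^ 2 * (1 + ‖y‖) + δ ^ n) * (1 + ‖u‖) ^ 2) * X) := by
                have := hC i
                gcongr
                refine e1.trans ?_
                gcongr
            _ = (n.choose i : ℝ) * C i * (δ ^ 2 * (1 + ‖y‖) + δ ^ n) *
                ((1 + ‖u‖) ^ (D + 2) * X) := by rw [pow_add]; ring
            _ ≤ (n.choose i : ℝ) * C i * (δ ^ 2 * (1 + ‖y‖) + δ ^ n) * K (n - i) (D + 2) := by
                have := hC i
                gcongr
            _ = _ := by ring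
      _ = _ := by rw [← Finset.sum_mul]
  set I := ∫ u : Phase d, ((1 + ‖u‖) ^ D)⁻¹
  have hI : 0 ≤ I := integral_nonneg fun u => by positivity
  refine ⟨2 ^ N * ∑ n ∈ Finset.range (N + 1), A n * I, ?_, fun δ hδ y w => ?_⟩
  · exact mul_nonneg (by positivity) (Finset.sum_nonneg fun n _ => mul_nonneg (hA n) hI)
  have hf := fourier_decay (hsm δ hδ y) N (fun n => A n * (δ ^ 2 * (1 + ‖y‖) + δ ^ n) * I)
    (fun n => by
      have hint : Integrable (iteratedFDeriv ℝ n (commIntegrand h a δ y)) :=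
        (integrable_decay.const_mul _).mono'
          ((hsm δ hδ y).continuous_iteratedFDeriv (m := n)
            (by exact_mod_cast le_top)).aestronglyMeasurable
          (Filter.Eventually.of_forall (hpt n δ hδ y))
      refine ⟨hint, ?_⟩
      refine (integral_mono hint.norm (integrable_decay.const_mul _) (hpt n δ hδ y)).trans_eq ?_
      rw [integral_const_mul]) w
  refine hf.trans ?_
  rw [mul_assoc, Finset.sum_mul]
  refine mul_le_mul_of_nonneg_left (Finset.sum_le_sum fun n hn => ?_) (by positivity)
  have hn' : n ≤ N := Nat.lt_succ_iff.1 (Finset.mem_range.1 hn)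
  have e3 : δ ^ n ≤ δ ^ N := pow_le_pow_right₀ hδ hn'
  have := hA n
  calc A n * (δ ^ 2 * (1 + ‖y‖) + δ ^ n) * I ≤ A n * (δ ^ 2 * (1 + ‖y‖) + δ ^ N) * I := by gcongr
    _ = _ := by ring

/-- The first bound serves for t ≤ 1. For t ≥ 1 the factor t² in the second one outweighs the linear
growth on the right, so T = O(δ²) throughout. The third bound gives the decay for t ≥ δ; its two
extra powers again absorb the growth in t. -/
theorem decay_of_three_bounds {T t δ C : ℝ} {D : ℕ} (hT : 0 ≤ T) (ht : 0 ≤ t) (hδ : 1 ≤ δ)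
    (hC : 0 ≤ C) (h0 : T ≤ C * (δ ^ 2 * (1 + t) + 1))
    (h2 : t ^ 2 * T ≤ C * (δ ^ 2 * (1 + t) + δ ^ 2))
    (hD : t ^ (D + 2) * T ≤ C * (δ ^ 2 * (1 + t) + δ ^ (D + 2))) :
    (1 + t / δ) ^ D * T ≤ 2 ^ D * (6 * C) * δ ^ 2 := by
  have hδ0 : 0 < δ := by linarith
  have hδ2 : 1 ≤ δ ^ 2 := one_le_pow₀ hδ
  have h1 : T ≤ 3 * C * δ ^ 2 := by
    rcases le_total t 1 with h | h
    · refine h0.trans ?_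
      have : δ ^ 2 * (1 + t) + 1 ≤ 3 * δ ^ 2 := by nlinarith
      nlinarith
    · have ht2 : 0 < t ^ 2 := by positivity
      refine le_of_mul_le_mul_left (h2.trans ?_) ht2
      have : δ ^ 2 * (1 + t) + δ ^ 2 ≤ 3 * (t ^ 2 * δ ^ 2) := by
        have : 2 + t ≤ 3 * t ^ 2 := by nlinarith
        nlinarith
      nlinarith
  have h3 : (t / δ) ^ D * T ≤ 3 * C * δ ^ 2 := by
    rcases le_total t δ with h | h
    · refine (mul_le_of_le_one_left hT ?_).trans h1
      exact pow_le_one₀ (by positivity) ((div_le_one hδ0).2 h)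
    · have ht1 : 1 ≤ t := hδ.trans h
      have ht0 : 0 < t := by linarith
      rw [div_pow, div_mul_eq_mul_div, div_le_iff₀ (by positivity)]
      have ht2 : 0 < t ^ 2 := by positivity
      refine le_of_mul_le_mul_left (a := t ^ 2) ?_ ht2
      have e1 : δ ^ 2 ≤ δ ^ (D + 2) := pow_le_pow_right₀ hδ (by omega)
      have e2 : δ ^ 2 * (1 + t) ≤ δ ^ (D + 2) * (2 * t ^ 2) :=
        mul_le_mul e1 (by nlinarith) (by positivity) (by positivity)
      have e3 : δ ^ (D + 2) * 1 ≤ δ ^ (D + 2) * t ^ 2 :=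
        mul_le_mul_of_nonneg_left (one_le_pow₀ ht1) (by positivity)
      calc t ^ 2 * (t ^ D * T) = t ^ (D + 2) * T := by rw [pow_add]; ring
        _ ≤ C * (δ ^ 2 * (1 + t) + δ ^ (D + 2)) := hD
        _ ≤ C * (δ ^ (D + 2) * (3 * t ^ 2)) := mul_le_mul_of_nonneg_left (by linarith) hC
        _ = t ^ 2 * (3 * C * δ ^ 2 * δ ^ D) := by rw [pow_add]; ring
  have h4 := one_add_pow_le (show 0 ≤ t / δ by positivity) D
  calc (1 + t / δ) ^ D * T ≤ 2 ^ D * (1 + (t / δ) ^ D) * T := by gcongr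
    _ = 2 ^ D * (T + (t / δ) ^ D * T) := by ring
    _ ≤ 2 ^ D * (3 * C * δ ^ 2 + 3 * C * δ ^ 2) := by gcongr
    _ = _ := by ring

/-- The rescaling ξ = δ⁻¹u with s = δ² turns the Gaussian into a fixed one and the displacement πs
Jξ into πδ Ju. With z = δy the character becomes independent of δ, and the Jacobian is δ^{-2d}. -/
theorem compSymbol_sub_eq {M : ℕ} {a : Phase d → ℝ} (ha : HasSymbolGrowth M a) (b : 𝓢(Phase d, ℝ))
    {δ : ℝ} (hδ : 0 < δ) (y : Phase d) :
    compSymbol 1 b a (δ ^ 2) (δ • y) - compSymbol (-1) b a (δ ^ 2) (δ • y) =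
      (((δ ^ (d + d))⁻¹ : ℝ) : ℂ) * 𝓕 (commIntegrand (𝓕 (complexify b)) a δ y) (-y) := by
  rw [compSymbol_eq, compSymbol_eq,
    ← integral_sub (integrable_compIntegrand 1 b ha (by positivity) _)
      (integrable_compIntegrand (-1) b ha (by positivity) _)]
  have h := Measure.integral_comp_smul_of_nonneg (μ := (volume : Measure (Phase d)))
    (fun ξ => compIntegrand 1 b a (δ ^ 2) (δ • y) ξ - compIntegrand (-1) b a (δ ^ 2) (δ • y) ξ)
    δ⁻¹ (hR := by positivity)
  rw [finrank_euclideanSpace, Fintype.card_sum, Fintype.card_fin, inv_pow, inv_inv] at h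
  have hp : ((δ ^ (d + d) : ℝ) : ℂ) ≠ 0 := by exact_mod_cast (pow_pos hδ _).ne'
  rw [Complex.ofReal_inv, eq_inv_mul_iff_mul_eq₀ hp, ← Complex.real_smul, ← h, Real.fourier_eq]
  congr 1
  ext1 u
  have e1 : inner ℝ (δ⁻¹ • u) (δ • y) = -inner ℝ u (-y) := by
    rw [inner_smul_left, inner_smul_right, inner_neg_right, RCLike.conj_to_real]
    field_simp
  have e2 : gaussF (δ ^ 2) (δ⁻¹ • u) = gaussF 1 u := by
    rw [gaussF, gaussF, norm_smul, norm_inv, Real.norm_of_nonneg hδ.le]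
    congr 1
    field_simp
  have e3 : ∀ σ : ℝ, (-(σ * π * δ ^ 2)) • symp (δ⁻¹ • u) = (-(σ * (π * δ))) • symp u := fun σ => by
    rw [map_smul, smul_smul]
    congr 1
    field_simp
  have e4 := e3 1
  have e5 := e3 (-1)
  simp only [one_mul, neg_mul, neg_neg] at e4 e5
  simp only [compIntegrand, e1, e2, commIntegrand, diffSymbol, Circle.smul_def, smul_eq_mul,
    Complex.real_smul, one_mul, neg_mul, neg_neg, e4, e5]
  push_cast
  ring

/-- With ε = δ², the symbol is at most of order δ^{2-2d} times a decaying function of z/δ².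
Integrating that function gives δ^{4d}, in total δ^{2+2d} = ε·ε^d. -/
theorem exists_integral_compSymbol_sub_le {a : Phase d → ℝ} (ha : IsSubquadratic a)
    (b : 𝓢(Phase d, ℝ)) : ∃ C : ℝ, 0 ≤ C ∧ ∀ ε : ℝ, 1 ≤ ε →
      ∫ z, ‖compSymbol 1 b a ε z - compSymbol (-1) b a ε z‖ ≤ C * ε * ε ^ d := by
  set D := decayExp (Phase d)
  obtain ⟨C₀, hC₀, h0⟩ := exists_fourier_commIntegrand_bound ha (𝓕 (complexify b)) 0
  obtain ⟨C₂, hC₂, h2⟩ := exists_fourier_commIntegrand_bound ha (𝓕 (complexify b)) 2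
  obtain ⟨C₃, hC₃, h3⟩ := exists_fourier_commIntegrand_bound ha (𝓕 (complexify b)) (D + 2)
  set C := C₀ + C₂ + C₃
  set I := ∫ u : Phase d, ((1 + ‖u‖) ^ D)⁻¹
  have hI : 0 ≤ I := integral_nonneg fun u => by positivity
  refine ⟨2 ^ D * (6 * C) * I, by positivity, fun ε hε => ?_⟩
  have hε0 : 0 < ε := by linarith
  obtain ⟨δ, hδ, rfl⟩ : ∃ δ : ℝ, 1 ≤ δ ∧ δ ^ 2 = ε :=
    ⟨√ε, Real.one_le_sqrt.2 hε, Real.sq_sqrt hε0.le⟩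
  have hδ0 : 0 < δ := by linarith
  have hpt : ∀ z, ‖compSymbol 1 b a (δ ^ 2) z - compSymbol (-1) b a (δ ^ 2) z‖ ≤
      (δ ^ (d + d))⁻¹ * (2 ^ D * (6 * C) * δ ^ 2) * ((1 + ‖(δ ^ 2)⁻¹ • z‖) ^ D)⁻¹ := fun z => by
    have e : z = δ • (δ⁻¹ • z) := by rw [smul_smul, mul_inv_cancel₀ hδ0.ne', one_smul]
    have e1 : ‖(δ ^ 2)⁻¹ • z‖ = ‖δ⁻¹ • z‖ / δ := by
      rw [norm_smul, norm_smul, norm_inv, norm_inv, norm_pow, Real.norm_of_nonneg hδ0.le]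
      field_simp
    rw [e1]
    set y := δ⁻¹ • z
    rw [e, compSymbol_sub_eq ha.hasSymbolGrowth b hδ0, norm_mul, Complex.norm_real,
      Real.norm_of_nonneg (by positivity), mul_assoc]
    refine mul_le_mul_of_nonneg_left ?_ (by positivity)
    rw [← div_eq_mul_inv, le_div_iff₀ (by positivity), mul_comm]
    have g0 := h0 δ hδ y (-y)
    have g2 := h2 δ hδ y (-y)
    have g3 := h3 δ hδ y (-y)
    rw [norm_neg] at g0 g2 g3
    rw [pow_zero, one_mul, pow_zero] at g0
    refine decay_of_three_bounds (norm_nonneg _) (norm_nonneg y) hδ (by positivity)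
      (g0.trans ?_) (g2.trans ?_) (g3.trans ?_)
    all_goals refine mul_le_mul_of_nonneg_right ?_ (by positivity)
    all_goals simp only [C]; linarith
  have hsc := Measure.integral_comp_smul_of_nonneg (μ := (volume : Measure (Phase d)))
    (fun z => ((1 + ‖z‖) ^ D)⁻¹) (δ ^ 2)⁻¹ (hR := by positivity)
  rw [finrank_euclideanSpace, Fintype.card_sum, Fintype.card_fin, inv_pow, inv_inv,
    smul_eq_mul] at hsc
  have hint : Integrable fun z : Phase d => ((1 + ‖(δ ^ 2)⁻¹ • z‖) ^ D)⁻¹ :=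
    (integrable_comp_smul_iff volume (fun z : Phase d => ((1 + ‖z‖) ^ D)⁻¹)
      (inv_ne_zero (pow_ne_zero 2 hδ0.ne'))).2 integrable_decay
  refine (integral_mono_of_nonneg (Filter.Eventually.of_forall fun z => norm_nonneg _)
    (hint.const_mul _) (Filter.Eventually.of_forall hpt)).trans_eq ?_
  rw [integral_const_mul, hsc]
  change _ * ((δ ^ 2) ^ (d + d) * I) = _
  rw [pow_add δ, pow_add (δ ^ 2), ← pow_mul, mul_comm 2 d, pow_mul]
  field_simp

end LargeParameter

/-! ### The Weyl symbol of an Anti-Wick operator -/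

section AntiWick

open Real FourierTransform

variable {d : ℕ}

/-- The Fourier transform of the Anti-Wick symbol. -/
def antiWickFourier (b : 𝓢(Phase d, ℝ)) {ε : ℝ} (hε : 0 ≤ ε) : 𝓢(Phase d, ℂ) :=
  (((𝓕 (complexify b)).isUniformSchwartz (ι := Unit)).gaussF_mul (s := fun _ => ε) (S := ε)
    fun _ => ⟨hε, le_rfl⟩).toSchwartz ()

theorem coe_antiWickFourier (b : 𝓢(Phase d, ℝ)) {ε : ℝ} (hε : 0 ≤ ε) :
    ⇑(antiWickFourier b hε) = fun ξ => (gaussF ε ξ : ℂ) * 𝓕 (complexify b) ξ := rfl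

/-- The Weyl symbol of an Anti-Wick operator. -/
def antiWickSymbol (b : 𝓢(Phase d, ℝ)) {ε : ℝ} (hε : 0 ≤ ε) : 𝓢(Phase d, ℂ) :=
  𝓕⁻ (antiWickFourier b hε)

theorem fourier_antiWickSymbol (b : 𝓢(Phase d, ℝ)) {ε : ℝ} (hε : 0 ≤ ε) :
    𝓕 (antiWickSymbol b hε) = antiWickFourier b hε :=
  FourierInvPair.fourier_fourierInv_eq _

theorem char_mul_gaussF (ε : ℝ) (z : Phase d) :
    (fun ξ : Phase d => (𝐞 (inner ℝ ξ z) : ℂ) * (gaussF ε ξ : ℂ)) =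
      fun v => Complex.exp (-((ε * π ^ 2 : ℝ) : ℂ) * (‖v‖ : ℂ) ^ 2 +
        2 * π * Complex.I * (inner ℝ z v : ℝ)) := by
  ext1 v
  rw [fourierChar_eq_exp, gaussF, Complex.ofReal_exp, ← Complex.exp_add, real_inner_comm]
  congr 1
  push_cast
  ring

theorem fourier_gaussF {ε : ℝ} (hε : 0 < ε) (z t : Phase d) :
    𝓕 (fun ξ : Phase d => (𝐞 (inner ℝ ξ z) : ℂ) * (gaussF ε ξ : ℂ)) t = (gauss ε (z - t) : ℂ) := by
  have hpi : (π : ℂ) ≠ 0 := by exact_mod_cast pi_ne_zero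
  have hε' : (ε : ℂ) ≠ 0 := by exact_mod_cast hε.ne'
  have h := fourier_gaussian_innerProductSpace' (V := Phase d) (b := ((ε * π ^ 2 : ℝ) : ℂ))
    (by rw [Complex.ofReal_re]; positivity) z t
  rw [char_mul_gaussF, h, gauss, finrank_euclideanSpace, Fintype.card_sum, Fintype.card_fin]
  have e2 : (((d + d : ℕ) : ℂ) / 2) = (d : ℂ) := by push_cast; ring
  have e3 : (π : ℂ) / ((ε * π ^ 2 : ℝ) : ℂ) = ((π * ε : ℝ) : ℂ)⁻¹ := by
    push_cast
    field_simp
  rw [e2, e3, Complex.cpow_natCast, inv_pow]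
  push_cast
  congr 2
  field_simp

/-- The multiplication formula for the Fourier transform moves the transform from b to the modulated
Gaussian, whose transform is the translate of `gauss ε` to z. -/
theorem antiWickSymbol_apply (b : 𝓢(Phase d, ℝ)) {ε : ℝ} (hε : 0 < ε) (z : Phase d) :
    antiWickSymbol b hε.le z =
      (((b ⋆[ContinuousLinearMap.mul ℝ ℝ, volume] gauss ε) z : ℝ) : ℂ) := by
  have hK : Integrable (fun ξ : Phase d => (𝐞 (inner ℝ ξ z) : ℂ) * (gaussF ε ξ : ℂ)) := by
    rw [char_mul_gaussF]
    exact GaussianFourier.integrable_cexp_neg_mul_sq_norm_add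
      (by rw [Complex.ofReal_re]; positivity) _ _
  have h := VectorFourier.integral_fourierIntegral_smul_eq_flip (L := innerₗ (Phase d))
    (μ := volume) (ν := volume) continuous_fourierChar continuous_inner (complexify b).integrable hK
  rw [flip_innerₗ] at h
  rw [convolution_def, antiWickSymbol, SchwartzMap.fourierInv_coe, Real.fourierInv_eq]
  rw [← integral_complex_ofReal]
  calc _ = ∫ ξ, VectorFourier.fourierIntegral 𝐞 volume (innerₗ (Phase d)) (⇑(complexify b)) ξ •
        ((𝐞 (inner ℝ ξ z) : ℂ) * (gaussF ε ξ : ℂ)) := by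
        congr 1
        ext1 ξ
        rw [coe_antiWickFourier, Circle.smul_def, smul_eq_mul, smul_eq_mul]
        change _ = 𝓕 (complexify b : Phase d → ℂ) ξ * _
        rw [← SchwartzMap.fourier_coe]
        ring
    _ = _ := by
        rw [h]
        congr 1
        ext1 t
        change complexify b t • 𝓕 (fun ξ : Phase d => (𝐞 (inner ℝ ξ z) : ℂ) * (gaussF ε ξ : ℂ)) t = _
        rw [fourier_gaussF hε, complexify_apply]
        simp

end AntiWick

/-! ### Behaviour under complex conjugation -/

section Reality

open Real FourierTransform

variable {d : ℕ}

theorem conj_fourier_complexify (b : 𝓢(Phase d, ℝ)) (ξ : Phase d) :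
    (starRingEnd ℂ) (𝓕 (complexify b) ξ) = 𝓕 (complexify b) (-ξ) := by
  rw [SchwartzMap.fourier_coe, Real.fourier_eq, Real.fourier_eq, ← integral_conj]
  congr 1
  ext1 v
  rw [Circle.smul_def, Circle.smul_def, smul_eq_mul, smul_eq_mul, map_mul, complexify_apply,
    Complex.conj_ofReal, inner_neg_right, ← Circle.coe_inv_eq_conj, ← AddChar.map_neg_eq_inv]

/-- As b is real, its transform is conjugated by ξ ↦ -ξ. Substituting -ξ restores the character and
the Gaussian and reverses only the shift of a. -/
theorem conj_compSymbol (σ : ℝ) (b : 𝓢(Phase d, ℝ)) (a : Phase d → ℝ) (s : ℝ) (z : Phase d) :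
    (starRingEnd ℂ) (compSymbol σ b a s z) = compSymbol (-σ) b a s z := by
  rw [compSymbol_eq, compSymbol_eq, ← integral_conj, ← integral_neg_eq_self]
  congr 1
  ext1 ξ
  have e : gaussF s (-ξ) = gaussF s ξ := by rw [gaussF, gaussF, norm_neg]
  simp only [compIntegrand, map_mul, Complex.conj_ofReal, conj_fourier_complexify, neg_neg, e,
    inner_neg_left, ← Circle.coe_inv_eq_conj, ← AddChar.map_neg_eq_inv, map_neg, smul_neg,
    neg_smul, neg_mul]

theorem conj_compSymbolDeriv (σ : ℝ) (k : ℕ) : ∀ (b : 𝓢(Phase d, ℝ)) (a : Phase d → ℝ) (s : ℝ)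
    (z : Phase d), (starRingEnd ℂ) (compSymbolDeriv σ k b a s z) =
      compSymbolDeriv (-σ) k b a s z := by
  induction k with
  | zero => exact conj_compSymbol σ
  | succ k ih =>
    intro b a s z
    simp only [compSymbolDeriv, map_add, map_mul, map_sum, ih, map_inv₀, map_div₀, Complex.conj_I,
      Complex.conj_ofReal, Complex.conj_ofNat]
    push_cast
    simp only [neg_mul, mul_neg, neg_div]

theorem conj_compRemainder {M : ℕ} (σ : ℝ) (n : ℕ) (b : 𝓢(Phase d, ℝ)) {a : Phase d → ℝ}
    (ha : HasSymbolGrowth M a) {s : ℝ} (hs : 0 ≤ s) (z : Phase d) :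
    (starRingEnd ℂ) (compRemainder σ n b ha hs z) = compRemainder (-σ) n b ha hs z := by
  simp only [compRemainder, sub_apply, sum_apply, smul_apply, smul_eq_mul, coe_compSchwartz,
    map_sub, map_sum, map_mul, conj_compSymbolDeriv, map_div₀, map_pow, Complex.conj_ofReal,
    Complex.conj_natCast]

end Reality

/-! ### Expansion of the commutator and uniform bounds for the remainder -/

section Expansion

open Real FourierTransform

variable {d : ℕ}

/-- The operator `opL2`, as a linear map of the symbol. -/
def opL2Linear (ε : ℝ) : 𝓢(Phase d, ℂ) →ₗ[ℂ] (L2 d →L[ℂ] L2 d) where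
  toFun := opL2 ε
  map_add' := opL2_add ε
  map_smul' := opL2_smul ε

theorem opL2Linear_apply (ε : ℝ) (c : 𝓢(Phase d, ℂ)) : opL2Linear ε c = opL2 ε c := rfl

/-- The value of a Weyl operator at a point, as a linear map of the symbol. -/
def weylLinear (ε : ℝ) (ψ : 𝓢(Config d, ℂ)) (q : Config d) : 𝓢(Phase d, ℂ) →ₗ[ℂ] ℂ where
  toFun c := weyl ε c ψ q
  map_add' c c' := weyl_add_symbol c c' (ψ.memLp 2) ε q
  map_smul' k c := weyl_smul_symbol c ψ k ε q

theorem weylLinear_apply (ε : ℝ) (ψ : 𝓢(Config d, ℂ)) (q : Config d) (c : 𝓢(Phase d, ℂ)) :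
    weylLinear ε ψ q c = weyl ε c ψ q := rfl

/-- The real part of a Schwartz function. -/
def reSchwartz (c : 𝓢(Phase d, ℂ)) : 𝓢(Phase d, ℝ) :=
  SchwartzMap.postcompCLM (𝕜 := ℝ) Complex.reCLM c

theorem ofReal_reSchwartz {c : 𝓢(Phase d, ℂ)} (hc : ∀ z, (starRingEnd ℂ) (c z) = c z)
    (z : Phase d) : ((reSchwartz c z : ℝ) : ℂ) = c z :=
  Complex.conj_eq_iff_re.1 (hc z)

/-- The derivatives of order `k` of the symbol of the commutator of `op(a)` with the Anti-Wick
operator of `b`. -/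
def commSymbol {M : ℕ} (k : ℕ) (b : 𝓢(Phase d, ℝ)) {a : Phase d → ℝ} (ha : HasSymbolGrowth M a)
    {s : ℝ} (hs : 0 ≤ s) : 𝓢(Phase d, ℂ) :=
  compSchwartz 1 k b ha hs - compSchwartz (-1) k b ha hs

/-- The remainder in the expansion of the commutator. -/
def commRemainder {M : ℕ} (n : ℕ) (b : 𝓢(Phase d, ℝ)) {a : Phase d → ℝ} (ha : HasSymbolGrowth M a)
    {s : ℝ} (hs : 0 ≤ s) : 𝓢(Phase d, ℂ) :=
  (Complex.I * ((s : ℂ) ^ (n + 1))⁻¹) •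
    (compRemainder 1 (n + 1) b ha hs - compRemainder (-1) (n + 1) b ha hs)

theorem commRemainder_eq {M : ℕ} (n : ℕ) (b : 𝓢(Phase d, ℝ)) {a : Phase d → ℝ}
    (ha : HasSymbolGrowth M a) {s : ℝ} (hs : 0 ≤ s) :
    commRemainder n b ha hs = (Complex.I * ((s : ℂ) ^ (n + 1))⁻¹) • (commSymbol 0 b ha hs -
      ∑ k ∈ Finset.range (n + 1),
        ((s : ℂ) ^ k / (k.factorial : ℂ)) • commSymbol k b ha le_rfl) := by
  simp only [commRemainder, compRemainder, commSymbol, smul_sub, Finset.sum_sub_distrib]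
  abel

theorem conj_commRemainder {M : ℕ} (n : ℕ) (b : 𝓢(Phase d, ℝ)) {a : Phase d → ℝ}
    (ha : HasSymbolGrowth M a) {s : ℝ} (hs : 0 ≤ s) (z : Phase d) :
    (starRingEnd ℂ) (commRemainder n b ha hs z) = commRemainder n b ha hs z := by
  simp only [commRemainder, sub_apply, smul_apply, smul_eq_mul, map_mul, map_sub,
    conj_compRemainder, map_inv₀, map_pow, Complex.conj_ofReal, Complex.conj_I, neg_neg]
  ring

theorem conj_I_div_smul_commSymbol {M : ℕ} (b : 𝓢(Phase d, ℝ)) {a : Phase d → ℝ}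
    (ha : HasSymbolGrowth M a) {s : ℝ} (hs : 0 ≤ s) (z : Phase d) :
    (starRingEnd ℂ) (((Complex.I / (s : ℂ)) • commSymbol 0 b ha hs) z) =
      ((Complex.I / (s : ℂ)) • commSymbol 0 b ha hs) z := by
  simp only [commSymbol, sub_apply, smul_apply, smul_eq_mul, map_mul, map_sub, coe_compSchwartz,
    conj_compSymbolDeriv, map_div₀, Complex.conj_ofReal, Complex.conj_I, neg_neg]
  ring

theorem coe_I_smul_commSymbol_eq_commTheta {a : Phase d → ℝ} (ha : IsSubquadratic a)
    (b : 𝓢(Phase d, ℝ)) (k : ℕ) :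
    ⇑((Complex.I / ((k + 1).factorial : ℂ)) • commSymbol (k + 1) b ha.hasSymbolGrowth le_rfl) =
      commTheta k a b := by
  ext1 z
  rw [commTheta_eq ha.1]
  rfl

theorem commSymbol_zero_zero {M : ℕ} (b : 𝓢(Phase d, ℝ)) {a : Phase d → ℝ}
    (ha : HasSymbolGrowth M a) : commSymbol 0 b ha le_rfl = 0 := by
  ext z
  change compSymbol 1 b a 0 z - compSymbol (-1) b a 0 z = 0
  rw [compSymbol_zero, compSymbol_zero, sub_self]

/-- The term k = 0 of the Taylor polynomial vanishes because the pointwise product is commutative.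
Division by s then shifts the index, so the remainder of order n + 1 becomes one of order n. -/
theorem commSymbol_expansion {M : ℕ} (n : ℕ) (b : 𝓢(Phase d, ℝ)) {a : Phase d → ℝ}
    (ha : HasSymbolGrowth M a) {s : ℝ} (hs : 0 < s) :
    (Complex.I / (s : ℂ)) • commSymbol 0 b ha hs.le =
      ∑ k ∈ Finset.range n, (s : ℂ) ^ k •
        ((Complex.I / ((k + 1).factorial : ℂ)) • commSymbol (k + 1) b ha le_rfl) +
      (s : ℂ) ^ n • commRemainder n b ha hs.le := by
  have hs' : (s : ℂ) ≠ 0 := by exact_mod_cast hs.ne'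
  have e : (s : ℂ) ^ n * (Complex.I * ((s : ℂ) ^ (n + 1))⁻¹) = Complex.I / s := by
    rw [pow_succ]
    field_simp
  rw [commRemainder_eq, smul_smul, e, Finset.sum_range_succ', commSymbol_zero_zero, smul_zero,
    add_zero, smul_sub, Finset.smul_sum]
  have e2 : ∀ k : ℕ, (Complex.I / (s : ℂ)) • (((s : ℂ) ^ (k + 1) / ((k + 1).factorial : ℂ)) •
      commSymbol (k + 1) b ha le_rfl) = (s : ℂ) ^ k •
        ((Complex.I / ((k + 1).factorial : ℂ)) • commSymbol (k + 1) b ha le_rfl) := fun k => by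
    rw [smul_smul, smul_smul]
    congr 1
    rw [pow_succ]
    field_simp
  simp only [e2]
  abel

/-- The Taylor remainder has order n + 1, which is exactly the power of s divided out in
`commRemainder`. -/
theorem exists_norm_opL2_commRemainder_le_of_le_one {M : ℕ} (n : ℕ) (b : 𝓢(Phase d, ℝ))
    {a : Phase d → ℝ} (ha : HasSymbolGrowth M a) :
    ∃ C : ℝ, ∀ s (hs : 0 < s), s ≤ 1 → ‖opL2 s (commRemainder n b ha hs.le)‖ ≤ C := by
  obtain ⟨C₁, -, h₁⟩ := exists_integral_fourier_compRemainder_le 1 (n + 1) b ha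
  obtain ⟨C₂, -, h₂⟩ := exists_integral_fourier_compRemainder_le (-1) (n + 1) b ha
  refine ⟨C₁ + C₂, fun s hs hs1 => ?_⟩
  rw [commRemainder, ← opL2Linear_apply, map_smul, map_sub, opL2Linear_apply, opL2Linear_apply,
    norm_smul, norm_mul, Complex.norm_I, one_mul, norm_inv, norm_pow, Complex.norm_real,
    norm_of_nonneg hs.le, inv_mul_le_iff₀ (pow_pos hs _), mul_comm, add_mul]
  exact (norm_sub_le _ _).trans (add_le_add
    ((norm_opL2_le_fourier hs _).trans (h₁ s hs.le hs1))
    ((norm_opL2_le_fourier hs _).trans (h₂ s hs.le hs1)))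

/-- The factor s^d in the L¹ norm of the symbol is cancelled by the prefactor (πs)^{-d} of the
reflection bound. -/
theorem exists_norm_opL2_commSymbol_le {a : Phase d → ℝ} (ha : IsSubquadratic a)
    (b : 𝓢(Phase d, ℝ)) :
    ∃ C : ℝ, 0 ≤ C ∧ ∀ s (hs : 1 ≤ s),
      ‖opL2 s (commSymbol 0 b ha.hasSymbolGrowth (zero_le_one.trans hs))‖ ≤ C * s := by
  obtain ⟨C, hC, h⟩ := exists_integral_compSymbol_sub_le ha b
  refine ⟨(π ^ d)⁻¹ * C, by positivity, fun s hs => ?_⟩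
  have hs0 : 0 < s := zero_lt_one.trans_le hs
  refine (norm_opL2_le s _).trans ?_
  rw [abs_of_nonneg (by positivity)]
  calc _ ≤ ((π * s) ^ d)⁻¹ * (C * s * s ^ d) := by
        gcongr
        exact h s hs
    _ = _ := by rw [mul_pow]; field_simp

/-- Here no cancellation is needed. The full symbol contributes O(s), and the Taylor terms are
powers s^k with k ≤ n times operators with fixed symbols, bounded uniformly in s by the Fourier
estimate. Everything is O(s^{n+1}) since s ≥ 1. -/
theorem exists_norm_opL2_commRemainder_le_of_one_le (n : ℕ) (b : 𝓢(Phase d, ℝ))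
    {a : Phase d → ℝ} (ha : IsSubquadratic a) :
    ∃ C : ℝ, ∀ s (hs : 1 ≤ s),
      ‖opL2 s (commRemainder n b ha.hasSymbolGrowth (zero_le_one.trans hs))‖ ≤ C := by
  obtain ⟨C, hC, h⟩ := exists_norm_opL2_commSymbol_le ha b
  refine ⟨C + ∑ k ∈ Finset.range (n + 1),
    ∫ ξ, ‖(𝓕 (commSymbol k b ha.hasSymbolGrowth le_rfl)) ξ‖, fun s hs => ?_⟩
  have hs0 : 0 < s := zero_lt_one.trans_le hs
  rw [commRemainder_eq, ← opL2Linear_apply, map_smul, map_sub, map_sum, norm_smul, norm_mul,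
    Complex.norm_I, one_mul, norm_inv, norm_pow, Complex.norm_real, norm_of_nonneg hs0.le,
    inv_mul_le_iff₀ (pow_pos hs0 _), mul_add, Finset.mul_sum]
  refine (norm_sub_le _ _).trans (add_le_add ((h s hs).trans ?_)
    ((norm_sum_le _ _).trans (Finset.sum_le_sum fun k hk => ?_)))
  · rw [mul_comm]
    gcongr
    exact le_self_pow₀ hs (Nat.succ_ne_zero n)
  · rw [map_smul, norm_smul, opL2Linear_apply, norm_div, norm_pow, Complex.norm_real,
      norm_of_nonneg hs0.le, Complex.norm_natCast]
    refine mul_le_mul ?_ (norm_opL2_le_fourier hs0 _) (norm_nonneg _) (by positivity)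
    exact (div_le_self (by positivity) (by exact_mod_cast k.factorial_pos)).trans
      (pow_le_pow_right₀ hs (Finset.mem_range.1 hk).le)

theorem antiWick_eq_weyl (b : 𝓢(Phase d, ℝ)) {ε : ℝ} (hε : 0 < ε) (ψ : Config d → ℂ) :
    antiWick ε b ψ = weyl ε (antiWickSymbol b hε.le) ψ := by
  rw [antiWick]
  congr 1
  ext1 z
  exact (antiWickSymbol_apply b hε z).symm

theorem conj_antiWickSymbol (b : 𝓢(Phase d, ℝ)) {ε : ℝ} (hε : 0 < ε) (z : Phase d) :
    (starRingEnd ℂ) (antiWickSymbol b hε.le z) = antiWickSymbol b hε.le z := by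
  rw [antiWickSymbol_apply b hε, Complex.conj_ofReal]

/-- The Anti-Wick operator on the Schwartz space. -/
def antiWickMap (b : 𝓢(Phase d, ℝ)) {ε : ℝ} (hε : 0 < ε) : 𝓢(Config d, ℂ) →ₗ[ℂ] 𝓢(Config d, ℂ) :=
  weylMap ((reSchwartz (antiWickSymbol b hε.le)).hasSymbolGrowth 0) hε.ne'

theorem coe_antiWickMap (b : 𝓢(Phase d, ℝ)) {ε : ℝ} (hε : 0 < ε) (ψ : 𝓢(Config d, ℂ)) :
    ⇑(antiWickMap b hε ψ) = weyl ε (antiWickSymbol b hε.le) ψ := by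
  rw [antiWickMap, coe_weylMap]
  congr 1
  ext1 z
  exact ofReal_reSchwartz (conj_antiWickSymbol b hε) z

/-- The two orders of composition correspond to the shifts -πε and +πε, that is, to σ = 1 and σ = -1
at s = ε. -/
theorem commutator_apply {M : ℕ} {a : Phase d → ℝ} (ha : HasSymbolGrowth M a) (b : 𝓢(Phase d, ℝ))
    {ε : ℝ} (hε : 0 < ε) (ψ : 𝓢(Config d, ℂ)) (q : Config d) :
    ((Complex.I / (ε : ℂ)) • (weylMap ha hε.ne' ∘ₗ antiWickMap b hε -
      antiWickMap b hε ∘ₗ weylMap ha hε.ne')) ψ q =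
      weyl ε ((Complex.I / (ε : ℂ)) • commSymbol 0 b ha hε.le) ψ q := by
  have h1 : weylMap ha hε.ne' (antiWickMap b hε ψ) q = weyl ε (compSchwartz 1 0 b ha hε.le) ψ q := by
    rw [coe_weylMap, coe_antiWickMap, weyl_weyl_right ha _ ψ hε, fourier_antiWickSymbol,
      coe_antiWickFourier, coe_compSchwartz, compSymbolDeriv, compSymbol, one_mul]
  have h2 : antiWickMap b hε (weylMap ha hε.ne' ψ) q =
      weyl ε (compSchwartz (-1) 0 b ha hε.le) ψ q := by
    rw [coe_antiWickMap, coe_weylMap, weyl_weyl_left ha _ ψ hε, fourier_antiWickSymbol,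
      coe_antiWickFourier, coe_compSchwartz, compSymbolDeriv, compSymbol, neg_one_mul, neg_mul,
      neg_neg]
  change Complex.I / (ε : ℂ) * (weylMap ha hε.ne' (antiWickMap b hε ψ) q -
    antiWickMap b hε (weylMap ha hε.ne' ψ) q) = _
  rw [h1, h2, ← weylLinear_apply ε ψ q (_ • _), map_smul, commSymbol, map_sub, weylLinear_apply,
    weylLinear_apply, smul_eq_mul]

theorem isEssentiallySelfAdjoint_commutator {M : ℕ} {a : Phase d → ℝ} (ha : HasSymbolGrowth M a)
    (b : 𝓢(Phase d, ℝ)) {ε : ℝ} (hε : 0 < ε) :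
    IsEssentiallySelfAdjoint (onSchwartz ((Complex.I / (ε : ℂ)) •
      (weylMap ha hε.ne' ∘ₗ antiWickMap b hε - antiWickMap b hε ∘ₗ weylMap ha hε.ne'))) := by
  refine isEssentiallySelfAdjoint_onSchwartz
    (isSelfAdjoint_opL2 ε _ (conj_I_div_smul_commSymbol b ha hε.le)) fun ψ => Lp.ext ?_
  refine (SchwartzMap.coeFn_toLp _ 2 volume).trans (Filter.EventuallyEq.trans ?_
    (coeFn_opL2_toLp ε _ ψ).symm)
  exact Filter.Eventually.of_forall fun q => commutator_apply ha b hε ψ q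

end Expansion

end WeylCalculus

end

open WeylCalculus in
theorem mainTheorem5 (d : ℕ) (a : Phase d → ℝ) (ha : IsSubquadratic a) (b : 𝓢(Phase d, ℝ))
    (n : ℕ) :
    ∃ ρ : ℝ → 𝓢(Phase d, ℝ),
      (∃ C : ℝ, ∀ ε : ℝ, 0 < ε → ∃ R : L2 d →L[ℂ] L2 d,
        (∀ ψ : L2 d, ⇑(R ψ) =ᵐ[volume] weyl ε (fun z => (ρ ε z : ℂ)) ψ) ∧ ‖R‖ ≤ C) ∧
      ∀ ε : ℝ, 0 < ε → ∃ A B : 𝓢(Config d, ℂ) →ₗ[ℂ] 𝓢(Config d, ℂ),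
        (∀ ψ : 𝓢(Config d, ℂ), ⇑(A ψ) = weyl ε (fun z => (a z : ℂ)) ψ) ∧
        (∀ ψ : 𝓢(Config d, ℂ), ⇑(B ψ) = antiWick ε b ψ) ∧
        IsEssentiallySelfAdjoint (onSchwartz ((Complex.I / (ε : ℂ)) • (A ∘ₗ B - B ∘ₗ A))) ∧
        ∀ (ψ : 𝓢(Config d, ℂ)) (q : Config d),
          ((Complex.I / (ε : ℂ)) • (A ∘ₗ B - B ∘ₗ A)) ψ q =
            ∑ k ∈ Finset.range n, (ε : ℂ) ^ k * weyl ε (commTheta k a b) ψ q +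
              (ε : ℂ) ^ n * weyl ε (fun z => (ρ ε z : ℂ)) ψ q := by
  have hg := ha.hasSymbolGrowth
  obtain ⟨C₁, h₁⟩ := exists_norm_opL2_commRemainder_le_of_le_one n b hg
  obtain ⟨C₂, h₂⟩ := exists_norm_opL2_commRemainder_le_of_one_le n b ha
  -- The remainder symbol is real, so taking real parts loses nothing. For ε ≤ 0, where nothing is
  -- claimed, the family is set to 0.
  have hρ : ∀ ε (hε : 0 < ε), (fun z => (((if h : 0 < ε then reSchwartz (commRemainder n b hg h.le)
      else 0 : 𝓢(Phase d, ℝ)) z : ℝ) : ℂ)) = ⇑(commRemainder n b hg hε.le) := fun ε hε => by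
    ext1 z
    rw [dif_pos hε, ofReal_reSchwartz (conj_commRemainder n b hg hε.le)]
  refine ⟨fun ε => if h : 0 < ε then reSchwartz (commRemainder n b hg h.le) else 0,
    ⟨max C₁ C₂, fun ε hε => ⟨opL2 ε (commRemainder n b hg hε.le), fun ψ => ?_, ?_⟩⟩,
    fun ε hε => ⟨weylMap hg hε.ne', antiWickMap b hε, coe_weylMap hg hε.ne', fun ψ => ?_,
      isEssentiallySelfAdjoint_commutator hg b hε, fun ψ q => ?_⟩⟩
  · rw [hρ ε hε]
    exact coeFn_opL2 ε _ ψ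
  · rcases le_total ε 1 with h | h
    · exact (h₁ ε hε h).trans (le_max_left _ _)
    · exact (h₂ ε h).trans (le_max_right _ _)
  · rw [coe_antiWickMap, antiWick_eq_weyl b hε]
  · rw [hρ ε hε, commutator_apply hg b hε, ← weylLinear_apply, commSymbol_expansion n b hg hε,
      map_add, map_sum, map_smul]
    simp only [map_smul, ← coe_I_smul_commSymbol_eq_commTheta ha b, ← weylLinear_apply, smul_eq_mul]
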